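/- An instance of the unsplittable Euclidean capacitated vehicle routing problem consists of a depot $O$ and $n\ge 0$ terminals $v\in V$, each given by a point of the Euclidean plane with rational coordinates (locations may coincide), and of a rational demand $\mathrm{demand}(v)\in(0,1]$ for each terminal. A tour is a closed walk on $V\cup\{O\}$ that starts and ends at $O$; it covers some of the terminals that it visits, and its cost is its Euclidean length. A feasible solution is a finite collection of tours such that every terminal is covered exactly once, by a single tour, and the total demand of the terminals covered by each tour is at most $1$. The cost of a solution is the sum of the costs of its tours. Theorem. For every $\epsilon>0$ there is a deterministic algorithm that, given any instance in which every terminal has demand at least $\epsilon$, outputs a feasible solution whose cost is at most $(1+\epsilon)$ times the cost of every feasible solution. Its running time is bounded by a polynomial (which may depend on $\epsilon$) in the bit size of the instance, where numbers are written in binary and every elementary operation is charged the bit size of the data that it reads and writes. -/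

import Mathlib

/-! ### The problem -/

namespace CVRP

/-- The point of the Euclidean plane with the given rational coordinates. -/
noncomputable def toPlane (p : ℚ × ℚ) : EuclideanSpace ℝ (Fin 2) :=
  !₂[(p.1 : ℝ), (p.2 : ℝ)]

/-- An instance of the unsplittable Euclidean capacitated vehicle routing problem with `n`
terminals and tour capacity `1`, given by rational data. Distinct terminals may share a
location, and terminals may lie at the depot. -/
structure Instance where
  n : ℕ
  depot : ℚ × ℚ
  loc : Fin n → ℚ × ℚ
  demand : Fin n → ℚ
  demand_pos : ∀ v, 0 < demand v
  demand_le_one : ∀ v, demand v ≤ 1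

/-- A vertex is the depot (`none`) or a terminal (`some v`). -/
abbrev Vertex (n : ℕ) : Type := Option (Fin n)

/-- A tour starts at the depot, visits the vertices of `route` in this order, and returns to the
depot. It covers the terminals in `covered`; it may pass through further ones. -/
structure Tour (n : ℕ) where
  route : List (Vertex n)
  covered : List (Fin n)

/-- A solution is a finite collection of tours. -/
abbrev Solution (n : ℕ) : Type := List (Tour n)

/-- The length of the polygonal path through a list of points. -/
noncomputable def pathLength {X : Type*} [MetricSpace X] : List X → ℝ
  | [] => 0
  | [_] => 0
  | x :: y :: l => dist x y + pathLength (y :: l)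

namespace Instance

variable (I : Instance)

/-- The position of a vertex in the plane. -/
noncomputable def pos : Vertex I.n → EuclideanSpace ℝ (Fin 2)
  | none => toPlane I.depot
  | some v => toPlane (I.loc v)

/-- The length of the closed walk `O, route, O`. -/
noncomputable def tourCost (t : Tour I.n) : ℝ :=
  pathLength ((none :: (t.route ++ [none])).map I.pos)

/-- The total length of all tours. -/
noncomputable def cost (S : Solution I.n) : ℝ := (S.map I.tourCost).sum

/-- Feasibility: a tour covers only terminals that it visits, every terminal is covered exactly
once in the whole collection, and the demand covered by each tour is at most `1`. -/
structure Feasible (S : Solution I.n) : Prop where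
  visits : ∀ t ∈ S, ∀ v ∈ t.covered, some v ∈ t.route
  covers : ∀ v : Fin I.n, (S.flatMap Tour.covered).count v = 1
  capacity : ∀ t ∈ S, (t.covered.map I.demand).sum ≤ 1

/-- `S` is feasible and costs at most `ρ` times as much as every feasible solution. -/
def IsApprox (ρ : ℝ) (S : Solution I.n) : Prop :=
  I.Feasible S ∧ ∀ S' : Solution I.n, I.Feasible S' → I.cost S ≤ ρ * I.cost S'

/-- All terminals are big with respect to `ε`. -/
def AllBig (ε : ℝ) : Prop := ∀ v, ε ≤ (I.demand v : ℝ)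

end Instance

end CVRP

/-! ### The machine model

Deterministic programs on binary trees whose leaves hold rational numbers. Every basic operation
costs the bit size of the tree it reads plus the bit size of the tree it writes, so no value can be
larger than the input plus the time spent, and time is polynomially related to time on a Turing
machine. -/

namespace Machine

/-- Binary trees with rational leaves. -/
inductive Data : Type
  | atom (q : ℚ)
  | node (a b : Data)

namespace Data

/-- The bit size of a tree; numerators and denominators are counted in binary. -/
def size : Data → ℕ
  | atom q => 1 + q.num.natAbs.size + q.den.size
  | node a b => 1 + a.size + b.size

/-- The truth values are `0` and `1`. -/
def ofBool (b : Bool) : Data := atom (if b then 1 else 0)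

/-- Lists, with `0` as the end marker. -/
def ofList : List Data → Data
  | [] => atom 0
  | a :: l => node a (ofList l)

end Data

/-- The basic operations. The arithmetic ones act on a pair of leaves (`floor`: on one leaf). -/
inductive Op : Type
  | id
  | const (d : Data)
  | fst
  | snd
  | isNode
  | add
  | sub
  | mul
  | div
  | floor
  | le

open Data in
/-- The effect of a basic operation; the result is `0` if the argument has the wrong shape. -/
def Op.apply : Op → Data → Data
  | .id, x => x
  | .const d, _ => d
  | .fst, node a _ => a
  | .snd, node _ b => b
  | .isNode, node _ _ => ofBool true
  | .add, node (atom p) (atom q) => atom (p + q)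
  | .sub, node (atom p) (atom q) => atom (p - q)
  | .mul, node (atom p) (atom q) => atom (p * q)
  | .div, node (atom p) (atom q) => atom (p / q)
  | .floor, atom p => atom (⌊p⌋ : ℤ)
  | .le, node (atom p) (atom q) => ofBool (decide (p ≤ q))
  | _, _ => atom 0

/-- Programs: each one maps an input tree to an output tree. -/
inductive Program : Type
  | op (o : Op)
  | seq (f g : Program)
  | pair (f g : Program)
  | ite (c f g : Program)
  | while (c f : Program)

/-- `Run P x y t`: the program `P`, started on `x`, halts with output `y` after time `t`.
A condition holds if its value is not `0`. -/
inductive Run : Program → Data → Data → ℕ → Prop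
  | op (o : Op) (x : Data) :
      Run (.op o) x (o.apply x) (1 + x.size + (o.apply x).size)
  | seq {f g : Program} {x y z : Data} {s t : ℕ} :
      Run f x y s → Run g y z t → Run (.seq f g) x z (1 + s + t)
  | pair {f g : Program} {x y z : Data} {s t : ℕ} :
      Run f x y s → Run g x z t → Run (.pair f g) x (.node y z) (1 + s + t)
  | ite_true {c f g : Program} {x b y : Data} {s t : ℕ} :
      Run c x b s → b ≠ .atom 0 → Run f x y t → Run (.ite c f g) x y (1 + s + t)
  | ite_false {c f g : Program} {x y : Data} {s t : ℕ} :
      Run c x (.atom 0) s → Run g x y t → Run (.ite c f g) x y (1 + s + t)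
  | while_true {c f : Program} {x b y z : Data} {s t u : ℕ} :
      Run c x b s → b ≠ .atom 0 → Run f x y t → Run (.while c f) y z u →
      Run (.while c f) x z (1 + s + t + u)
  | while_false {c f : Program} {x : Data} {s : ℕ} :
      Run c x (.atom 0) s → Run (.while c f) x x (1 + s)

/-- Programs are deterministic: output and running time are determined by the input. -/
theorem Run.deterministic {P : Program} {x y : Data} {t : ℕ} (h : Run P x y t) :
    ∀ {y' : Data} {t' : ℕ}, Run P x y' t' → y = y' ∧ t = t' := by
  induction h with
  | op o x => intro y' t' h'; cases h'; exact ⟨rfl, rfl⟩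
  | seq _ _ ih₁ ih₂ =>
    intro y' t' h'
    cases h' with
    | seq a b =>
      obtain ⟨rfl, rfl⟩ := ih₁ a
      obtain ⟨rfl, rfl⟩ := ih₂ b
      exact ⟨rfl, rfl⟩
  | pair _ _ ih₁ ih₂ =>
    intro y' t' h'
    cases h' with
    | pair a b =>
      obtain ⟨rfl, rfl⟩ := ih₁ a
      obtain ⟨rfl, rfl⟩ := ih₂ b
      exact ⟨rfl, rfl⟩
  | ite_true _ hb _ ih₁ ih₂ =>
    intro y' t' h'
    cases h' with
    | ite_true a _ b =>
      obtain ⟨rfl, rfl⟩ := ih₁ a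
      obtain ⟨rfl, rfl⟩ := ih₂ b
      exact ⟨rfl, rfl⟩
    | ite_false a b => exact absurd (ih₁ a).1 hb
  | ite_false _ _ ih₁ ih₂ =>
    intro y' t' h'
    cases h' with
    | ite_true a hb b => exact absurd (ih₁ a).1.symm hb
    | ite_false a b =>
      obtain ⟨-, rfl⟩ := ih₁ a
      obtain ⟨rfl, rfl⟩ := ih₂ b
      exact ⟨rfl, rfl⟩
  | while_true _ hb _ _ ih₁ ih₂ ih₃ =>
    intro y' t' h'
    cases h' with
    | while_true a _ b c =>
      obtain ⟨rfl, rfl⟩ := ih₁ a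
      obtain ⟨rfl, rfl⟩ := ih₂ b
      obtain ⟨rfl, rfl⟩ := ih₃ c
      exact ⟨rfl, rfl⟩
    | while_false a => exact absurd (ih₁ a).1 hb
  | while_false _ ih₁ =>
    intro y' t' h'
    cases h' with
    | while_true a hb b c => exact absurd (ih₁ a).1.symm hb
    | while_false a =>
      obtain ⟨-, rfl⟩ := ih₁ a
      exact ⟨rfl, rfl⟩

end Machine

/-! ### Polynomial-time approximation algorithms -/

namespace CVRP

open Machine

/-- A point is written as the pair of its coordinates. -/
def encodePoint (p : ℚ × ℚ) : Data := .node (.atom p.1) (.atom p.2)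

/-- An instance is written as its depot followed by the list of its terminals, each of them as
location and demand. -/
def Instance.encode (I : Instance) : Data :=
  .node (encodePoint I.depot)
    (.ofList (List.ofFn fun v => .node (encodePoint (I.loc v)) (.atom (I.demand v))))

/-- The depot is written as `0` and the terminals as `1, …, n`. -/
def encodeVertex {n : ℕ} : Vertex n → Data
  | none => .atom 0
  | some v => .atom ((v : ℕ) + 1 : ℕ)

/-- A tour is written as the list of its stops and the list of the terminals that it covers. -/
def Tour.encode {n : ℕ} (t : Tour n) : Data :=
  .node (.ofList (t.route.map encodeVertex))
    (.ofList (t.covered.map fun v => encodeVertex (some v)))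

/-- A solution is written as the list of its tours. -/
def Solution.encode {n : ℕ} (S : Solution n) : Data := .ofList (S.map Tour.encode)

/-- `A` is a polynomial-time `ρ`-approximation algorithm for the instances with property `P`:
on each of them it halts within a time that is polynomial in the bit size of the
instance, and it outputs a feasible solution of cost at most `ρ` times the optimum. -/
def IsPolyTimeApproxAlgorithm (A : Program) (P : Instance → Prop) (ρ : ℝ) : Prop :=
  ∃ p : Polynomial ℕ, ∀ I : Instance, P I →
    ∃ (S : Solution I.n) (t : ℕ),
      Run A I.encode (Solution.encode S) t ∧ t ≤ p.eval I.encode.size ∧ I.IsApprox ρ S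

end CVRP

/-!
A tour through terminals of demand at least `ε` has at most `k = ⌈1 / ε⌉` stops, so its length is
at least `2 / k` times the sum of the distances of its terminals from the depot. A constant number
of errors that are small multiples of these distances is therefore affordable.

The plane is cut into annuli `K ^ i ≤ ‖p‖ < K ^ (i + 1)` (in the maximum norm) for a large constant
`K`. For one of the `K` residue classes of scales, serving the terminals in these annuli by tours of
their own costs at most a fraction `k / K` of the optimum. The remaining annuli form blocks whose
radii differ by a factor of at least `K`, so splitting all tours among the blocks increases the cost
only by a factor `1 + 2 * k / K`. In each block there are a constant number of annuli, and each
annulus is cut into a constant number of cells of relative size about `1 / K`.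

The terminals in a cell are sorted by decreasing demand and divided into at most `2 * K` classes of
equal size. In linear grouping each terminal is replaced by the one a class size further in this
order, which is nearby and has no larger demand; only the few terminals of the lowest ranks are not
used as a replacement, and they are served by tours of their own. A tour is thus determined, up to
an affordable error, by its configuration, which is the list of the cells and classes of its
terminals. There is a constant number of configurations, so the multiplicities with which they occur
can be enumerated in polynomial time. The lengths of tours are compared through rational
approximations of the norm from Newton's method.
-/

namespace Machine

open Polynomial

/-! ### Polynomial-time functions -/

theorem eval_le_eval (p : ℕ[X]) {m n : ℕ} (h : m ≤ n) : p.eval m ≤ p.eval n := by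
  simp only [Polynomial.eval_eq_sum]
  exact Finset.sum_le_sum fun i _ => Nat.mul_le_mul_left _ (Nat.pow_le_pow_left h i)

theorem Data.ofBool_true_ne : Data.ofBool true ≠ .atom 0 := by simp [Data.ofBool]

theorem Run.size_le {P : Program} {x y : Data} {t : ℕ} (h : Run P x y t) :
    x.size ≤ t ∧ y.size ≤ t := by
  induction h with
  | pair => simp only [Data.size]; omega
  | _ => omega

theorem Run.while_of_forall {R P : Program} {r p m : ℕ} {x : ℕ → Data}
    (hR : ∀ i < m, ∃ b ≠ Data.atom 0, ∃ t ≤ r, Run R (x i) b t)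
    (hP : ∀ i < m, ∃ t ≤ p, Run P (x i) (x (i + 1)) t)
    (hm : ∃ t ≤ r, Run R (x m) (.atom 0) t) :
    ∃ t ≤ (m + 1) * (1 + r + p), Run (.while R P) (x 0) (x m) t := by
  induction m generalizing x with
  | zero =>
    obtain ⟨t, ht, h⟩ := hm
    exact ⟨_, by omega, .while_false h⟩
  | succ m ih =>
    obtain ⟨b, hb, s, hs, hRun⟩ := hR 0 m.succ_pos
    obtain ⟨t, ht, hPun⟩ := hP 0 m.succ_pos
    obtain ⟨u, hu, hWhile⟩ := ih (x := fun i => x (i + 1))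
      (fun i hi => hR (i + 1) (by omega)) (fun i hi => hP (i + 1) (by omega)) hm
    refine ⟨_, ?_, .while_true hRun hb hPun hWhile⟩
    rw [Nat.add_mul (m + 1)]
    omega

/-- Types whose elements are written as trees, so that programs can compute with them. -/
class ToData (α : Type) where
  toData : α → Data

open ToData (toData)

/-- The bit size of the tree that represents an element. -/
def bitSize {α : Type} [ToData α] (a : α) : ℕ := (toData a).size

instance : ToData ℚ := ⟨.atom⟩
instance : ToData ℤ := ⟨fun z => .atom z⟩
instance : ToData ℕ := ⟨fun n => .atom n⟩
instance : ToData Bool := ⟨.ofBool⟩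

-- Predicates become functions into `Prop`, so that `fun_prop` also handles conditions.
open Classical in
noncomputable instance : ToData Prop := ⟨fun p => .ofBool (decide p)⟩

instance {α β : Type} [ToData α] [ToData β] : ToData (α × β) :=
  ⟨fun x => .node (toData x.1) (toData x.2)⟩

instance {α : Type} [ToData α] : ToData (List α) := ⟨fun l => .ofList (l.map toData)⟩

section BitSize

variable {α β : Type} [ToData α] [ToData β]

theorem bitSize_mk (a : α) (b : β) : bitSize (a, b) = 1 + bitSize a + bitSize b := rfl

theorem bitSize_prod (x : α × β) : bitSize x = 1 + bitSize x.1 + bitSize x.2 := rfl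

theorem bitSize_prop (p : Prop) : bitSize p ≤ 3 := by
  by_cases h : p <;> simp [bitSize, toData, Data.ofBool, Data.size, h]

theorem bitSize_nil : bitSize ([] : List α) = 2 := by
  simp [bitSize, toData, Data.ofList, Data.size]

theorem bitSize_cons (a : α) (l : List α) : bitSize (a :: l) = 1 + bitSize a + bitSize l := rfl

theorem bitSize_list (l : List α) : bitSize l = 2 + (l.map fun a => 1 + bitSize a).sum := by
  induction l with
  | nil => exact bitSize_nil
  | cons a l ih => rw [bitSize_cons, ih, List.map_cons, List.sum_cons]; omega

theorem bitSize_append (l m : List α) : bitSize (l ++ m) + 2 = bitSize l + bitSize m := by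
  simp only [bitSize_list, List.map_append, List.sum_append]; omega

theorem bitSize_append_le (l m : List α) : bitSize (l ++ m) ≤ bitSize l + bitSize m := by
  have := bitSize_append l m
  omega

theorem bitSize_eq_of_perm {l m : List α} (h : l.Perm m) : bitSize l = bitSize m := by
  rw [bitSize_list, bitSize_list, (h.map _).sum_eq]

theorem bitSize_le_of_sublist {l m : List α} (h : l.Sublist m) :
    bitSize l ≤ bitSize m := by
  rw [bitSize_list, bitSize_list]
  exact Nat.add_le_add_left ((h.map _).sum_le_sum fun _ _ => Nat.zero_le _) 2

theorem bitSize_le_of_mem {a : α} {l : List α} (h : a ∈ l) : bitSize a ≤ bitSize l := by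
  have := bitSize_le_of_sublist (List.singleton_sublist.2 h)
  rw [bitSize_cons] at this
  omega

theorem length_le_bitSize (l : List α) : l.length ≤ bitSize l := by
  induction l with
  | nil => simp
  | cons a l ih => rw [bitSize_cons, List.length_cons]; omega

theorem bitSize_iterate_le {f : α → α} {c : ℕ} (h : ∀ a, bitSize (f a) ≤ bitSize a + c)
    (n : ℕ) (a : α) : bitSize (f^[n] a) ≤ bitSize a + n * c := by
  induction n with
  | zero => simp
  | succ n ih =>
    have := h (f^[n] a)
    rw [Function.iterate_succ_apply', Nat.add_mul]
    omega

end BitSize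

/-- Natural numbers that are bounded by a polynomial in the bit size of the argument. -/
def PolyBounded {α : Type} [ToData α] (s : α → ℕ) : Prop :=
  ∃ p : ℕ[X], ∀ a, s a ≤ p.eval (bitSize a)

/-- Functions computed by a program in polynomial time. -/
@[fun_prop]
def PolyTime {α β : Type} [ToData α] [ToData β] (f : α → β) : Prop :=
  ∃ (P : Program) (t : α → ℕ), PolyBounded t ∧ ∀ a, Run P (toData a) (toData (f a)) (t a)

variable {α β γ δ σ : Type} [ToData α] [ToData β] [ToData γ] [ToData δ] [ToData σ]

namespace PolyBounded

theorem mono {s t : α → ℕ} (ht : PolyBounded t) (h : ∀ a, s a ≤ t a) : PolyBounded s := by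
  obtain ⟨p, hp⟩ := ht
  exact ⟨p, fun a => (h a).trans (hp a)⟩

theorem const (n : ℕ) : PolyBounded fun _ : α => n := ⟨C n, fun _ => by simp⟩

theorem bitSize : PolyBounded (bitSize : α → ℕ) := ⟨X, fun _ => by simp⟩

theorem add {s t : α → ℕ} (hs : PolyBounded s) (ht : PolyBounded t) :
    PolyBounded fun a => s a + t a := by
  obtain ⟨p, hp⟩ := hs
  obtain ⟨q, hq⟩ := ht
  exact ⟨p + q, fun a => by simpa using Nat.add_le_add (hp a) (hq a)⟩

theorem mul {s t : α → ℕ} (hs : PolyBounded s) (ht : PolyBounded t) :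
    PolyBounded fun a => s a * t a := by
  obtain ⟨p, hp⟩ := hs
  obtain ⟨q, hq⟩ := ht
  exact ⟨p * q, fun a => by simpa using Nat.mul_le_mul (hp a) (hq a)⟩

theorem eval {s : α → ℕ} (hs : PolyBounded s) (p : ℕ[X]) :
    PolyBounded fun a => p.eval (s a) := by
  obtain ⟨q, hq⟩ := hs
  exact ⟨p.comp q, fun a => by simpa using eval_le_eval p (hq a)⟩

end PolyBounded

namespace PolyTime

theorem polyBounded_bitSize {f : α → β} (hf : PolyTime f) :
    PolyBounded fun a => bitSize (f a) := by
  obtain ⟨P, t, ht, hP⟩ := hf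
  exact ht.mono fun a => (hP a).size_le.2

end PolyTime

theorem PolyBounded.comp {s : β → ℕ} {f : α → β} (hs : PolyBounded s) (hf : PolyTime f) :
    PolyBounded fun a => s (f a) := by
  obtain ⟨p, hp⟩ := hs
  exact (hf.polyBounded_bitSize.eval p).mono fun a => hp (f a)

namespace PolyTime

theorem of_run {f : α → β} (P : Program) {T : α → ℕ} (hT : PolyBounded T)
    (h : ∀ a, ∃ t ≤ T a, Run P (toData a) (toData (f a)) t) : PolyTime f := by
  choose t ht hP using h
  exact ⟨P, t, hT.mono ht, hP⟩

theorem of_op (o : Op) {f : α → β} (h : ∀ a, o.apply (toData a) = toData (f a))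
    (hf : PolyBounded fun a => bitSize (f a)) : PolyTime f :=
  ⟨.op o, _, ((PolyBounded.const 1).add .bitSize).add hf, fun a => by
    have := Run.op o (toData a)
    rwa [h] at this⟩

theorem of_toData_eq {f : α → β} (h : ∀ a, toData (f a) = toData a) : PolyTime f :=
  of_op .id (fun a => (h a).symm) (PolyBounded.bitSize.mono fun a => by rw [bitSize, h]; rfl)

theorem of_eq {f g : α → β} (hf : PolyTime f) (h : ∀ a, f a = g a) : PolyTime g :=
  funext h ▸ hf

@[fun_prop]
protected theorem id : PolyTime (fun a : α => a) := of_toData_eq fun _ => rfl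

@[fun_prop]
protected theorem const (b : β) : PolyTime (fun _ : α => b) :=
  of_op (.const (toData b)) (fun _ => rfl) (.const _)

@[fun_prop]
protected theorem comp {g : β → γ} {f : α → β} (hg : PolyTime g) (hf : PolyTime f) :
    PolyTime (fun a => g (f a)) := by
  obtain ⟨Q, t, ht, hQ⟩ := hg
  have htf := ht.comp hf
  obtain ⟨P, s, hs, hP⟩ := hf
  exact ⟨.seq P Q, _, ((PolyBounded.const 1).add hs).add htf, fun a => (hP a).seq (hQ (f a))⟩

@[fun_prop]
theorem prodMk {f : α → β} {g : α → γ} (hf : PolyTime f) (hg : PolyTime g) :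
    PolyTime (fun a => (f a, g a)) := by
  obtain ⟨P, s, hs, hP⟩ := hf
  obtain ⟨Q, t, ht, hQ⟩ := hg
  exact ⟨.pair P Q, _, ((PolyBounded.const 1).add hs).add ht, fun a => (hP a).pair (hQ a)⟩

@[fun_prop]
protected theorem fst : PolyTime (fun x : α × β => x.1) :=
  of_op .fst (fun _ => rfl) (PolyBounded.bitSize.mono fun x => by rw [bitSize_prod x]; omega)

@[fun_prop]
protected theorem snd : PolyTime (fun x : α × β => x.2) :=
  of_op .snd (fun _ => rfl) (PolyBounded.bitSize.mono fun x => by rw [bitSize_prod x]; omega)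

@[fun_prop]
protected theorem ite {p : α → Prop} [DecidablePred p] {f g : α → β} (hp : PolyTime p)
    (hf : PolyTime f) (hg : PolyTime g) : PolyTime (fun a => if p a then f a else g a) := by
  obtain ⟨R, r, hr, hR⟩ := hp
  obtain ⟨P, s, hs, hP⟩ := hf
  obtain ⟨Q, t, ht, hQ⟩ := hg
  refine of_run (.ite R P Q) ((((PolyBounded.const 1).add hr).add hs).add ht) fun a => ?_
  have hRa := hR a
  by_cases h : p a
  · rw [show toData (p a) = Data.ofBool true by simp [toData, h]] at hRa
    rw [if_pos h]
    exact ⟨_, by omega, .ite_true hRa Data.ofBool_true_ne (hP a)⟩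
  · rw [show toData (p a) = .atom 0 by simp [toData, h, Data.ofBool]] at hRa
    rw [if_neg h]
    exact ⟨_, by omega, .ite_false hRa (hQ a)⟩

@[fun_prop]
protected theorem decide {p : α → Prop} [DecidablePred p] (hp : PolyTime p) :
    PolyTime fun a => decide (p a) :=
  of_eq (hp.ite (.const true) (.const false)) fun a => by by_cases h : p a <;> simp [h]

open Classical in
@[fun_prop]
protected theorem not {p : α → Prop} (hp : PolyTime p) : PolyTime fun a => ¬p a :=
  of_eq (hp.ite (.const False) (.const True)) fun a => by by_cases h : p a <;> simp [h]

open Classical in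
@[fun_prop]
protected theorem and {p q : α → Prop} (hp : PolyTime p) (hq : PolyTime q) :
    PolyTime fun a => p a ∧ q a :=
  of_eq (hp.ite hq (.const False)) fun a => by by_cases h : p a <;> simp [h]

@[fun_prop]
protected theorem or {p q : α → Prop} (hp : PolyTime p) (hq : PolyTime q) :
    PolyTime fun a => p a ∨ q a :=
  of_eq (hp.not.and hq.not).not fun a => by rw [← not_or, not_not]

theorem iterate {f : δ → α → α} {g : δ → α} (hf : PolyTime fun x : δ × α => f x.1 x.2)
    (hg : PolyTime g) (n : ℕ) : PolyTime fun d => (f d)^[n] (g d) := by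
  induction n with
  | zero => exact hg
  | succ n ih =>
    exact of_eq (hf.comp (PolyTime.id.prodMk ih)) fun d => (Function.iterate_succ_apply' ..).symm

theorem iterate_while {c : α → Prop} {f : α → α} {g : δ → α} {n B : δ → ℕ} (hc : PolyTime c)
    (hf : PolyTime f) (hg : PolyTime g) (hn : PolyBounded n) (hB : PolyBounded B)
    (hle : ∀ d, ∀ i ≤ n d, bitSize (f^[i] (g d)) ≤ B d)
    (hlt : ∀ d, ∀ i < n d, c (f^[i] (g d))) (hend : ∀ d, ¬c (f^[n d] (g d))) :
    PolyTime fun d => f^[n d] (g d) := by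
  obtain ⟨R, r, ⟨p, hp⟩, hR⟩ := hc
  obtain ⟨P, s, ⟨q, hq⟩, hP⟩ := hf
  have hloop : PolyBounded fun d => (n d + 1) * (1 + p.eval (B d) + q.eval (B d)) :=
    (hn.add (.const 1)).mul (((PolyBounded.const 1).add (hB.eval p)).add (hB.eval q))
  obtain ⟨G, u, hu, hG⟩ := hg
  refine of_run (.seq G (.while R P)) (((PolyBounded.const 1).add hu).add hloop) fun d => ?_
  have hRle : ∀ i ≤ n d, r (f^[i] (g d)) ≤ p.eval (B d) := fun i hi =>
    (hp _).trans (eval_le_eval p (hle d i hi))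
  obtain ⟨t, ht, hrun⟩ := Run.while_of_forall (R := R) (P := P)
    (x := fun i => toData (f^[i] (g d))) (m := n d)
    (fun i hi => ⟨_, by simp [toData, hlt d i hi, Data.ofBool], _, hRle i hi.le, hR _⟩)
    (fun i hi => ⟨_, (hq _).trans (eval_le_eval q (hle d i hi.le)), by
      rw [Function.iterate_succ_apply']; exact hP _⟩)
    ⟨_, hRle _ le_rfl, by simpa [toData, hend d, Data.ofBool] using hR (f^[n d] (g d))⟩
  exact ⟨_, Nat.add_le_add_left ht _, (hG d).seq hrun⟩

/-! ### Lists -/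

@[fun_prop]
theorem list_cons {f : α → β} {g : α → List β} (hf : PolyTime f) (hg : PolyTime g) :
    PolyTime (fun a => f a :: g a) :=
  PolyTime.comp (of_toData_eq (f := fun x : β × List β => x.1 :: x.2) fun _ => rfl) (hf.prodMk hg)

@[fun_prop]
theorem list_eq_nil {l : δ → List α} (hl : PolyTime l) : PolyTime fun d => l d = [] := by
  have hnode : PolyTime fun l : List α => ¬l = [] :=
    of_op .isNode (fun l => by cases l <;> simp [toData, Data.ofList, Op.apply, Data.ofBool])
      ((PolyBounded.const 3).mono fun _ => bitSize_prop _)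
  exact of_eq (hnode.not.comp hl) fun d => propext not_not

theorem list_casesOn {l : δ → List α} {f : δ → β} {g : δ → α → List α → β} (hl : PolyTime l)
    (hf : PolyTime f) (hg : PolyTime fun x : δ × α × List α => g x.1 x.2.1 x.2.2) :
    PolyTime fun d => (List.casesOn (l d) (f d) (g d) : β) := by
  have hpair : PolyTime fun d => (d, l d) := by fun_prop
  have hsize := hpair.polyBounded_bitSize
  obtain ⟨C, r, hr, hC⟩ := hl.list_eq_nil
  obtain ⟨L, s, hs, hL⟩ := hpair
  obtain ⟨P, t, ht, hP⟩ := hf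
  obtain ⟨Q, u, ⟨q, hq⟩, hQ⟩ := hg
  refine of_run (.ite C P (.seq L Q))
    (((((PolyBounded.const 2).add hr).add hs).add ht).add (hsize.eval q)) fun d => ?_
  have hCd := hC d
  have hLd : Run L (toData d) (toData (d, l d)) (s d) := hL d
  cases hld : l d with
  | nil =>
    rw [show toData (l d = []) = Data.ofBool true by simp [toData, hld]] at hCd
    exact ⟨_, by omega, .ite_true hCd Data.ofBool_true_ne (hP d)⟩
  | cons a m =>
    rw [show toData (l d = []) = .atom 0 by simp [toData, hld, Data.ofBool]] at hCd
    rw [hld] at hLd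
    -- The pair `(d, a :: m)` and the triple `(d, a, m)` are represented by the same tree.
    have htime : u (d, a, m) ≤ q.eval (bitSize (d, a :: m)) := hq (d, a, m)
    exact ⟨_, by omega, .ite_false hCd (hLd.seq (hQ (d, a, m)))⟩

/-- One step in the evaluation of a fold: the state holds the environment, the accumulator and
the remaining list. -/
private def foldStep (step : γ → β → α → β) (x : γ × β × List α) : γ × β × List α :=
  List.casesOn x.2.2 x fun a l => (x.1, step x.1 x.2.1 a, l)

omit [ToData α] [ToData β] [ToData γ] in
private theorem iterate_foldStep (step : γ → β → α → β) (i : ℕ) (c : γ) (b : β) (l : List α) :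
    (foldStep step)^[i] (c, b, l) = (c, (l.take i).foldl (step c) b, l.drop i) := by
  induction i generalizing b l with
  | zero => simp
  | succ i ih => cases l <;> rw [Function.iterate_succ_apply] <;> simp [foldStep, ih]

theorem list_foldl {step : δ → β → α → β} {b : δ → β} {l : δ → List α} {B : δ → ℕ}
    (hstep : PolyTime fun x : δ × β × α => step x.1 x.2.1 x.2.2) (hb : PolyTime b)
    (hl : PolyTime l) (hB : PolyBounded B)
    (h : ∀ d m, m <+: l d → bitSize (m.foldl (step d) (b d)) ≤ B d) :
    PolyTime fun d => (l d).foldl (step d) (b d) := by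
  have hfoldStep : PolyTime (foldStep step) := by
    have := hstep.comp (f := fun y : (δ × β × List α) × α × List α => (y.1.1, y.1.2.1, y.2.1))
      (by fun_prop)
    exact list_casesOn (by fun_prop) (by fun_prop) (by fun_prop)
  have hloop := iterate_while (c := fun x : δ × β × List α => ¬x.2.2 = []) (by fun_prop)
    hfoldStep (g := fun d => (d, b d, l d)) (by fun_prop) (n := fun d => (l d).length)
    (hl.polyBounded_bitSize.mono fun d => length_le_bitSize (l d))
    (((PolyBounded.const 2).add .bitSize).add (hB.add hl.polyBounded_bitSize))
    (fun d i _ => by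
      rw [iterate_foldStep]
      have hacc := h d _ (List.take_prefix i (l d))
      have hrest := bitSize_le_of_sublist (List.drop_sublist i (l d))
      simp only [bitSize_mk]
      omega)
    (fun d i hi => by rw [iterate_foldStep]; simpa using hi)
    (fun d => by rw [iterate_foldStep]; simp)
  refine of_eq (PolyTime.fst.comp (PolyTime.snd.comp hloop)) fun d => ?_
  rw [iterate_foldStep]
  simp

@[fun_prop]
theorem list_reverse {l : δ → List α} (hl : PolyTime l) : PolyTime fun d => (l d).reverse := by
  refine of_eq (list_foldl (step := fun _ (b : List α) a => a :: b) (b := fun _ => [])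
    (by fun_prop) (by fun_prop) hl hl.polyBounded_bitSize fun d m hm => ?_) fun d => ?_
  · simpa [bitSize_eq_of_perm m.reverse_perm] using bitSize_le_of_sublist hm.sublist
  · simp

theorem list_foldr {step : δ → α → β → β} {b : δ → β} {l : δ → List α} {B : δ → ℕ}
    (hstep : PolyTime fun x : δ × α × β => step x.1 x.2.1 x.2.2) (hb : PolyTime b)
    (hl : PolyTime l) (hB : PolyBounded B)
    (h : ∀ d m, m <:+ l d → bitSize (m.foldr (step d) (b d)) ≤ B d) :
    PolyTime fun d => (l d).foldr (step d) (b d) := by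
  refine of_eq (list_foldl (step := fun d b a => step d a b)
    (hstep.comp (f := fun x : δ × β × α => (x.1, x.2.2, x.2.1)) (by fun_prop)) hb
    hl.list_reverse hB fun d m hm => ?_) fun d => List.foldl_reverse
  rw [← List.foldr_reverse]
  exact h d _ (by simpa using hm.reverse)

theorem list_foldr_of_bitSize_le_add {step : δ → α → β → β} {b : δ → β} {l : δ → List α}
    {B : δ × α → ℕ} (hstep : PolyTime fun x : δ × α × β => step x.1 x.2.1 x.2.2)
    (hb : PolyTime b) (hl : PolyTime l) (hB : PolyBounded B)
    (h : ∀ d a b, bitSize (step d a b) ≤ bitSize b + B (d, a)) :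
    PolyTime fun d => (l d).foldr (step d) (b d) := by
  obtain ⟨p, hp⟩ := hB
  have hsize := (PolyBounded.const 1).add (PolyBounded.bitSize.add hl.polyBounded_bitSize)
  refine list_foldr hstep hb hl (hb.polyBounded_bitSize.add
    (hl.polyBounded_bitSize.mul (hsize.eval p))) fun d m hm => ?_
  have hfold : bitSize (m.foldr (step d) (b d)) ≤
      bitSize (b d) + m.length * p.eval (1 + (bitSize d + bitSize (l d))) := by
    induction m with
    | nil => simp
    | cons a m ih =>
      have ha := bitSize_le_of_mem (hm.subset List.mem_cons_self)
      have hstep := (h d a (m.foldr (step d) (b d))).trans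
        (Nat.add_le_add_left ((hp (d, a)).trans (eval_le_eval p
          (n := 1 + (bitSize d + bitSize (l d))) (by rw [bitSize_mk]; omega))) _)
      have := ih ((List.suffix_cons a m).trans hm)
      rw [List.foldr_cons, List.length_cons, Nat.add_mul]
      omega
  refine hfold.trans (Nat.add_le_add_left (Nat.mul_le_mul_right _ ?_) _)
  exact hm.length_le.trans (length_le_bitSize _)

@[fun_prop]
theorem list_append {l m : δ → List α} (hl : PolyTime l) (hm : PolyTime m) :
    PolyTime fun d => l d ++ m d :=
  of_eq (list_foldr_of_bitSize_le_add (step := fun _ a (b : List α) => a :: b) (by fun_prop) hm hl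
    (B := fun x => 1 + bitSize x.2)
    ((PolyBounded.const 1).add (PolyTime.polyBounded_bitSize (by fun_prop)))
    fun d a b => by simp only [bitSize_cons]; omega) fun d => by simp

@[fun_prop]
theorem list_flatten {l : δ → List (List α)} (hl : PolyTime l) :
    PolyTime fun d => (l d).flatten := by
  refine of_eq (list_foldr_of_bitSize_le_add (step := fun _ (a : List α) b => a ++ b)
    (b := fun _ => []) (by fun_prop) (by fun_prop) hl (B := fun x => bitSize x.2)
    (PolyTime.polyBounded_bitSize (by fun_prop))
    fun d a b => by rw [Nat.add_comm]; exact bitSize_append_le a b) fun d => ?_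
  induction l d with
  | nil => rfl
  | cons a l ih => rw [List.foldr_cons, ih, List.flatten_cons]

@[fun_prop]
theorem list_map {g : δ → α → β} {l : δ → List α} (hg : PolyTime fun x : δ × α => g x.1 x.2)
    (hl : PolyTime l) : PolyTime fun d => (l d).map (g d) := by
  have hcons : PolyTime fun x : δ × α × List β => g x.1 x.2.1 :: x.2.2 := by
    have := hg.comp (f := fun x : δ × α × List β => (x.1, x.2.1)) (by fun_prop)
    fun_prop
  exact of_eq (list_foldr_of_bitSize_le_add hcons (.const []) hl
    ((PolyBounded.const 1).add hg.polyBounded_bitSize)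
    fun d a b => by simp only [bitSize_cons]; omega) fun d => List.map_eq_foldr.symm

@[fun_prop]
theorem list_flatMap {g : δ → α → List β} {l : δ → List α}
    (hg : PolyTime fun x : δ × α => g x.1 x.2) (hl : PolyTime l) :
    PolyTime fun d => (l d).flatMap (g d) :=
  of_eq (list_map hg hl).list_flatten fun _ => List.flatMap_def.symm

@[fun_prop]
theorem eq_true {b : α → Bool} (hb : PolyTime b) : PolyTime fun a => b a = true :=
  PolyTime.comp (of_toData_eq (f := fun b : Bool => b = true) fun b => by cases b <;> simp [toData])
    hb

@[fun_prop]
theorem list_filter {g : δ → α → Bool} {l : δ → List α} (hg : PolyTime fun x : δ × α => g x.1 x.2)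
    (hl : PolyTime l) : PolyTime fun d => (l d).filter (g d) := by
  have hstep : PolyTime fun x : δ × α × List α =>
      if g x.1 x.2.1 = true then x.2.1 :: x.2.2 else x.2.2 := by
    have := hg.comp (f := fun x : δ × α × List α => (x.1, x.2.1)) (by fun_prop)
    fun_prop
  have hfilter (d : δ) (m : List α) :
      m.foldr (fun a b => if g d a = true then a :: b else b) [] = m.filter (g d) := by
    rw [List.filter_eq_foldr]
    simp only [Bool.cond_eq_ite]
  refine of_eq (list_foldr hstep (.const []) hl hl.polyBounded_bitSize fun d m hm => ?_)
    fun d => hfilter d _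
  rw [hfilter]
  exact bitSize_le_of_sublist (List.filter_sublist.trans hm.sublist)

omit [ToData α] in
private theorem bitSize_mapAccumr_snd_le {f : α → σ → σ × β} {s : σ} {C : ℕ} {l : List α}
    (h : ∀ m a, a :: m <:+ l → bitSize (f a (m.mapAccumr f s).1) ≤ C) :
    bitSize (l.mapAccumr f s).2 ≤ 2 + l.length * (1 + C) := by
  induction l with
  | nil => simp [List.mapAccumr, bitSize_nil]
  | cons a l ih =>
    have hvalue := h l a List.suffix_rfl
    have := ih fun m b hm => h m b (hm.trans (List.suffix_cons a l))
    rw [bitSize_prod] at hvalue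
    simp only [List.mapAccumr, bitSize_cons, List.length_cons, Nat.add_mul]
    omega

theorem list_mapAccumr {f : δ → α → σ → σ × β} {l : δ → List α} {s : δ → σ} {B : δ → ℕ}
    (hf : PolyTime fun x : δ × α × σ => f x.1 x.2.1 x.2.2) (hl : PolyTime l) (hs : PolyTime s)
    (hB : PolyBounded B) (h : ∀ d m, m <:+ l d → bitSize (m.mapAccumr (f d) (s d)).1 ≤ B d) :
    PolyTime fun d => (l d).mapAccumr (f d) (s d) := by
  obtain ⟨p, hp⟩ := hf.polyBounded_bitSize
  have hstep : PolyTime fun x : δ × α × σ × List β =>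
      ((f x.1 x.2.1 x.2.2.1).1, (f x.1 x.2.1 x.2.2.1).2 :: x.2.2.2) := by
    have := hf.comp (f := fun x : δ × α × σ × List β => (x.1, x.2.1, x.2.2.1)) (by fun_prop)
    fun_prop
  let C (d : δ) : ℕ := p.eval (2 + (bitSize d + (bitSize (l d) + B d)))
  have hC : PolyBounded C := ((PolyBounded.const 2).add
    (PolyBounded.bitSize.add (hl.polyBounded_bitSize.add hB))).eval p
  refine of_eq (list_foldr (step := fun d a r => ((f d a r.1).1, (f d a r.1).2 :: r.2)) hstep
    (hs.prodMk (.const [])) hl (((PolyBounded.const 3).add hB).add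
      (hl.polyBounded_bitSize.mul ((PolyBounded.const 1).add hC))) fun d m hm => ?_)
    fun d => (List.mapAccumr_eq_foldr ..).symm
  rw [← List.mapAccumr_eq_foldr, bitSize_prod]
  have houtput := bitSize_mapAccumr_snd_le (l := m) (f := f d) (s := s d) (C := C d)
    fun m' a hm' => by
      have hstate := h d m' ((List.suffix_cons a m').trans (hm'.trans hm))
      have ha := bitSize_le_of_mem (hm.subset (hm'.subset List.mem_cons_self))
      exact (hp (d, a, (m'.mapAccumr (f d) (s d)).1)).trans
        (eval_le_eval p (by simp only [bitSize_mk]; omega))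
  have hlength := Nat.mul_le_mul_right (1 + C d) (hm.length_le.trans (length_le_bitSize (l d)))
  have hstate := h d m hm
  omega

theorem list_iterate {f : α → α} {s : δ → α} {l : δ → List β} {c : ℕ} (hf : PolyTime f)
    (hs : PolyTime s) (hl : PolyTime l) (hc : ∀ a, bitSize (f a) ≤ bitSize a + c) :
    PolyTime fun d => List.iterate f (s d) ((l d).length + 1) := by
  have hmap (m : List β) (a : α) : m.mapAccumr (fun _ a => (f a, a)) a =
      (f^[m.length] a, (List.iterate f a m.length).reverse) := by
    induction m with
    | nil => rfl
    | cons b m ih =>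
      rw [List.mapAccumr, ih, List.length_cons, List.iterate_add, Function.iterate_succ_apply']
      simp [List.iterate]
  have hstates : PolyTime fun d => (l d).mapAccumr (fun _ a => (f a, a)) (s d) := by
    refine list_mapAccumr (f := fun _ _ a => (f a, a)) (by fun_prop) hl hs
      (hs.polyBounded_bitSize.add (hl.polyBounded_bitSize.mul (.const c))) fun d m hm => ?_
    rw [hmap]
    exact (bitSize_iterate_le hc _ _).trans (Nat.add_le_add_left (Nat.mul_le_mul_right c
      (hm.length_le.trans (length_le_bitSize _))) _)
  have hrev : PolyTime fun x : α × List α => x.2.reverse ++ [x.1] := by fun_prop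
  refine of_eq (hrev.comp hstates) fun d => ?_
  rw [hmap, List.reverse_reverse, List.iterate_add]
  rfl

theorem list_foldr_const {ι : Type} {L : List ι} {f : ι → α → α} (hf : ∀ i, PolyTime (f i)) :
    PolyTime fun a => L.foldr f a := by
  induction L with
  | nil => exact .id
  | cons i L ih => exact (hf i).comp ih

theorem list_map_const {ι : Type} {L : List ι} {f : ι → α → β} (hf : ∀ i, PolyTime (f i)) :
    PolyTime fun a => L.map fun i => f i a := by
  induction L with
  | nil => exact .const []
  | cons i L ih => exact (hf i).list_cons ih

end PolyTime

/-! ### Arithmetic -/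

section BitSize

theorem bitSize_rat (q : ℚ) : bitSize q = 1 + q.num.natAbs.size + q.den.size := rfl

theorem bitSize_int (z : ℤ) : bitSize z = 2 + z.natAbs.size := by
  change 1 + (z : ℚ).num.natAbs.size + (z : ℚ).den.size = _
  simp only [Rat.num_intCast, Rat.den_intCast, Nat.size_one]
  omega

theorem bitSize_nat (n : ℕ) : bitSize n = 2 + n.size := bitSize_int n

theorem size_mul_le (a b : ℕ) : (a * b).size ≤ a.size + b.size := by
  rw [Nat.size_le, pow_add]
  exact Nat.mul_lt_mul'' (Nat.lt_size_self a) (Nat.lt_size_self b)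

theorem size_add_le (a b : ℕ) : (a + b).size ≤ max a.size b.size + 1 := by
  rw [Nat.size_le, pow_succ]
  have ha := (Nat.lt_size_self a).trans_le
    (Nat.pow_le_pow_right two_pos (le_max_left a.size b.size))
  have hb := (Nat.lt_size_self b).trans_le
    (Nat.pow_le_pow_right two_pos (le_max_right a.size b.size))
  omega

theorem size_le_self (n : ℕ) : n.size ≤ n := Nat.size_le.2 Nat.lt_two_pow_self

theorem size_num_den_div_le (a : ℤ) {b : ℤ} (hb : b ≠ 0) :
    ((a : ℚ) / b).num.natAbs.size ≤ a.natAbs.size ∧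
      ((a : ℚ) / b).den.size ≤ b.natAbs.size := by
  rw [← Rat.divInt_eq_div]
  refine ⟨Nat.size_le_size ?_, Nat.size_le_size ?_⟩
  · rcases eq_or_ne a 0 with rfl | ha
    · simp
    · exact Nat.le_of_dvd (Int.natAbs_pos.2 ha) (Int.natAbs_dvd_natAbs.2 (Rat.num_dvd a hb))
  · exact Nat.le_of_dvd (Int.natAbs_pos.2 hb) (Int.natCast_dvd.1 (Rat.den_dvd a b))

theorem size_num_den_add_le (p q : ℚ) :
    (p + q).num.natAbs.size ≤
      max (p.num.natAbs.size + q.den.size) (q.num.natAbs.size + p.den.size) + 1 ∧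
    (p + q).den.size ≤ p.den.size + q.den.size := by
  have hp : (p.den : ℚ) ≠ 0 := by simp
  have hq : (q.den : ℚ) ≠ 0 := by simp
  have h : p + q = ((p.num * q.den + q.num * p.den : ℤ) : ℚ) / ((p.den * q.den : ℤ) : ℚ) := by
    conv_lhs => rw [← Rat.num_div_den p, ← Rat.num_div_den q, div_add_div _ _ hp hq]
    push_cast
    ring
  obtain ⟨hnum, hden⟩ := size_num_den_div_le (p.num * q.den + q.num * p.den)
    (b := p.den * q.den) (by positivity)
  rw [← h] at hnum hden
  have hnum' := hnum.trans ((Nat.size_le_size (Int.natAbs_add_le _ _)).trans (size_add_le _ _))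
  have hpq := size_mul_le p.num.natAbs q.den
  have hqp := size_mul_le q.num.natAbs p.den
  have hdd := size_mul_le p.den q.den
  simp only [Int.natAbs_mul, Int.natAbs_natCast] at hnum' hden
  omega

theorem bitSize_rat_add_le (p q : ℚ) : bitSize (p + q) ≤ 2 * (bitSize p + bitSize q) := by
  have := size_num_den_add_le p q
  simp only [bitSize_rat]
  omega

theorem bitSize_rat_mul_le (p q : ℚ) : bitSize (p * q) ≤ bitSize p + bitSize q := by
  have h : p * q = ((p.num * q.num : ℤ) : ℚ) / ((p.den * q.den : ℤ) : ℚ) := by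
    conv_lhs => rw [← Rat.num_div_den p, ← Rat.num_div_den q]
    push_cast
    rw [div_mul_div_comm]
  obtain ⟨hnum, hden⟩ := size_num_den_div_le (p.num * q.num) (b := p.den * q.den) (by positivity)
  rw [← h, Int.natAbs_mul] at hnum hden
  have hnn := size_mul_le p.num.natAbs q.num.natAbs
  have hdd := size_mul_le p.den q.den
  simp only [bitSize_rat, Int.natAbs_natCast] at *
  omega

theorem bitSize_rat_inv_le (p : ℚ) : bitSize p⁻¹ ≤ bitSize p + 1 := by
  rcases eq_or_ne p 0 with rfl | hp
  · simp
  have h : p⁻¹ = ((p.den : ℤ) : ℚ) / ((p.num : ℤ) : ℚ) := by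
    conv_lhs => rw [← Rat.num_div_den p, inv_div]
    simp
  obtain ⟨hnum, hden⟩ := size_num_den_div_le (p.den : ℤ) (b := p.num) (by simpa using hp)
  rw [← h] at hnum hden
  simp only [bitSize_rat, Int.natAbs_natCast] at *
  omega

theorem bitSize_rat_div_le (p q : ℚ) : bitSize (p / q) ≤ bitSize p + bitSize q + 1 := by
  have hmul := bitSize_rat_mul_le p q⁻¹
  have hinv := bitSize_rat_inv_le q
  rw [div_eq_mul_inv]
  omega

theorem bitSize_floor_le (q : ℚ) : bitSize ⌊q⌋ ≤ bitSize q + 1 := by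
  have := Nat.size_le_size (Int.natAbs_ediv_le_natAbs q.num q.den)
  rw [bitSize_int, bitSize_rat, Rat.floor_def']
  omega

theorem bitSize_int_add_le (y z : ℤ) : bitSize (y + z) ≤ bitSize y + bitSize z := by
  have h := Nat.size_le_size (Int.natAbs_add_le y z)
  have hadd := size_add_le y.natAbs z.natAbs
  simp only [bitSize_int]
  omega

theorem size_num_den_sum_le (l : List ℚ) :
    l.sum.num.natAbs.size ≤ bitSize l ∧ l.sum.den.size ≤ bitSize l := by
  induction l with
  | nil => simp [bitSize_nil]
  | cons a l ih =>
    have hadd := size_num_den_add_le a l.sum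
    have ha := bitSize_rat a
    rw [List.sum_cons, bitSize_cons]
    omega

theorem bitSize_sum_le (l : List ℚ) : bitSize l.sum ≤ 1 + 2 * bitSize l := by
  have := size_num_den_sum_le l
  rw [bitSize_rat]
  omega

theorem lt_pow_size {K : ℕ} (hK : 1 < K) (n : ℕ) : n < K ^ n.size :=
  (Nat.lt_size_self n).trans_le (Nat.pow_le_pow_left hK _)

theorem log_lt_size_num {K : ℕ} (hK : 1 < K) {q : ℚ} (hq : 0 < q) :
    Int.log K q < (q.num.natAbs.size : ℤ) := by
  have hnum : ((q.num.natAbs : ℤ) : ℚ) = q.num := by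
    rw [Int.natCast_natAbs, abs_of_nonneg (Rat.num_nonneg.2 hq.le)]
  have hden : (1 : ℚ) ≤ q.den := by exact_mod_cast q.den_pos
  rw [← Int.lt_zpow_iff_log_lt hK hq, zpow_natCast]
  calc q = q.num / q.den := (Rat.num_div_den q).symm
    _ ≤ q.num := div_le_self (by exact_mod_cast Rat.num_nonneg.2 hq.le) hden
    _ = q.num.natAbs := by rw [← hnum, Int.cast_natCast]
    _ < (K : ℚ) ^ q.num.natAbs.size := by exact_mod_cast lt_pow_size hK _

theorem neg_size_den_le_log {K : ℕ} (hK : 1 < K) {q : ℚ} (hq : 0 < q) :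
    -(q.den.size : ℤ) ≤ Int.log K q := by
  have hden : (0 : ℚ) < q.den := by exact_mod_cast q.den_pos
  have hnum : (1 : ℚ) ≤ q.num := by exact_mod_cast Rat.num_pos.2 hq
  rw [← Int.zpow_le_iff_le_log hK hq, zpow_neg, zpow_natCast]
  calc ((K : ℚ) ^ q.den.size)⁻¹ ≤ (q.den : ℚ)⁻¹ :=
        inv_anti₀ hden (by exact_mod_cast (lt_pow_size hK _).le)
    _ ≤ q.num / q.den := by rw [inv_eq_one_div]; gcongr
    _ = q := Rat.num_div_den q

theorem natAbs_log_le_bitSize {K : ℕ} (hK : 1 < K) (q : ℚ) :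
    (Int.log K q).natAbs ≤ bitSize q := by
  rcases le_or_gt q 0 with hq | hq
  · simp [Int.log_of_right_le_zero K hq]
  have hupper := log_lt_size_num hK hq
  have hlower := neg_size_den_le_log hK hq
  rw [bitSize_rat]
  omega

end BitSize

namespace PolyTime

variable {α β δ : Type} [ToData α] [ToData β] [ToData δ]

@[fun_prop]
theorem rat_add {f g : δ → ℚ} (hf : PolyTime f) (hg : PolyTime g) :
    PolyTime fun d => f d + g d := by
  have hadd : PolyTime fun x : ℚ × ℚ => x.1 + x.2 :=
    of_op .add (fun _ => rfl) (((PolyBounded.const 2).mul .bitSize).mono fun x =>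
      (bitSize_rat_add_le x.1 x.2).trans
        (Nat.mul_le_mul_left 2 (by rw [bitSize_prod x]; omega)))
  exact hadd.comp (hf.prodMk hg)

@[fun_prop]
theorem rat_mul {f g : δ → ℚ} (hf : PolyTime f) (hg : PolyTime g) :
    PolyTime fun d => f d * g d := by
  have hmul : PolyTime fun x : ℚ × ℚ => x.1 * x.2 :=
    of_op .mul (fun _ => rfl) (PolyBounded.bitSize.mono fun x =>
      (bitSize_rat_mul_le x.1 x.2).trans (by rw [bitSize_prod x]; omega))
  exact hmul.comp (hf.prodMk hg)

@[fun_prop]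
theorem rat_div {f g : δ → ℚ} (hf : PolyTime f) (hg : PolyTime g) :
    PolyTime fun d => f d / g d := by
  have hdiv : PolyTime fun x : ℚ × ℚ => x.1 / x.2 :=
    of_op .div (fun _ => rfl) (PolyBounded.bitSize.mono fun x =>
      (bitSize_rat_div_le x.1 x.2).trans (by rw [bitSize_prod x]; omega))
  exact hdiv.comp (hf.prodMk hg)

@[fun_prop]
theorem rat_neg {f : δ → ℚ} (hf : PolyTime f) : PolyTime fun d => -f d :=
  of_eq ((PolyTime.const (-1)).rat_mul hf) fun _ => neg_one_mul _

@[fun_prop]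
theorem rat_sub {f g : δ → ℚ} (hf : PolyTime f) (hg : PolyTime g) : PolyTime fun d => f d - g d :=
  of_eq (hf.rat_add hg.rat_neg) fun _ => (sub_eq_add_neg _ _).symm

@[fun_prop]
theorem floor {f : δ → ℚ} (hf : PolyTime f) : PolyTime fun d => ⌊f d⌋ := by
  have hfloor : PolyTime fun q : ℚ => ⌊q⌋ :=
    of_op .floor (fun _ => rfl) ((PolyBounded.bitSize.add (.const 1)).mono bitSize_floor_le)
  exact hfloor.comp hf

@[fun_prop]
theorem rat_le {f g : δ → ℚ} (hf : PolyTime f) (hg : PolyTime g) : PolyTime fun d => f d ≤ g d := by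
  have hle : PolyTime fun x : ℚ × ℚ => x.1 ≤ x.2 :=
    of_op .le (fun x => by by_cases h : x.1 ≤ x.2 <;> simp [toData, Op.apply, h])
      ((PolyBounded.const 3).mono fun _ => bitSize_prop _)
  exact hle.comp (hf.prodMk hg)

@[fun_prop]
theorem rat_lt {f g : δ → ℚ} (hf : PolyTime f) (hg : PolyTime g) : PolyTime fun d => f d < g d :=
  of_eq (hg.rat_le hf).not fun _ => propext not_le

@[fun_prop]
theorem rat_max {f g : δ → ℚ} (hf : PolyTime f) (hg : PolyTime g) :
    PolyTime fun d => max (f d) (g d) :=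
  of_eq ((hf.rat_le hg).ite hg hf) fun _ => (max_def _ _).symm

@[fun_prop]
theorem abs {f : δ → ℚ} (hf : PolyTime f) : PolyTime fun d => |f d| := hf.rat_max hf.rat_neg

-- Integers and natural numbers are written as rational numbers, so the casts are computed by the
-- same programs.
@[fun_prop]
theorem intCast {f : δ → ℤ} (hf : PolyTime f) : PolyTime fun d => (f d : ℚ) := hf

@[fun_prop]
theorem natCast {f : δ → ℕ} (hf : PolyTime f) : PolyTime fun d => (f d : ℚ) := hf

theorem of_intCast {f : δ → ℤ} (hf : PolyTime fun d => (f d : ℚ)) : PolyTime f := hf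

theorem of_natCast {f : δ → ℕ} (hf : PolyTime fun d => (f d : ℚ)) : PolyTime f := hf

@[fun_prop]
theorem int_add {f g : δ → ℤ} (hf : PolyTime f) (hg : PolyTime g) : PolyTime fun d => f d + g d :=
  of_intCast (by push_cast; fun_prop)

@[fun_prop]
theorem int_sub {f g : δ → ℤ} (hf : PolyTime f) (hg : PolyTime g) : PolyTime fun d => f d - g d :=
  of_intCast (by push_cast; fun_prop)

@[fun_prop]
theorem int_div_natCast {f : δ → ℤ} (hf : PolyTime f) (n : ℕ) : PolyTime fun d => f d / (n : ℤ) :=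
  of_eq (f := fun d => ⌊(f d : ℚ) / (n : ℚ)⌋) (by fun_prop)
    fun _ => Rat.floor_intCast_div_natCast _ _

@[fun_prop]
theorem int_mod_natCast {f : δ → ℤ} (hf : PolyTime f) (n : ℕ) : PolyTime fun d => f d % (n : ℤ) :=
  of_eq (f := fun d => f d - ⌊(f d / (n : ℤ) : ℤ) * (n : ℚ)⌋) (by fun_prop) fun d => by
    rw [Int.emod_def, mul_comm (n : ℤ)]
    norm_cast

@[fun_prop]
theorem nat_add {f g : δ → ℕ} (hf : PolyTime f) (hg : PolyTime g) : PolyTime fun d => f d + g d :=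
  of_natCast (by push_cast; fun_prop)

@[fun_prop]
theorem nat_max {f g : δ → ℕ} (hf : PolyTime f) (hg : PolyTime g) :
    PolyTime fun d => max (f d) (g d) :=
  of_natCast (by push_cast; fun_prop)

@[fun_prop]
theorem nat_div {f g : δ → ℕ} (hf : PolyTime f) (hg : PolyTime g) :
    PolyTime fun d => f d / g d := by
  have hfloor : PolyTime fun d => ((⌊(f d : ℚ) / (g d : ℚ)⌋ : ℤ) : ℚ) := by fun_prop
  refine of_natCast (of_eq hfloor fun d => ?_)
  have := Rat.floor_intCast_div_natCast (f d : ℤ) (g d)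
  push_cast at this
  rw [this]
  norm_cast

@[fun_prop]
theorem nat_lt {f g : δ → ℕ} (hf : PolyTime f) (hg : PolyTime g) : PolyTime fun d => f d < g d := by
  have hcast : PolyTime fun d => (f d : ℚ) < (g d : ℚ) := by fun_prop
  exact of_eq hcast fun d => propext Nat.cast_lt

theorem eq_of_injective {f : α → β} (hinj : f.Injective) (hf : PolyTime f)
    (hβ : PolyTime fun x : β × β => x.1 = x.2) : PolyTime fun x : α × α => x.1 = x.2 :=
  of_eq (hβ.comp (f := fun x : α × α => (f x.1, f x.2)) (by fun_prop))
    fun _ => propext hinj.eq_iff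

end PolyTime

/-- Types with an equality test that runs in polynomial time. -/
class PolyTimeEq (α : Type) [ToData α] : Prop where
  polyTime_eq : PolyTime fun x : α × α => x.1 = x.2

instance : PolyTimeEq ℚ :=
  ⟨PolyTime.of_eq (f := fun x : ℚ × ℚ => x.1 ≤ x.2 ∧ x.2 ≤ x.1) (by fun_prop)
    fun _ => propext le_antisymm_iff.symm⟩

instance : PolyTimeEq ℤ :=
  ⟨PolyTime.eq_of_injective Int.cast_injective (by fun_prop) (PolyTimeEq.polyTime_eq (α := ℚ))⟩

instance : PolyTimeEq ℕ :=
  ⟨PolyTime.eq_of_injective Nat.cast_injective (by fun_prop) (PolyTimeEq.polyTime_eq (α := ℚ))⟩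

variable {α β δ : Type} [ToData α] [ToData β] [ToData δ]

@[fun_prop]
theorem PolyTime.eq [PolyTimeEq α] {f g : δ → α} (hf : PolyTime f) (hg : PolyTime g) :
    PolyTime fun d => f d = g d :=
  PolyTimeEq.polyTime_eq.comp (hf.prodMk hg)

instance [PolyTimeEq α] [PolyTimeEq β] : PolyTimeEq (α × β) :=
  ⟨PolyTime.of_eq (f := fun x : (α × β) × (α × β) => x.1.1 = x.2.1 ∧ x.1.2 = x.2.2) (by fun_prop)
    fun _ => propext Prod.ext_iff.symm⟩

namespace PolyTime

@[fun_prop]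
theorem list_length {l : δ → List α} (hl : PolyTime l) : PolyTime fun d => (l d).length := by
  have hfold (m : List α) : m.foldr (fun _ n => n + 1) 0 = m.length := by
    induction m with
    | nil => rfl
    | cons a m ih => rw [List.foldr_cons, ih, List.length_cons]
  refine of_eq (list_foldr (step := fun _ _ (n : ℕ) => n + 1) (by fun_prop) (.const 0) hl
    ((PolyBounded.const 2).add hl.polyBounded_bitSize) fun d m hm => ?_) fun d => hfold _
  rw [hfold, bitSize_nat]
  exact Nat.add_le_add_left ((size_le_self _).trans (hm.length_le.trans (length_le_bitSize _))) 2

@[fun_prop]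
theorem list_countP {p : δ → α → Bool} {l : δ → List α} (hp : PolyTime fun x : δ × α => p x.1 x.2)
    (hl : PolyTime l) : PolyTime fun d => (l d).countP (p d) :=
  of_eq (list_filter hp hl).list_length fun _ => List.countP_eq_length_filter.symm

@[fun_prop]
theorem list_sum {l : δ → List ℚ} (hl : PolyTime l) : PolyTime fun d => (l d).sum := by
  refine list_foldr (step := fun _ (a b : ℚ) => a + b) (by fun_prop) (.const 0) hl
    ((PolyBounded.const 1).add ((PolyBounded.const 2).mul hl.polyBounded_bitSize))
    fun d m hm => (bitSize_sum_le m).trans ?_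
  have := bitSize_le_of_sublist hm.sublist
  omega

theorem list_minOn {f : α → ℚ} {a : δ → α} {l : δ → List α} (hf : PolyTime f) (ha : PolyTime a)
    (hl : PolyTime l) :
    PolyTime fun d => (a d :: l d).minOn f (List.cons_ne_nil _ _) := by
  have hsize := (ha.list_cons hl).polyBounded_bitSize
  refine list_foldl (step := fun _ b c => minOn f b c) ?_ ha hl hsize fun d m hm => ?_
  · exact PolyTime.ite (p := fun x : δ × α × α => f x.2.1 ≤ f x.2.2) (by fun_prop) (by fun_prop)
      (by fun_prop)
  · have hmem : (a d :: m).minOn f (List.cons_ne_nil _ _) ∈ a d :: m := List.minOn_mem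
    exact bitSize_le_of_mem ((hm.sublist.cons_cons _).mem hmem)

@[fun_prop]
theorem list_mem [PolyTimeEq α] {f : δ → α} {l : δ → List α} (hf : PolyTime f)
    (hl : PolyTime l) : PolyTime fun d => f d ∈ l d := by
  classical
  have hfilter : PolyTime fun d => (l d).filter fun a => a = f d := by
    have := hf.comp (PolyTime.fst (α := δ) (β := α))
    fun_prop
  exact of_eq hfilter.list_eq_nil.not fun d => by simp

@[fun_prop]
theorem list_dedup [DecidableEq α] [PolyTimeEq α] {l : δ → List α} (hl : PolyTime l) :
    PolyTime fun d => (l d).dedup := by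
  have hfold (m : List α) : m.foldr (fun a m => if a ∈ m then m else a :: m) [] = m.dedup := by
    induction m with
    | nil => rfl
    | cons a m ih => rw [List.foldr_cons, ih, List.dedup_cons]; simp
  refine of_eq (list_foldr (step := fun _ a m => if a ∈ m then m else a :: m) (by fun_prop)
    (.const []) hl hl.polyBounded_bitSize fun d m hm => ?_) fun d => hfold _
  rw [hfold]
  exact bitSize_le_of_sublist ((List.dedup_sublist m).trans hm.sublist)

@[fun_prop]
theorem list_zipIdx {l : δ → List α} (hl : PolyTime l) : PolyTime fun d => (l d).zipIdx := by
  have hcount (m : List α) :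
      m.mapAccumr (fun a n => (n + 1, (a, n))) 0 = (m.length, m.reverse.zipIdx.reverse) := by
    induction m with
    | nil => rfl
    | cons a m ih => simp [List.mapAccumr, ih, List.zipIdx_append]
  have hmap := list_mapAccumr (f := fun _ (a : α) n => (n + 1, (a, n))) (s := fun _ => 0)
    (by fun_prop) hl.list_reverse (.const 0)
    ((PolyBounded.const 2).add hl.list_reverse.polyBounded_bitSize) fun d m hm => by
      rw [hcount, bitSize_nat]
      exact Nat.add_le_add_left
        ((size_le_self _).trans (hm.length_le.trans (length_le_bitSize _))) 2
  exact of_eq (PolyTime.snd.comp hmap).list_reverse fun d => by simp [hcount]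

/-! ### Integer logarithms -/

/-- One step in the search for `Int.log K q`: the state holds `q`, an exponent and the power of `K`
with that exponent. -/
private def logStep (K : ℕ) (s : ℚ × ℤ × ℚ) : ℚ × ℤ × ℚ :=
  if K * s.2.2 ≤ s.1 then (s.1, s.2.1 + 1, s.2.2 * K) else (s.1, s.2.1 - 1, s.2.2 / K)

private theorem bitSize_logStep_le (K : ℕ) (s : ℚ × ℤ × ℚ) :
    bitSize (logStep K s) ≤ bitSize s + (bitSize K + bitSize (-1 : ℤ) + 1) := by
  have hadd := bitSize_int_add_le s.2.1 1
  have hsub := bitSize_int_add_le s.2.1 (-1)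
  have hmul : bitSize (s.2.2 * K) ≤ bitSize s.2.2 + bitSize K := bitSize_rat_mul_le _ _
  have hdiv : bitSize (s.2.2 / K) ≤ bitSize s.2.2 + bitSize K + 1 := bitSize_rat_div_le _ _
  have hone : bitSize (1 : ℤ) = bitSize (-1 : ℤ) := rfl
  rw [← sub_eq_add_neg] at hsub
  unfold logStep
  split <;> simp only [bitSize_mk, bitSize_prod s, bitSize_prod s.2] <;> omega

private theorem iterate_logStep {K : ℕ} (hK : 1 < K) {q : ℚ} {i : ℕ}
    (hi : i ≤ (Int.log K q).natAbs) :
    (logStep K)^[i] (q, 0, 1) =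
      (q, (Int.log K q).sign * i, (K : ℚ) ^ ((Int.log K q).sign * i)) := by
  have hK0 : (K : ℚ) ≠ 0 := by positivity
  rcases le_or_gt q 0 with hq | hq
  · obtain rfl : i = 0 := by simpa [Int.log_of_right_le_zero K hq] using hi
    simp
  induction i with
  | zero => simp
  | succ i ih =>
    rw [Function.iterate_succ_apply', ih (by omega), logStep]
    simp only [← zpow_one_add₀ hK0, Int.zpow_le_iff_le_log hK hq]
    rcases lt_trichotomy (Int.log K q) 0 with hneg | hzero | hpos
    · rw [Int.sign_eq_neg_one_of_neg hneg, if_neg (by omega), div_eq_mul_inv,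
        ← zpow_sub_one₀ hK0]
      push_cast
      ring_nf
    · omega
    · rw [Int.sign_eq_one_of_pos hpos, if_pos (by omega), ← zpow_add_one₀ hK0]
      push_cast
      ring_nf

private theorem lt_natAbs_log_iff {K : ℕ} (hK : 1 < K) {q : ℚ} {i : ℕ}
    (hi : i ≤ (Int.log K q).natAbs) :
    i < (Int.log K q).natAbs ↔
      K * (K : ℚ) ^ ((Int.log K q).sign * i) ≤ q ∨
        0 < q ∧ q < (K : ℚ) ^ ((Int.log K q).sign * i) := by
  have hK0 : (0 : ℚ) < K := by positivity
  rcases le_or_gt q 0 with hq | hq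
  · simp [Int.log_of_right_le_zero K hq, hq.not_gt, hq.trans_lt hK0]
  · rw [← zpow_one_add₀ hK0.ne', Int.zpow_le_iff_le_log hK hq, Int.lt_zpow_iff_log_lt hK hq,
      and_iff_right hq]
    rcases lt_trichotomy (Int.log K q) 0 with hneg | hzero | hpos
    · rw [Int.sign_eq_neg_one_of_neg hneg]
      omega
    · simp [hzero]
    · rw [Int.sign_eq_one_of_pos hpos]
      omega

private theorem log_zpow_log {K : ℕ} (hK : 1 < K) :
    PolyTime fun q : ℚ => (q, Int.log K q, (K : ℚ) ^ Int.log K q) := by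
  have hstep : PolyTime (logStep K) := by unfold logStep; fun_prop
  have hloop := iterate_while (c := fun s : ℚ × ℤ × ℚ => K * s.2.2 ≤ s.1 ∨ 0 < s.1 ∧ s.1 < s.2.2)
    (by fun_prop) hstep (g := fun q => (q, 0, 1)) (by fun_prop)
    (PolyBounded.bitSize.mono (natAbs_log_le_bitSize hK))
    (B := fun q => bitSize (q, (0 : ℤ), (1 : ℚ)) + bitSize q * (bitSize K + bitSize (-1 : ℤ) + 1))
    ((PolyTime.polyBounded_bitSize (by fun_prop)).add (PolyBounded.bitSize.mul (.const _)))
    (fun q i hi => (bitSize_iterate_le (bitSize_logStep_le K) i _).trans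
      (Nat.add_le_add_left (Nat.mul_le_mul_right _ (hi.trans (natAbs_log_le_bitSize hK q))) _))
    (fun q i hi => by
      rw [iterate_logStep hK hi.le]; exact (lt_natAbs_log_iff hK hi.le).1 hi)
    (fun q => by
      rw [iterate_logStep hK le_rfl, ← lt_natAbs_log_iff hK le_rfl]; exact lt_irrefl _)
  exact of_eq hloop fun q => by rw [iterate_logStep hK le_rfl, Int.sign_mul_natAbs]

theorem int_log {K : ℕ} (hK : 1 < K) {f : δ → ℚ} (hf : PolyTime f) :
    PolyTime fun d => Int.log K (f d) :=
  PolyTime.fst.comp (PolyTime.snd.comp ((log_zpow_log hK).comp hf))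

theorem zpow_int_log {K : ℕ} (hK : 1 < K) {f : δ → ℚ} (hf : PolyTime f) :
    PolyTime fun d => (K : ℚ) ^ Int.log K (f d) :=
  PolyTime.snd.comp (PolyTime.snd.comp ((log_zpow_log hK).comp hf))

end PolyTime

end Machine

namespace CVRP

open Machine
open ToData (toData)

/-! ### The algorithm -/

/-- A terminal as the algorithm sees it: its number in the encoding, its position relative to the
depot, and its demand. -/
structure Terminal where
  index : ℕ
  pos : ℚ × ℚ
  demand : ℚ

/-- A cell of the subdivision of the plane: the annulus that contains it, given by its scale, and
the position in a square grid whose mesh is a fixed fraction of the radius of the annulus. -/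
@[ext]
structure Cell where
  scale : ℤ
  col : ℤ
  row : ℤ
  deriving DecidableEq

/-- A terminal together with its cell and the number of its demand class in this cell. -/
structure Item extends Terminal where
  cell : Cell
  group : ℕ

instance : ToData Terminal := ⟨fun v => toData (v.index, v.pos, v.demand)⟩
instance : ToData Cell := ⟨fun κ => toData (κ.scale, κ.col, κ.row)⟩
instance : ToData Item := ⟨fun v => toData (v.toTerminal, v.cell, v.group)⟩

section Structures

variable {δ : Type} [ToData δ]

theorem polyTime_terminal_tuple : PolyTime fun v : Terminal => (v.index, v.pos, v.demand) :=
  .of_toData_eq fun _ => rfl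

theorem polyTime_cell_tuple : PolyTime fun κ : Cell => (κ.scale, κ.col, κ.row) :=
  .of_toData_eq fun _ => rfl

theorem polyTime_item_tuple : PolyTime fun v : Item => (v.toTerminal, v.cell, v.group) :=
  .of_toData_eq fun _ => rfl

@[fun_prop]
theorem polyTime_index : PolyTime Terminal.index := PolyTime.fst.comp polyTime_terminal_tuple

@[fun_prop]
theorem polyTime_pos : PolyTime Terminal.pos :=
  PolyTime.fst.comp (PolyTime.snd.comp polyTime_terminal_tuple)

@[fun_prop]
theorem polyTime_demand : PolyTime Terminal.demand :=
  PolyTime.snd.comp (PolyTime.snd.comp polyTime_terminal_tuple)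

@[fun_prop]
theorem polyTime_scale : PolyTime Cell.scale := PolyTime.fst.comp polyTime_cell_tuple

@[fun_prop]
theorem polyTime_col : PolyTime Cell.col :=
  PolyTime.fst.comp (PolyTime.snd.comp polyTime_cell_tuple)

@[fun_prop]
theorem polyTime_row : PolyTime Cell.row :=
  PolyTime.snd.comp (PolyTime.snd.comp polyTime_cell_tuple)

@[fun_prop]
theorem polyTime_toTerminal : PolyTime Item.toTerminal := PolyTime.fst.comp polyTime_item_tuple

@[fun_prop]
theorem polyTime_cell : PolyTime Item.cell :=
  PolyTime.fst.comp (PolyTime.snd.comp polyTime_item_tuple)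

@[fun_prop]
theorem polyTime_group : PolyTime Item.group :=
  PolyTime.snd.comp (PolyTime.snd.comp polyTime_item_tuple)

@[fun_prop]
theorem polyTime_terminal_mk {i : δ → ℕ} {p : δ → ℚ × ℚ} {q : δ → ℚ} (hi : PolyTime i)
    (hp : PolyTime p) (hq : PolyTime q) : PolyTime fun d => Terminal.mk (i d) (p d) (q d) :=
  PolyTime.comp (g := fun x : ℕ × (ℚ × ℚ) × ℚ => Terminal.mk x.1 x.2.1 x.2.2)
    (.of_toData_eq fun _ => rfl) (hi.prodMk (hp.prodMk hq))

@[fun_prop]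
theorem polyTime_cell_mk {s c r : δ → ℤ} (hs : PolyTime s) (hc : PolyTime c) (hr : PolyTime r) :
    PolyTime fun d => Cell.mk (s d) (c d) (r d) :=
  PolyTime.comp (g := fun x : ℤ × ℤ × ℤ => Cell.mk x.1 x.2.1 x.2.2)
    (.of_toData_eq fun _ => rfl) (hs.prodMk (hc.prodMk hr))

@[fun_prop]
theorem polyTime_item_mk {v : δ → Terminal} {κ : δ → Cell} {g : δ → ℕ} (hv : PolyTime v)
    (hκ : PolyTime κ) (hg : PolyTime g) : PolyTime fun d => Item.mk (v d) (κ d) (g d) :=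
  PolyTime.comp (g := fun x : Terminal × Cell × ℕ => Item.mk x.1 x.2.1 x.2.2)
    (.of_toData_eq fun _ => rfl) (hv.prodMk (hκ.prodMk hg))

instance : PolyTimeEq Cell :=
  ⟨PolyTime.eq_of_injective (f := fun κ : Cell => (κ.scale, κ.col, κ.row))
    (fun ⟨_, _, _⟩ ⟨_, _, _⟩ h => by simpa using h) polyTime_cell_tuple
    PolyTimeEq.polyTime_eq⟩

end Structures

/-- The maximum norm of a point, which determines its scale. -/
def maxNorm (p : ℚ × ℚ) : ℚ := max |p.1| |p.2|

/-- The cell of a point. The point `0` is the only one in its cell. -/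
def cellOf (K : ℕ) (p : ℚ × ℚ) : Cell where
  scale := Int.log K (maxNorm p)
  col := ⌊p.1 / (K : ℚ) ^ Int.log K (maxNorm p) * K⌋
  row := ⌊p.2 / (K : ℚ) ^ Int.log K (maxNorm p) * K⌋

theorem polyTime_cellOf {K : ℕ} (hK : 1 < K) : PolyTime (cellOf K) := by
  have hnorm : PolyTime maxNorm := by unfold maxNorm; fun_prop
  have hlog := PolyTime.int_log hK hnorm
  have hpow := PolyTime.zpow_int_log hK hnorm
  unfold cellOf
  fun_prop

/-- Terminals are ordered by decreasing demand; the index serves as a tie-breaker. -/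
def Terminal.sortKey (v : Terminal) : ℚᵒᵈ ×ₗ ℕ := toLex (OrderDual.toDual v.demand, v.index)

theorem Terminal.sortKey_lt_sortKey {v w : Terminal} : w.sortKey < v.sortKey ↔
    v.demand < w.demand ∨ w.demand = v.demand ∧ w.index < v.index := by
  simp [sortKey, Prod.Lex.toLex_lt_toLex]

/-- The number of terminals in a list that come before a given one. -/
def rank (l : List Terminal) (v : Terminal) : ℕ := l.countP fun w => w.sortKey < v.sortKey

@[fun_prop]
theorem polyTime_rank {δ : Type} [ToData δ] {l : δ → List Terminal} {v : δ → Terminal}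
    (hl : PolyTime l) (hv : PolyTime v) : PolyTime fun d => rank (l d) (v d) := by
  have := hv.comp (PolyTime.fst (α := δ) (β := Terminal))
  simp only [rank, Terminal.sortKey_lt_sortKey]
  fun_prop

/-- The terminals in a cell. -/
def inCell (K : ℕ) (l : List Terminal) (κ : Cell) : List Terminal :=
  l.filter fun w => cellOf K w.pos = κ

/-- The common size of the demand classes in a cell: every cell is divided into about `K` classes,
which consist of single terminals if there are fewer than `K` terminals. -/
def classSize (K : ℕ) (l : List Terminal) (κ : Cell) : ℕ := max ((inCell K l κ).length / K) 1

/-- Determine the cell and the demand class of a terminal. -/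
def classifyTerminal (K : ℕ) (l : List Terminal) (v : Terminal) : Item where
  toTerminal := v
  cell := cellOf K v.pos
  group := rank (inCell K l (cellOf K v.pos)) v / classSize K l (cellOf K v.pos)

/-- Determine the cells and the demand classes of all terminals. -/
def classify (K : ℕ) (l : List Terminal) : List Item := l.map (classifyTerminal K l)

theorem polyTime_classify {K : ℕ} (hK : 1 < K) : PolyTime (classify K) := by
  have := polyTime_cellOf hK
  unfold classify classifyTerminal classSize inCell
  fun_prop

/-- The type of a terminal relative to the block of scales that contains it. -/
def relType (K a : ℕ) (v : Item) : Cell × ℕ :=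
  (⟨(v.cell.scale - a) % K, v.cell.col, v.cell.row⟩, v.group)

/-- The block of `K` consecutive scales that contains a terminal; `a` is the offset of blocks. -/
def blockOf (K a : ℕ) (v : Item) : ℤ := (v.cell.scale - a) / K

/-- The smallest scale of each block separates it from the previous one. -/
def Separates (K a : ℕ) (v : Item) : Prop := (v.cell.scale - a) % K = 0

instance (K a : ℕ) : DecidablePred (Separates K a) :=
  fun v => inferInstanceAs (Decidable ((v.cell.scale - a) % K = 0))

theorem polyTime_relType (K a : ℕ) : PolyTime (relType K a) := by
  unfold relType
  fun_prop

@[fun_prop]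
theorem polyTime_blockOf (K a : ℕ) : PolyTime (blockOf K a) := by
  unfold blockOf
  fun_prop

@[fun_prop]
theorem polyTime_separates (K a : ℕ) : PolyTime (Separates K a) := by
  unfold Separates
  fun_prop

section Enumeration

variable {β τ : Type} [DecidableEq τ] (ty : β → τ)

/-- Move an element of type `t`, if there is one, from the first list to the second. -/
def popStep (t : τ) (s : List β × List β) : List β × List β :=
  match s.1.filter fun v => ty v = t with
  | [] => s
  | v :: l => (l ++ s.1.filter fun v => ty v ≠ t, v :: s.2)

/-- Remove elements with the types given by a configuration. The result consists of the remaining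
elements and the removed ones. -/
def takeTour (c : List τ) (l : List β) : List β × List β := c.foldr (popStep ty) (l, [])

/-- Remove a tour and put it into the list of tours. -/
def addTour (c : List τ) (s : List β × List (List β)) : List β × List (List β) :=
  ((takeTour ty c s.1).1, (takeTour ty c s.1).2 :: s.2)

/-- The states that result from adding at most `l.length` tours with configuration `c`. -/
def addTours (c : List τ) (l : List β) (s : List β × List (List β)) :
    List (List β × List (List β)) :=
  List.iterate (addTour ty c) s (l.length + 1)

/-- All ways to choose tours with the given configurations. -/
def states (Cs : List (List τ)) (l : List β) : List (List β × List (List β)) :=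
  Cs.foldr (fun c S => S.flatMap (addTours ty c l)) [(l, [])]

variable {ty}

theorem popStep_perm (t : τ) (s : List β × List β) :
    ((popStep ty t s).2 ++ (popStep ty t s).1).Perm (s.2 ++ s.1) := by
  have h := List.filter_append_perm (fun v => ty v = t) s.1
  unfold popStep
  cases hfilter : s.1.filter fun v => ty v = t with
  | nil => rfl
  | cons v l =>
    rw [hfilter] at h
    simp only [← decide_not] at h
    exact List.perm_middle.symm.trans (h.append_left s.2)

theorem takeTour_perm (c : List τ) (l : List β) :
    ((takeTour ty c l).2 ++ (takeTour ty c l).1).Perm l := by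
  induction c with
  | nil => rfl
  | cons t c ih => exact (popStep_perm t _).trans ih

variable [ToData β]

theorem bitSize_addTour (c : List τ) (s : List β × List (List β)) :
    bitSize (addTour ty c s) = bitSize s + 3 := by
  have hperm := bitSize_eq_of_perm (takeTour_perm (ty := ty) c s.1)
  have happend := bitSize_append (takeTour ty c s.1).2 (takeTour ty c s.1).1
  rw [bitSize_prod s, addTour, bitSize_mk, bitSize_cons]
  omega

variable [ToData τ] [PolyTimeEq τ]

theorem polyTime_popStep (hty : PolyTime ty) (t : τ) : PolyTime (popStep ty t) := by
  refine .of_eq (PolyTime.list_casesOn (l := fun s => s.1.filter fun v => ty v = t)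
    (f := fun s => s) (g := fun s v l => (l ++ s.1.filter fun v => ty v ≠ t, v :: s.2))
    (by fun_prop) (by fun_prop) (by fun_prop)) fun s => ?_
  unfold popStep
  cases s.1.filter fun v => ty v = t <;> rfl

theorem polyTime_addTour (hty : PolyTime ty) (c : List τ) : PolyTime (addTour ty c) := by
  have := PolyTime.list_foldr_const (L := c) (polyTime_popStep hty)
  unfold addTour takeTour
  fun_prop

theorem polyTime_addTours (hty : PolyTime ty) (c : List τ) :
    PolyTime fun x : List β × (List β × List (List β)) => addTours ty c x.1 x.2 :=
  PolyTime.list_iterate (polyTime_addTour hty c) .snd .fst fun s => (bitSize_addTour c s).le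

theorem polyTime_states (hty : PolyTime ty) (Cs : List (List τ)) : PolyTime (states ty Cs) := by
  unfold states
  induction Cs with
  | nil => exact PolyTime.list_cons (by fun_prop) (.const [])
  | cons c Cs ih =>
    have := polyTime_addTours hty c
    exact PolyTime.list_flatMap this ih

end Enumeration

/-- An approximation from above of the Euclidean norm, by Newton's method for the square root. -/
def approxNorm (K : ℕ) (p : ℚ × ℚ) : ℚ :=
  (fun x => (x + (p.1 * p.1 + p.2 * p.2) / x) / 2)^[K] (|p.1| + |p.2|)

theorem polyTime_approxNorm (K : ℕ) : PolyTime (approxNorm K) :=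
  PolyTime.iterate (f := fun (p : ℚ × ℚ) x => (x + (p.1 * p.1 + p.2 * p.2) / x) / 2) (by fun_prop)
    (g := fun p => |p.1| + |p.2|) (by fun_prop) K

/-- The approximate lengths of the segments of the path through `l` that ends in `z`. -/
def legs (K : ℕ) (z : ℚ × ℚ) (l : List (ℚ × ℚ)) : List ℚ :=
  (l.mapAccumr (fun p q => (p, approxNorm K (q.1 - p.1, q.2 - p.2))) z).2

theorem polyTime_legs (K : ℕ) (z : ℚ × ℚ) : PolyTime (legs K z) := by
  have hnorm : PolyTime fun x : (ℚ × ℚ) × (ℚ × ℚ) =>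
      approxNorm K (x.2.1 - x.1.1, x.2.2 - x.1.2) := by
    have := polyTime_approxNorm K
    fun_prop
  unfold legs
  generalize approxNorm K = norm at hnorm
  refine PolyTime.snd.comp (PolyTime.list_mapAccumr
    (f := fun _ p q => (p, norm (q.1 - p.1, q.2 - p.2))) ?_ .id (.const z)
    (PolyTime.polyBounded_bitSize (f := fun l : List (ℚ × ℚ) => l ++ [z]) (by fun_prop))
    fun l m hm => ?_)
  · exact PolyTime.prodMk (by fun_prop) (hnorm.comp .snd)
  · exact bitSize_le_of_mem
      ((hm.sublist.append_right [z]).mem (by cases m <;> simp [List.mapAccumr]))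

/-- The approximate cost of a collection of tours, each given by the terminals in their order. -/
def approxCost (K : ℕ) (S : List (List Item)) : ℚ :=
  (S.flatMap fun t => legs K (0, 0) ((0, 0) :: t.map fun v => v.pos)).sum

theorem polyTime_approxCost (K : ℕ) : PolyTime (approxCost K) := by
  have := polyTime_legs K (0, 0)
  unfold approxCost
  fun_prop

/-- A collection of least approximate cost among the given ones and the one that serves every
terminal by a tour of its own. -/
def best (K : ℕ) (l : List Item) (C : List (List (List Item))) : List (List Item) :=
  ((l.map fun v => [v]) :: C).minOn (approxCost K) (List.cons_ne_nil _ _)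

theorem polyTime_best {δ : Type} [ToData δ] (K : ℕ) {l : δ → List Item}
    {C : δ → List (List (List Item))} (hl : PolyTime l) (hC : PolyTime C) :
    PolyTime fun d => best K (l d) (C d) :=
  PolyTime.list_minOn (polyTime_approxCost K) (by fun_prop) hC

/-- Split a tour that exceeds the capacity. -/
def splitTour (t : List Item) : List (List Item) :=
  if (t.map fun v => v.demand).sum ≤ 1 then [t] else t.map fun v => [v]

/-- Complete a partial solution by tours with one terminal. -/
def finish (s : List Item × List (List Item)) : List (List Item) :=
  s.2.flatMap splitTour ++ s.1.map fun v => [v]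

/-- The approximate solution for the terminals in one block of scales. -/
def solveBlock (K a : ℕ) (Cs : List (List (Cell × ℕ))) (l : List Item) : List (List Item) :=
  best K l ((states (relType K a) Cs l).map finish)

theorem polyTime_solveBlock (K a : ℕ) (Cs : List (List (Cell × ℕ))) :
    PolyTime (solveBlock K a Cs) := by
  have hfinish : PolyTime finish := by unfold finish splitTour; fun_prop
  have := polyTime_states (polyTime_relType K a) Cs
  exact polyTime_best K (by fun_prop) (by fun_prop)

/-- The terminals that are not at separating scales. -/
def inner (K a : ℕ) (l : List Item) : List Item := l.filter fun v => ¬Separates K a v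

/-- The blocks of scales that contain some of these terminals. -/
def blocks (K a : ℕ) (l : List Item) : List ℤ := ((inner K a l).map (blockOf K a)).dedup

/-- The terminals of one block that are not at its separating scale. -/
def blockItems (K a : ℕ) (l : List Item) (b : ℤ) : List Item :=
  (inner K a l).filter fun v => blockOf K a v = b

/-- Serve the terminals at the separating scales by tours of their own, and solve the blocks. -/
def solveShift (K a : ℕ) (Cs : List (List (Cell × ℕ))) (l : List Item) : List (List Item) :=
  ((l.filter fun v => Separates K a v).map fun v => [v]) ++
    (blocks K a l).flatMap fun b => solveBlock K a Cs (blockItems K a l b)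

theorem polyTime_solveShift (K a : ℕ) (Cs : List (List (Cell × ℕ))) :
    PolyTime (solveShift K a Cs) := by
  have := polyTime_solveBlock K a Cs
  unfold solveShift blocks blockItems inner
  fun_prop

/-- The best solution over all offsets of the blocks. -/
def solve (K : ℕ) (Cs : List (List (Cell × ℕ))) (l : List Item) : List (List Item) :=
  best K l ((List.range K).map fun a => solveShift K a Cs l)

theorem polyTime_solve (K : ℕ) (Cs : List (List (Cell × ℕ))) : PolyTime (solve K Cs) :=
  polyTime_best K .id (.list_map_const fun a => polyTime_solveShift K a Cs)

/-- The terminals of an instance, which is given by its depot and the list of the locations and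
demands. -/
def terminals (x : (ℚ × ℚ) × List ((ℚ × ℚ) × ℚ)) : List Terminal :=
  x.2.zipIdx.map fun e => ⟨e.2 + 1, (e.1.1.1 - x.1.1, e.1.1.2 - x.1.2), e.1.2⟩

/-- The algorithm: each tour visits exactly the terminals that it covers. -/
def algorithm (K : ℕ) (Cs : List (List (Cell × ℕ))) (x : (ℚ × ℚ) × List ((ℚ × ℚ) × ℚ)) :
    List (List ℕ × List ℕ) :=
  (solve K Cs (classify K (terminals x))).map fun t =>
    (t.map fun v => v.index, t.map fun v => v.index)

theorem polyTime_algorithm {K : ℕ} (hK : 1 < K) (Cs : List (List (Cell × ℕ))) :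
    PolyTime (algorithm K Cs) := by
  have := polyTime_solve K Cs
  have := polyTime_classify hK
  have hterminals : PolyTime terminals := by unfold terminals; fun_prop
  unfold algorithm
  fun_prop

/-! ### Walks and their approximate lengths -/

section Walk

variable {α E : Type*} [MetricSpace E]

/-- The length of the walk from `x` to `z` through the points of `l`. -/
noncomputable def walk (x : E) (l : List E) (z : E) : ℝ := pathLength (x :: (l ++ [z]))

theorem walk_nil (x z : E) : walk x [] z = dist x z := by simp [walk, pathLength]

theorem walk_cons (x a : E) (l : List E) (z : E) :
    walk x (a :: l) z = dist x a + walk a l z := rfl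

theorem walk_le_dist_add (x y : E) (l : List E) (z : E) : walk x l z ≤ dist x y + walk y l z := by
  cases l with
  | nil => simpa only [walk_nil] using dist_triangle x y z
  | cons a l => linarith [walk_cons x a l z, walk_cons y a l z, dist_triangle x y a]

theorem walk_le_of_sublistForall₂ {pos : α → E} {e : α → ℝ} (he : ∀ u, 0 ≤ e u) {w t : List α}
    (h : w.SublistForall₂ (fun v u => dist (pos v) (pos u) ≤ e u) t) (x y z : E) :
    walk x (w.map pos) z ≤
      dist x y + walk y (t.map pos) z + (t.map fun u => 2 * e u).sum := by
  induction h generalizing x y with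
  | @nil t =>
    induction t generalizing x y with
    | nil => simpa using walk_le_dist_add x y [] z
    | cons u t ih =>
      simp only [List.map_cons, List.sum_cons, walk_cons]
      linarith [ih x (pos u), dist_triangle x y (pos u), he u]
  | @cons v u w t hvu _ ih =>
    simp only [List.map_cons, List.sum_cons, walk_cons]
    linarith [ih (pos v) (pos u), dist_triangle4 x y (pos u) (pos v), dist_comm (pos u) (pos v)]
  | @cons_right u w t _ ih =>
    simp only [List.map_cons, List.sum_cons, walk_cons]
    linarith [ih x (pos u), dist_triangle x y (pos u), he u]

theorem walk_sublist {l m : List E} (h : l.Sublist m) (x z : E) : walk x l z ≤ walk x m z := by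
  have := walk_le_of_sublistForall₂ (pos := id) (e := fun _ => 0) (fun _ => le_rfl)
    (List.sublistForall₂_iff.2 ⟨l, List.forall₂_same.2 fun a _ => (dist_self a).le, h⟩) x x z
  simpa using this

theorem two_mul_dist_le_walk {a : E} {l : List E} (h : a ∈ l) (x : E) :
    2 * dist x a ≤ walk x l x := by
  have := walk_sublist (List.singleton_sublist.2 h) x x
  linarith [walk_cons x a [] x, walk_nil a x, dist_comm a x]

theorem walk_nonneg (x z : E) (l : List E) : 0 ≤ walk x l z :=
  dist_nonneg.trans ((walk_nil x z).symm.trans_le (walk_sublist (List.nil_sublist l) x z))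

theorem walk_le_dist_add_sum (x z : E) (l : List E) :
    walk x l z ≤ dist x z + (l.map fun a => 2 * dist z a).sum := by
  induction l generalizing x with
  | nil => simp [walk_nil]
  | cons a l ih =>
    rw [walk_cons, List.map_cons, List.sum_cons]
    linarith [ih a, dist_triangle x z a, dist_comm a z]

end Walk

theorem dist_toPlane (p q : ℚ × ℚ) :
    dist (toPlane p) (toPlane q) = √(((p.1 - q.1 : ℚ) : ℝ) ^ 2 + ((p.2 - q.2 : ℚ) : ℝ) ^ 2) := by
  rw [EuclideanSpace.dist_eq]
  simp [toPlane, Real.dist_eq, sq_abs]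

theorem newton_step_bounds {s r e : ℝ} (hs : 0 ≤ s) (hsr : s ≤ r) (hrs : r ≤ (1 + e) * s) :
    s ≤ (r + s ^ 2 / r) / 2 ∧ (r + s ^ 2 / r) / 2 ≤ (1 + e / 2) * s := by
  rcases (hs.trans hsr).eq_or_lt with rfl | hr
  · obtain rfl : s = 0 := le_antisymm hsr hs
    simp
  · have hlower : 2 * s - r ≤ s ^ 2 / r := by
      rw [le_div_iff₀ hr]
      nlinarith [sq_nonneg (s - r)]
    have hupper : s ^ 2 / r ≤ s := by
      rw [div_le_iff₀ hr]
      nlinarith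
    constructor <;> linarith

theorem sqrt_sq_add_sq_le_abs_add_abs (x y : ℝ) : √(x ^ 2 + y ^ 2) ≤ |x| + |y| := by
  rw [Real.sqrt_le_left (by positivity), ← sq_abs x, ← sq_abs y]
  nlinarith [mul_nonneg (abs_nonneg x) (abs_nonneg y)]

theorem abs_add_abs_le_two_mul_sqrt (x y : ℝ) : |x| + |y| ≤ 2 * √(x ^ 2 + y ^ 2) := by
  have hx := Real.abs_le_sqrt (show x ^ 2 ≤ x ^ 2 + y ^ 2 by nlinarith [sq_nonneg y])
  have hy := Real.abs_le_sqrt (show y ^ 2 ≤ x ^ 2 + y ^ 2 by nlinarith [sq_nonneg x])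
  linarith

theorem approxNorm_bounds (K : ℕ) (p : ℚ × ℚ) :
    √((p.1 : ℝ) ^ 2 + (p.2 : ℝ) ^ 2) ≤ approxNorm K p ∧
      approxNorm K p ≤ (1 + (1 / 2) ^ K) * √((p.1 : ℝ) ^ 2 + (p.2 : ℝ) ^ 2) := by
  induction K with
  | zero =>
    have hstart : (approxNorm 0 p : ℝ) = |(p.1 : ℝ)| + |(p.2 : ℝ)| := by simp [approxNorm]
    rw [hstart, pow_zero, one_add_one_eq_two]
    exact ⟨sqrt_sq_add_sq_le_abs_add_abs _ _, abs_add_abs_le_two_mul_sqrt _ _⟩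
  | succ K ih =>
    have hstep : (approxNorm (K + 1) p : ℝ) =
        (approxNorm K p + √((p.1 : ℝ) ^ 2 + (p.2 : ℝ) ^ 2) ^ 2 / approxNorm K p) / 2 := by
      rw [Real.sq_sqrt (by positivity), approxNorm, Function.iterate_succ_apply', ← approxNorm]
      push_cast
      rw [pow_two, pow_two]
    rw [hstep, pow_succ (1 / 2 : ℝ), ← div_eq_mul_one_div]
    exact newton_step_bounds (Real.sqrt_nonneg _) ih.1 ih.2

theorem approxNorm_sub_bounds (K : ℕ) (p q : ℚ × ℚ) :
    dist (toPlane p) (toPlane q) ≤ approxNorm K (q.1 - p.1, q.2 - p.2) ∧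
      approxNorm K (q.1 - p.1, q.2 - p.2) ≤ (1 + (1 / 2) ^ K) * dist (toPlane p) (toPlane q) := by
  rw [dist_comm, dist_toPlane]
  exact approxNorm_bounds K (q.1 - p.1, q.2 - p.2)

theorem fst_mapAccumr_eq_headD {β γ : Type*} (f : β → β → γ) (z : β) (l : List β) :
    (l.mapAccumr (fun p q => (p, f p q)) z).1 = l.headD z := by
  cases l <;> rfl

theorem sum_legs_cons (K : ℕ) (z p : ℚ × ℚ) (l : List (ℚ × ℚ)) :
    (legs K z (p :: l)).sum =
      approxNorm K ((l.headD z).1 - p.1, (l.headD z).2 - p.2) + (legs K z l).sum := by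
  rw [← fst_mapAccumr_eq_headD (fun p q => approxNorm K (q.1 - p.1, q.2 - p.2)) z l]
  rfl

theorem sum_legs_bounds (K : ℕ) (l : List (ℚ × ℚ)) (p z : ℚ × ℚ) :
    walk (toPlane p) (l.map toPlane) (toPlane z) ≤ (legs K z (p :: l)).sum ∧
      (legs K z (p :: l)).sum ≤
        (1 + (1 / 2) ^ K) * walk (toPlane p) (l.map toPlane) (toPlane z) := by
  induction l generalizing p with
  | nil =>
    have hnil : (legs K z []).sum = 0 := rfl
    simpa [sum_legs_cons, hnil, walk_nil] using approxNorm_sub_bounds K p z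
  | cons q l ih =>
    have hleg := approxNorm_sub_bounds K p q
    rw [sum_legs_cons, List.map_cons, walk_cons, Rat.cast_add, mul_add]
    exact ⟨add_le_add hleg.1 (ih q).1, add_le_add hleg.2 (ih q).2⟩

/-- The depot, which is the origin of the coordinates that the algorithm uses. -/
noncomputable def depot : EuclideanSpace ℝ (Fin 2) := toPlane (0, 0)

/-- The position of a terminal in the plane. -/
noncomputable def itemPos (v : Item) : EuclideanSpace ℝ (Fin 2) := toPlane v.pos

/-- The length of the tour through the given terminals. -/
noncomputable def tourLength (t : List Item) : ℝ := walk depot (t.map itemPos) depot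

/-- The total length of the tours. -/
noncomputable def totalLength (S : List (List Item)) : ℝ := (S.map tourLength).sum

theorem totalLength_append (S T : List (List Item)) :
    totalLength (S ++ T) = totalLength S + totalLength T := by
  simp [totalLength]

theorem approxCost_bounds (K : ℕ) (S : List (List Item)) :
    totalLength S ≤ approxCost K S ∧ approxCost K S ≤ (1 + (1 / 2) ^ K) * totalLength S := by
  induction S with
  | nil => simp [totalLength, approxCost]
  | cons t S ih =>
    have htour := sum_legs_bounds K (t.map fun v => v.pos) (0, 0) (0, 0)
    rw [List.map_map] at htour
    have htotal : totalLength (t :: S) = tourLength t + totalLength S := by simp [totalLength]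
    have hcost : approxCost K (t :: S) =
        (legs K (0, 0) ((0, 0) :: t.map fun v => v.pos)).sum + approxCost K S := by
      simp [approxCost]
    rw [htotal, hcost, Rat.cast_add, mul_add]
    exact ⟨add_le_add htour.1 ih.1, add_le_add htour.2 ih.2⟩

theorem tourLength_nonneg (t : List Item) : 0 ≤ tourLength t := walk_nonneg _ _ _

/-! ### Enumeration of the configurations -/

theorem flatMap_filter_perm {α γ : Type*} [DecidableEq γ] {f : α → γ} {D : List γ}
    (hD : D.Nodup) {l : List α} (hl : ∀ a ∈ l, f a ∈ D) :
    (D.flatMap fun c => l.filter fun a => f a = c).Perm l := by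
  classical
  refine List.perm_iff_count.2 fun a => ?_
  have hzero : ∀ c ≠ f a, c ∈ D → (l.filter fun a => f a = c).count a = 0 := fun c hc _ =>
    List.count_eq_zero.2 fun ha => hc (of_decide_eq_true (List.mem_filter.1 ha).2).symm
  rw [List.count_flatMap]
  refine (List.sum_map_eq_nsmul_single (f a) _ hzero).trans ?_
  by_cases ha : a ∈ l
  · simp [List.count_eq_one_of_mem hD (hl a ha), List.count_filter]
  · simp [List.count_eq_zero.2 ha]

section Enumeration

variable {β τ : Type} [DecidableEq τ] {ty : β → τ}

theorem map_snd_popStep {t : τ} {s : List β × List β} (h : t ∈ s.1.map ty) :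
    (popStep ty t s).2.map ty = t :: s.2.map ty := by
  obtain ⟨v, hv, hvt⟩ := List.mem_map.1 h
  have hmem : v ∈ s.1.filter fun w => ty w = t := List.mem_filter.2 ⟨hv, decide_eq_true hvt⟩
  unfold popStep
  cases hfilter : s.1.filter fun w => ty w = t with
  | nil => simp [hfilter] at hmem
  | cons u l =>
    have hu : u ∈ s.1.filter fun w => ty w = t := hfilter ▸ List.mem_cons_self
    rw [List.map_cons, of_decide_eq_true (List.mem_filter.1 hu).2]

theorem map_snd_takeTour {c r : List τ} {l : List β} (h : (c ++ r).Perm (l.map ty)) :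
    (takeTour ty c l).2.map ty = c := by
  induction c generalizing r with
  | nil => rfl
  | cons t c ih =>
    have htaken : (takeTour ty c l).2.map ty = c := ih (r := t :: r) (List.perm_middle.trans h)
    have hperm := (takeTour_perm (ty := ty) c l).map ty
    rw [List.map_append, htaken] at hperm
    have hrest : ((takeTour ty c l).1.map ty).Perm (t :: r) :=
      (List.perm_append_left_iff c).1 (hperm.trans (h.symm.trans List.perm_middle.symm))
    exact (map_snd_popStep (hrest.mem_iff.2 List.mem_cons_self)).trans
      (congrArg (t :: ·) htaken)

theorem perm_map_fst_takeTour {c r : List τ} {l : List β} (h : (c ++ r).Perm (l.map ty)) :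
    r.Perm ((takeTour ty c l).1.map ty) := by
  have hperm := (takeTour_perm (ty := ty) c l).map ty
  rw [List.map_append, map_snd_takeTour h] at hperm
  exact (List.perm_append_left_iff c).1 (h.trans hperm.symm)

variable (ty) in
/-- Remove tours with the given configurations one after the other, starting from the last. -/
def takeTours (cs : List (List τ)) (s : List β × List (List β)) : List β × List (List β) :=
  cs.foldr (addTour ty) s

theorem map_snd_takeTours {cs : List (List τ)} {r : List τ} {l : List β}
    (h : (cs.flatten ++ r).Perm (l.map ty)) :
    (takeTours ty cs (l, [])).2.map (List.map ty) = cs ∧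
      r.Perm ((takeTours ty cs (l, [])).1.map ty) := by
  induction cs generalizing r with
  | nil => exact ⟨rfl, h⟩
  | cons c cs ih =>
    rw [List.flatten_cons, List.append_assoc] at h
    obtain ⟨htypes, hrest⟩ := ih (r := c ++ r) (by
      rw [← List.append_assoc] at h ⊢
      exact (List.perm_append_comm.append_right r).trans h)
    exact ⟨congrArg₂ List.cons (map_snd_takeTour hrest) htypes, perm_map_fst_takeTour hrest⟩

theorem addTour_perm (c : List τ) (s : List β × List (List β)) :
    ((addTour ty c s).2.flatten ++ (addTour ty c s).1).Perm (s.2.flatten ++ s.1) := by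
  have h := (takeTour_perm (ty := ty) c s.1).append_left s.2.flatten
  rw [← List.append_assoc] at h
  exact (List.perm_append_comm.append_right _).trans h

theorem takeTours_perm (cs : List (List τ)) (s : List β × List (List β)) :
    ((takeTours ty cs s).2.flatten ++ (takeTours ty cs s).1).Perm (s.2.flatten ++ s.1) := by
  induction cs with
  | nil => rfl
  | cons c cs ih => exact (addTour_perm c _).trans ih

theorem takeTours_append (cs ds : List (List τ)) (s : List β × List (List β)) :
    takeTours ty (cs ++ ds) s = takeTours ty cs (takeTours ty ds s) := List.foldr_append

theorem takeTours_replicate (c : List τ) (n : ℕ) (s : List β × List (List β)) :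
    takeTours ty (List.replicate n c) s = (addTour ty c)^[n] s := by
  induction n with
  | zero => rfl
  | succ n ih => rw [Function.iterate_succ_apply', ← ih]; rfl

theorem mem_addTours {c : List τ} {l : List β} {s x : List β × List (List β)} :
    x ∈ addTours ty c l s ↔ ∃ n ≤ l.length, x = takeTours ty (List.replicate n c) s := by
  simp only [addTours, List.mem_iterate, Nat.lt_succ_iff, takeTours_replicate]

theorem exists_takeTours_of_mem_states {Cs : List (List τ)} {l : List β}
    {x : List β × List (List β)} (h : x ∈ states ty Cs l) :
    ∃ cs : List (List τ), x = takeTours ty cs (l, []) := by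
  induction Cs generalizing x with
  | nil => exact ⟨[], List.mem_singleton.1 h⟩
  | cons c Cs ih =>
    obtain ⟨s, hs, hx⟩ := List.mem_flatMap.1 h
    obtain ⟨cs, rfl⟩ := ih hs
    obtain ⟨n, -, rfl⟩ := mem_addTours.1 hx
    exact ⟨List.replicate n c ++ cs, (takeTours_append _ _ _).symm⟩

theorem states_perm {Cs : List (List τ)} {l : List β} {x : List β × List (List β)}
    (h : x ∈ states ty Cs l) : (x.2.flatten ++ x.1).Perm l := by
  obtain ⟨cs, rfl⟩ := exists_takeTours_of_mem_states h
  simpa using takeTours_perm (ty := ty) cs (l, [])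

theorem takeTours_flatMap_replicate_mem_states {m : List τ → ℕ} {l : List β}
    (hm : ∀ c, m c ≤ l.length) (Cs : List (List τ)) :
    takeTours ty (Cs.flatMap fun c => List.replicate (m c) c) (l, []) ∈ states ty Cs l := by
  induction Cs with
  | nil => exact List.mem_singleton_self _
  | cons c Cs ih =>
    rw [List.flatMap_cons, takeTours_append]
    exact List.mem_flatMap.2 ⟨_, ih, mem_addTours.2 ⟨m c, hm c, rfl⟩⟩

theorem exists_mem_states {Cs : List (List τ)} (hCs : Cs.Nodup) {l : List β}
    {cs : List (List τ)} (hcs : ∀ c ∈ cs, c ∈ Cs) (hlen : cs.length ≤ l.length) {r : List τ}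
    (h : (cs.flatten ++ r).Perm (l.map ty)) :
    ∃ x ∈ states ty Cs l, (x.2.map (List.map ty)).Perm cs := by
  have hperm : (Cs.flatMap fun c => List.replicate (cs.count c) c).Perm cs := by
    simpa only [List.filter_eq] using flatMap_filter_perm (f := fun c => c) hCs hcs
  refine ⟨_, takeTours_flatMap_replicate_mem_states (m := fun c => cs.count c)
    (fun c => List.count_le_length.trans hlen) Cs, ?_⟩
  rw [(map_snd_takeTours ((hperm.flatten.append_right r).trans h)).1]
  exact hperm

end Enumeration

/-! ### Linear grouping -/

theorem sum_le_sum_of_map_perm {α β γ : Type*} {f : α → γ} {g : β → γ} {a : α → ℝ} {b : β → ℝ}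
    {l : List α} {m : List β} (h : (l.map f).Perm (m.map g))
    (hab : ∀ x ∈ l, ∀ y ∈ m, f x = g y → a x ≤ b y) : (l.map a).sum ≤ (m.map b).sum := by
  have hrel : Multiset.Rel (fun x y => f x = g y) (l : Multiset α) (m : Multiset β) :=
    Multiset.rel_map.1 (Multiset.rel_eq.2 (Multiset.coe_eq_coe.2 h))
  simpa using Multiset.sum_le_sum_of_rel_le
    (Multiset.rel_map.2 (hrel.mono fun x hx y hy => hab x hx y hy))

theorem sublistForall₂_of_map_eq_filterMap {α β γ : Type*} {f : α → γ} {g : β → Option γ}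
    {R : α → β → Prop} {l : List α} {m : List β} (h : l.map f = m.filterMap g)
    (hR : ∀ x ∈ l, ∀ y ∈ m, g y = some (f x) → R x y) : l.SublistForall₂ R m := by
  induction m generalizing l with
  | nil =>
    rw [List.map_eq_nil_iff.1 h]
    exact .nil
  | cons y m ih =>
    rcases hy : g y with _ | c
    · rw [List.filterMap_cons_none hy] at h
      exact .cons_right (ih h fun x hx z hz => hR x hx z (List.mem_cons_of_mem _ hz))
    · rw [List.filterMap_cons_some hy] at h
      obtain ⟨x, l, rfl, rfl, htail⟩ := List.map_eq_cons_iff.1 h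
      exact .cons (hR x List.mem_cons_self y List.mem_cons_self hy)
        (ih htail fun x hx z hz => hR x (List.mem_cons_of_mem _ hx) z (List.mem_cons_of_mem _ hz))

theorem sum_map_le_of_sublistForall₂ {α β M : Type*} [AddCommMonoid M] [Preorder M]
    [AddLeftMono M] [AddRightMono M] {f : α → M} {g : β → M} {l : List α} {m : List β}
    (h : l.SublistForall₂ (fun x y => f x ≤ g y) m) (hg : ∀ y ∈ m, 0 ≤ g y) :
    (l.map f).sum ≤ (m.map g).sum :=
  List.SublistForall₂.sum_le_sum
    (List.sublistForall₂_map_left_iff.2 (List.sublistForall₂_map_right_iff.2 h))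
    (List.forall_mem_map.2 hg)

section Grouping

variable {α κ ρ : Type*}

/-- The elements of `G` are split into cells by `key`, and `rk` numbers the elements of each cell
consecutively from `0`. -/
structure IsRanking (key : α → κ) (rk : α → ℕ) (G : List α) : Prop where
  nodup : G.Nodup
  eq_of_rk_eq : ∀ u ∈ G, ∀ w ∈ G, key u = key w → rk u = rk w → u = w
  exists_rk_eq : ∀ v ∈ G, ∀ n < rk v, ∃ u ∈ G, key u = key v ∧ rk u = n

theorem IsRanking.of_subset {key : α → κ} {rk : α → ℕ} {G H : List α} (hG : IsRanking key rk G)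
    (hH : H.Nodup) (hHG : H ⊆ G) (hsat : ∀ v ∈ H, ∀ u ∈ G, key u = key v → u ∈ H) :
    IsRanking key rk H where
  nodup := hH
  eq_of_rk_eq u hu w hw := hG.eq_of_rk_eq u (hHG hu) w (hHG hw)
  exists_rk_eq v hv n hn :=
    have ⟨u, hu, hkey, hrk⟩ := hG.exists_rk_eq v (hHG hv) n hn
    ⟨u, hsat v hv u hu hkey, hkey, hrk⟩

open Classical in
/-- The element of the cell of `u` whose rank exceeds that of `u` by the size `s` of the classes
into which the cell is cut: linear grouping lets it stand in for `u`. -/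
noncomputable def shiftItem (key : α → κ) (rk : α → ℕ) (s : κ → ℕ) (G : List α) (u : α) :
    Option α :=
  if h : ∃ w ∈ G, key w = key u ∧ rk w = rk u + s (key u) then some h.choose else none

variable {key : α → κ} {rk : α → ℕ} {s : κ → ℕ} {G : List α}

theorem shiftItem_spec {u w : α} (h : shiftItem key rk s G u = some w) :
    w ∈ G ∧ key w = key u ∧ rk w = rk u + s (key u) := by
  unfold shiftItem at h
  split_ifs at h with hex
  rw [← Option.some.inj h]
  exact hex.choose_spec

theorem IsRanking.shiftItem_eq_some (hG : IsRanking key rk G) {u w : α} (hw : w ∈ G)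
    (hkey : key w = key u) (hrk : rk w = rk u + s (key u)) :
    shiftItem key rk s G u = some w := by
  have hex : ∃ w ∈ G, key w = key u ∧ rk w = rk u + s (key u) := ⟨w, hw, hkey, hrk⟩
  obtain ⟨hmem, hkey', hrk'⟩ := hex.choose_spec
  rw [shiftItem, dif_pos hex, hG.eq_of_rk_eq _ hmem w hw (hkey'.trans hkey.symm)
    (hrk'.trans hrk.symm)]

theorem IsRanking.nodup_filterMap_shiftItem (hG : IsRanking key rk G) :
    (G.filterMap (shiftItem key rk s G)).Nodup := by
  refine List.Pairwise.filterMap _ ?_ (List.Pairwise.and_mem.1 hG.nodup)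
  rintro u u' ⟨hu, hu', hne⟩ w hw w' hw' rfl
  obtain ⟨-, hkey, hrk⟩ := shiftItem_spec hw
  obtain ⟨-, hkey', hrk'⟩ := shiftItem_spec hw'
  have hkeys : key u = key u' := hkey.symm.trans hkey'
  rw [hkeys] at hrk
  exact hne (hG.eq_of_rk_eq u hu u' hu' hkeys (by omega))

theorem IsRanking.exists_shiftItem_eq_some (hG : IsRanking key rk G) {w : α} (hw : w ∈ G)
    (hrk : s (key w) ≤ rk w) : ∃ u ∈ G, shiftItem key rk s G u = some w := by
  suffices ∃ u ∈ G, key u = key w ∧ rk u + s (key w) = rk w by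
    obtain ⟨u, hu, hkey, hrk⟩ := this
    exact ⟨u, hu, hG.shiftItem_eq_some hw hkey.symm (by rw [hkey, hrk])⟩
  rcases Nat.eq_zero_or_pos (s (key w)) with hs | hs
  · exact ⟨w, hw, rfl, by omega⟩
  · obtain ⟨u, hu, hkey, hrk⟩ := hG.exists_rk_eq w hw (rk w - s (key w)) (by omega)
    exact ⟨u, hu, hkey, by omega⟩

theorem IsRanking.filterMap_shiftItem_append_perm (hG : IsRanking key rk G) :
    (G.filterMap (shiftItem key rk s G) ++ G.filter fun w => rk w < s (key w)).Perm G := by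
  refine (List.perm_ext_iff_of_nodup (List.nodup_append.2
    ⟨hG.nodup_filterMap_shiftItem, hG.nodup.filter _, ?_⟩) hG.nodup).2 fun w => ?_
  · rintro w hw w' hw' rfl
    obtain ⟨u, -, hu⟩ := List.mem_filterMap.1 hw
    obtain ⟨-, hkey, hrk⟩ := shiftItem_spec hu
    have hlt : rk w < s (key w) := of_decide_eq_true (List.mem_filter.1 hw').2
    rw [hkey] at hlt
    omega
  · simp only [List.mem_append, List.mem_filterMap, List.mem_filter, decide_eq_true_eq]
    refine ⟨?_, fun hw => ?_⟩
    · rintro (⟨u, -, hu⟩ | ⟨hw, -⟩)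
      exacts [(shiftItem_spec hu).1, hw]
    · rcases lt_or_ge (rk w) (s (key w)) with hlt | hge
      exacts [.inr ⟨hw, hlt⟩, .inl (hG.exists_shiftItem_eq_some hw hge)]

theorem mul_sum_le_mul_sum_of_card_le {ι : Type*} {A B : Finset ι} {s K : ℕ} {d : ι → ℝ} {b : ℝ}
    (hd : ∀ i, 0 ≤ d i) (hb : 0 ≤ b) (hAB : ∀ u ∈ A, ∀ w ∈ B, d w ≤ b * d u)
    (hB : B.card ≤ s) (hA : s * K ≤ A.card) : K * ∑ w ∈ B, d w ≤ b * ∑ u ∈ A, d u := by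
  have hsum : 0 ≤ b * ∑ u ∈ A, d u := mul_nonneg hb (Finset.sum_nonneg fun i _ => hd i)
  have hterm : ∀ w ∈ B, (s : ℝ) * (K * d w) ≤ b * ∑ u ∈ A, d u := fun w hw =>
    calc (s : ℝ) * (K * d w) = (s * K : ℕ) * d w := by push_cast; ring
      _ ≤ A.card * d w := mul_le_mul_of_nonneg_right (by exact_mod_cast hA) (hd w)
      _ = ∑ _u ∈ A, d w := by rw [Finset.sum_const, nsmul_eq_mul]
      _ ≤ ∑ u ∈ A, b * d u := Finset.sum_le_sum fun u hu => hAB u hu w hw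
      _ = b * ∑ u ∈ A, d u := (Finset.mul_sum ..).symm
  rcases Nat.eq_zero_or_pos s with rfl | hs
  · rw [Finset.card_eq_zero.1 (Nat.le_zero.1 hB), Finset.sum_empty, mul_zero]
    exact hsum
  refine le_of_mul_le_mul_left ?_ (Nat.cast_pos.2 hs : (0 : ℝ) < s)
  calc (s : ℝ) * (K * ∑ w ∈ B, d w) = ∑ w ∈ B, (s : ℝ) * (K * d w) := by
        rw [Finset.mul_sum, Finset.mul_sum]
    _ ≤ B.card * (b * ∑ u ∈ A, d u) := by
        simpa only [nsmul_eq_mul] using Finset.sum_le_card_nsmul B _ _ hterm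
    _ ≤ s * (b * ∑ u ∈ A, d u) := mul_le_mul_of_nonneg_right (by exact_mod_cast hB) hsum

theorem IsRanking.mul_sum_lowRank_le [DecidableEq κ] (hG : IsRanking key rk G) {K : ℕ}
    (hs : ∀ v ∈ G, s (key v) * K ≤ (G.filter fun w => key w = key v).length)
    {d : α → ℝ} (hd : ∀ v, 0 ≤ d v) {b : ℝ} (hb : 0 ≤ b)
    (hdkey : ∀ u ∈ G, ∀ w ∈ G, key u = key w → d w ≤ b * d u) :
    K * ((G.filter fun w => rk w < s (key w)).map d).sum ≤ b * (G.map d).sum := by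
  classical
  rw [← List.sum_toFinset d hG.nodup, ← List.sum_toFinset d (hG.nodup.filter _),
    ← Finset.sum_fiberwise_of_maps_to (s := G.toFinset)
      (fun _ hv => Finset.mem_image_of_mem key hv),
    ← Finset.sum_fiberwise_of_maps_to (g := key) (t := G.toFinset.image key)
      (fun v hv => Finset.mem_image_of_mem key
        (List.mem_toFinset.2 (List.mem_filter.1 (List.mem_toFinset.1 hv)).1)),
    Finset.mul_sum, Finset.mul_sum]
  refine Finset.sum_le_sum fun k hk => ?_
  obtain ⟨v, hv, rfl⟩ := Finset.mem_image.1 hk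
  refine mul_sum_le_mul_sum_of_card_le (s := s (key v)) hd hb (fun u hu w hw => ?_) ?_ ?_
  · simp only [Finset.mem_filter, List.mem_toFinset, List.mem_filter] at hu hw
    exact hdkey u hu.1 w hw.1.1 (hu.2.trans hw.2.symm)
  · rw [← Finset.card_range (s (key v))]
    refine Finset.card_le_card_of_injOn rk (fun w hw => ?_) fun u hu w hw => ?_
    · simp only [Finset.coe_filter, Set.mem_ofPred_eq, List.mem_toFinset,
        List.mem_filter, decide_eq_true_eq] at hw
      rw [hw.2] at hw
      simpa using hw.1.2
    · simp only [Finset.coe_filter, Set.mem_ofPred_eq, List.mem_toFinset, List.mem_filter] at hu hw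
      exact hG.eq_of_rk_eq u hu.1.1 w hw.1.1 (hu.2.trans hw.2.symm)
  · refine (hs v (List.mem_toFinset.1 hv)).trans_eq ?_
    rw [← List.toFinset_card_of_nodup (hG.nodup.filter _), List.toFinset_filter]
    simp only [decide_eq_true_eq]

/-- The types of the elements that stand in for those of the tour `t`. -/
noncomputable def shiftedTypes (key : α → κ) (rk : α → ℕ) (s : κ → ℕ) (G : List α) (ty : α → ρ)
    (t : List α) : List ρ :=
  t.filterMap fun u => (shiftItem key rk s G u).map ty

theorem IsRanking.flatten_shiftedTypes_append_perm (hG : IsRanking key rk G) (ty : α → ρ)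
    {S : List (List α)} (hS : S.flatten.Perm G) :
    ((S.map (shiftedTypes key rk s G ty)).flatten ++
      (G.filter fun w => rk w < s (key w)).map ty).Perm (G.map ty) := by
  have hflatten : (S.map (shiftedTypes key rk s G ty)).flatten =
      (S.flatten.filterMap (shiftItem key rk s G)).map ty := by
    rw [List.map_filterMap, List.filterMap_flatten]
    rfl
  rw [hflatten]
  refine .trans ?_ (hG.filterMap_shiftItem_append_perm (s := s).map ty)
  rw [List.map_append]
  exact ((hS.filterMap _).map ty).append_right _

section Replacement

variable {ty : α → ρ} (hty : ∀ u ∈ G, ∀ w ∈ G, ty u = ty w → key u = key w ∧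
  rk u / max (s (key u)) 1 = rk w / max (s (key w)) 1)

include hty

theorem key_eq_and_rk_le_of_map_shiftItem_eq_some {u w : α} (hw : w ∈ G)
    (h : (shiftItem key rk s G u).map ty = some (ty w)) : key u = key w ∧ rk u ≤ rk w := by
  obtain ⟨v, hv, hvw⟩ := Option.map_eq_some_iff.1 h
  obtain ⟨hvG, hkey, hrk⟩ := shiftItem_spec hv
  obtain ⟨hkey', hdiv⟩ := hty v hvG w hw hvw
  refine ⟨hkey.symm.trans hkey', ?_⟩
  rw [← hkey', hkey, hrk] at hdiv
  by_contra! hlt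
  rcases Nat.eq_zero_or_pos (s (key u)) with hs | hs
  · simp [hs] at hdiv
    omega
  · rw [max_eq_left hs, Nat.add_div_right _ hs] at hdiv
    have := Nat.div_le_div_right (c := s (key u)) hlt.le
    omega

theorem sublistForall₂_of_map_eq_shiftedTypes {R : α → α → Prop} {w t : List α}
    (hw : ∀ v ∈ w, v ∈ G) (h : w.map ty = shiftedTypes key rk s G ty t)
    (hR : ∀ u ∈ t, ∀ v ∈ w, key u = key v → rk u ≤ rk v → R v u) : w.SublistForall₂ R t :=
  sublistForall₂_of_map_eq_filterMap h fun v hv u hu huv =>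
    have ⟨hkey, hrk⟩ := key_eq_and_rk_le_of_map_shiftItem_eq_some hty (hw v hv) huv
    hR u hu v hv hkey hrk

variable {E : Type*} [MetricSpace E] {O : E} {pos : α → E} {δ : ℝ} {S W : List (List α)}

theorem sum_walk_le_of_perm_shiftedTypes (hδ : 0 ≤ δ)
    (hdist : ∀ u ∈ G, ∀ w ∈ G, key u = key w → dist (pos w) (pos u) ≤ δ * dist O (pos u))
    (hS : S.flatten.Perm G) (hWG : ∀ t ∈ W, ∀ v ∈ t, v ∈ G)
    (hW : (W.map (List.map ty)).Perm (S.map (shiftedTypes key rk s G ty))) :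
    (W.map fun t => walk O (t.map pos) O).sum ≤ (S.map fun t => walk O (t.map pos) O).sum +
      2 * δ * (G.map fun v => dist O (pos v)).sum := by
  have hSG : ∀ t ∈ S, ∀ u ∈ t, u ∈ G := fun t ht u hu =>
    hS.mem_iff.1 (List.mem_flatten_of_mem ht hu)
  have hwalk : ∀ w ∈ W, ∀ t ∈ S, w.map ty = shiftedTypes key rk s G ty t →
      walk O (w.map pos) O ≤
        walk O (t.map pos) O + (t.map fun u => 2 * (δ * dist O (pos u))).sum := by
    intro w hw t ht h
    have hle := walk_le_of_sublistForall₂ (pos := pos) (e := fun u => δ * dist O (pos u))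
      (fun u => by positivity) (sublistForall₂_of_map_eq_shiftedTypes hty (hWG w hw) h
        fun u hu v hv hkey _ => hdist u (hSG t ht u hu) v (hWG w hw v hv) hkey) O O O
    simpa using hle
  refine (sum_le_sum_of_map_perm hW hwalk).trans_eq ?_
  have hflatten : (S.map fun t => (t.map fun u => 2 * (δ * dist O (pos u))).sum).sum =
      (S.flatten.map fun u => 2 * (δ * dist O (pos u))).sum := by
    rw [List.map_flatten, List.sum_flatten, List.map_map]
    rfl
  rw [List.sum_map_add, hflatten, (hS.map _).sum_eq, ← List.sum_map_mul_left]
  simp only [mul_assoc]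

theorem sum_le_one_of_perm_shiftedTypes {dem : α → ℚ} (hdem0 : ∀ u ∈ G, 0 ≤ dem u)
    (hdem : ∀ u ∈ G, ∀ w ∈ G, key u = key w → rk u ≤ rk w → dem w ≤ dem u)
    (hSG : ∀ t ∈ S, ∀ u ∈ t, u ∈ G) (hWG : ∀ t ∈ W, ∀ v ∈ t, v ∈ G)
    (hW : (W.map (List.map ty)).Perm (S.map (shiftedTypes key rk s G ty)))
    (hcap : ∀ t ∈ S, (t.map dem).sum ≤ 1) : ∀ w ∈ W, (w.map dem).sum ≤ 1 := by
  intro w hw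
  obtain ⟨t, ht, htw⟩ := List.mem_map.1 (hW.mem_iff.1 (List.mem_map_of_mem hw))
  refine (sum_map_le_of_sublistForall₂ ?_ fun u hu => hdem0 u (hSG t ht u hu)).trans (hcap t ht)
  exact sublistForall₂_of_map_eq_shiftedTypes hty (hWG w hw) htw.symm
    fun u hu v hv => hdem u (hSG t ht u hu) v (hWG w hw v hv)

/-- The elements left over have the types of the lowest ranks, which are few in each cell. -/
theorem IsRanking.mul_sum_rest_le [DecidableEq κ] (hG : IsRanking key rk G) {K : ℕ}
    (hs : ∀ v ∈ G, s (key v) * K ≤ (G.filter fun w => key w = key v).length) (hδ : 0 ≤ δ)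
    (hdist : ∀ u ∈ G, ∀ w ∈ G, key u = key w → dist (pos w) (pos u) ≤ δ * dist O (pos u))
    {R : List α} (hS : S.flatten.Perm G) (hWR : (W.flatten ++ R).Perm G)
    (hW : (W.map (List.map ty)).Perm (S.map (shiftedTypes key rk s G ty))) :
    K * (R.map fun v => dist O (pos v)).sum ≤
      (1 + δ) ^ 2 * (G.map fun v => dist O (pos v)).sum := by
  have hR : (R.map ty).Perm ((G.filter fun w => rk w < s (key w)).map ty) := by
    have hWRty := hWR.map ty
    rw [List.map_append, List.map_flatten] at hWRty
    exact (List.perm_append_left_iff _).1 ((hW.flatten.symm.append_right _).trans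
      (hWRty.trans (hG.flatten_shiftedTypes_append_perm ty hS).symm))
  have hkey : ∀ u ∈ G, ∀ w ∈ G, key u = key w →
      dist O (pos w) ≤ (1 + δ) * dist O (pos u) := fun u hu w hw h => by
    linarith [hdist u hu w hw h, dist_triangle O (pos u) (pos w), dist_comm (pos u) (pos w)]
  have hrest := sum_le_sum_of_map_perm (a := fun v => dist O (pos v))
    (b := fun v => (1 + δ) * dist O (pos v)) hR fun v hv u hu h =>
      have hvG := hWR.mem_iff.1 (List.mem_append_right _ hv)
      have huG := (List.mem_filter.1 hu).1
      hkey u huG v hvG (hty v hvG u huG h).1.symm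
  rw [List.sum_map_mul_left] at hrest
  have hlow := hG.mul_sum_lowRank_le hs (d := fun v => dist O (pos v))
    (fun _ => dist_nonneg) (b := 1 + δ) (by linarith) hkey
  calc K * (R.map fun v => dist O (pos v)).sum
      ≤ K * ((1 + δ) * ((G.filter fun w => rk w < s (key w)).map fun v => dist O (pos v)).sum) := by
        gcongr
    _ = (1 + δ) * (K * ((G.filter fun w => rk w < s (key w)).map fun v => dist O (pos v)).sum) := by
        ring
    _ ≤ (1 + δ) * ((1 + δ) * (G.map fun v => dist O (pos v)).sum) := by gcongr
    _ = (1 + δ) ^ 2 * (G.map fun v => dist O (pos v)).sum := by ring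

end Replacement

end Grouping

/-! ### Geometry of the cells -/

theorem maxNorm_le_dist (p q : ℚ × ℚ) :
    (maxNorm (p - q) : ℝ) ≤ dist (toPlane p) (toPlane q) := by
  rw [dist_toPlane, maxNorm, Rat.cast_max, Rat.cast_abs, Rat.cast_abs]
  exact max_le (Real.abs_le_sqrt (le_add_of_nonneg_right (sq_nonneg _)))
    (Real.abs_le_sqrt (le_add_of_nonneg_left (sq_nonneg _)))

theorem dist_le_two_mul_maxNorm (p q : ℚ × ℚ) :
    dist (toPlane p) (toPlane q) ≤ 2 * maxNorm (p - q) := by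
  have hfst : |((p.1 - q.1 : ℚ) : ℝ)| ≤ maxNorm (p - q) := by exact_mod_cast le_max_left _ _
  have hsnd : |((p.2 - q.2 : ℚ) : ℝ)| ≤ maxNorm (p - q) := by exact_mod_cast le_max_right _ _
  have hnonneg : (0 : ℝ) ≤ maxNorm (p - q) := (abs_nonneg _).trans hfst
  rw [dist_toPlane, Real.sqrt_le_left (by positivity)]
  nlinarith [sq_le_sq' (abs_le.1 hfst).1 (abs_le.1 hfst).2,
    sq_le_sq' (abs_le.1 hsnd).1 (abs_le.1 hsnd).2]

theorem maxNorm_le_dist_depot (p : ℚ × ℚ) : (maxNorm p : ℝ) ≤ dist depot (toPlane p) := by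
  have h := maxNorm_le_dist p 0
  rw [sub_zero, dist_comm] at h
  exact h

theorem dist_depot_le_two_mul_maxNorm (p : ℚ × ℚ) : dist depot (toPlane p) ≤ 2 * maxNorm p := by
  have h := dist_le_two_mul_maxNorm p 0
  rw [sub_zero, dist_comm] at h
  exact h

theorem maxNorm_nonneg (p : ℚ × ℚ) : 0 ≤ maxNorm p :=
  (abs_nonneg p.1).trans (le_max_left _ _)

section Cells

variable {K : ℕ} {p q : ℚ × ℚ}

theorem zpow_scale_le_maxNorm (hK : 1 < K) (hp : 0 < maxNorm p) :
    (K : ℚ) ^ (cellOf K p).scale ≤ maxNorm p :=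
  Int.zpow_log_le_self hK hp

theorem maxNorm_lt_zpow_scale_add_one (hK : 1 < K) (p : ℚ × ℚ) :
    maxNorm p < (K : ℚ) ^ ((cellOf K p).scale + 1) :=
  Int.lt_zpow_succ_log_self hK _

theorem abs_sub_lt_of_floor_div_mul_eq {x y z c : ℚ} (hz : 0 < z) (hc : 0 < c)
    (h : ⌊x / z * c⌋ = ⌊y / z * c⌋) : |x - y| < z / c := by
  have habs := Int.abs_sub_lt_one_of_floor_eq_floor h
  rwa [show x / z * c - y / z * c = (x - y) / (z / c) by field_simp, abs_div,
    abs_of_pos (div_pos hz hc), div_lt_one (div_pos hz hc)] at habs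

theorem maxNorm_sub_lt_of_cellOf_eq (hK : 1 < K) (h : cellOf K p = cellOf K q) :
    maxNorm (p - q) < (K : ℚ) ^ (cellOf K q).scale / K := by
  have hz : (0 : ℚ) < (K : ℚ) ^ (cellOf K q).scale := by positivity
  have hscale : Int.log K (maxNorm p) = (cellOf K q).scale := congrArg Cell.scale h
  have hcol := congrArg Cell.col h
  have hrow := congrArg Cell.row h
  simp only [cellOf, hscale] at hcol hrow
  exact max_lt (abs_sub_lt_of_floor_div_mul_eq hz (by positivity) hcol)
    (abs_sub_lt_of_floor_div_mul_eq hz (by positivity) hrow)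

theorem maxNorm_sub_le_of_cellOf_eq (hK : 1 < K) (h : cellOf K p = cellOf K q) :
    maxNorm (p - q) ≤ maxNorm q / K := by
  have hlt := maxNorm_sub_lt_of_cellOf_eq hK h
  rcases (maxNorm_nonneg q).eq_or_lt with hq | hq
  · have hq0 : q = 0 := by
      have := max_le_iff.1 hq.ge
      exact Prod.ext (abs_nonpos_iff.1 this.1) (abs_nonpos_iff.1 this.2)
    have hscale : (cellOf K q).scale = 0 := by simp [cellOf, ← hq]
    rcases (maxNorm_nonneg p).eq_or_lt with hp | hp
    · rw [hq0, sub_zero, ← hp]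
      exact div_nonneg (maxNorm_nonneg 0) K.cast_nonneg
    have hle := zpow_scale_le_maxNorm hK hp
    rw [h, hscale, zpow_zero] at hle
    rw [hq0, sub_zero, ← hq0, hscale, zpow_zero] at hlt
    have : (1 : ℚ) / K < 1 := (div_lt_one (by positivity)).2 (by exact_mod_cast hK)
    linarith
  · exact hlt.le.trans (div_le_div_of_nonneg_right (zpow_scale_le_maxNorm hK hq) (by positivity))

theorem two_mul_le_dist_depot {x : ℚ} (h : x ≤ maxNorm q / K) :
    2 * (x : ℝ) ≤ 2 / K * dist depot (toPlane q) := by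
  have hcast : (x : ℝ) ≤ maxNorm q / K := by exact_mod_cast h
  calc 2 * (x : ℝ) ≤ 2 * (maxNorm q / K) := by gcongr
    _ = 2 / K * maxNorm q := by ring
    _ ≤ 2 / K * dist depot (toPlane q) := by
        gcongr
        exact maxNorm_le_dist_depot q

theorem dist_le_of_cellOf_eq (hK : 1 < K) (h : cellOf K p = cellOf K q) :
    dist (toPlane p) (toPlane q) ≤ 2 / K * dist depot (toPlane q) :=
  (dist_le_two_mul_maxNorm p q).trans (two_mul_le_dist_depot (maxNorm_sub_le_of_cellOf_eq hK h))

theorem dist_depot_le_of_scale_add_two_le (hK : 1 < K) (hq : 0 < maxNorm q)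
    (h : (cellOf K p).scale + 2 ≤ (cellOf K q).scale) :
    dist depot (toPlane p) ≤ 2 / K * dist depot (toPlane q) := by
  have hK0 : (0 : ℚ) < K := by positivity
  refine (dist_depot_le_two_mul_maxNorm p).trans (two_mul_le_dist_depot ?_)
  calc maxNorm p ≤ (K : ℚ) ^ ((cellOf K p).scale + 1) := (maxNorm_lt_zpow_scale_add_one hK p).le
    _ ≤ (K : ℚ) ^ ((cellOf K q).scale - 1) :=
        zpow_le_zpow_right₀ (by exact_mod_cast hK.le) (by omega)
    _ = (K : ℚ) ^ (cellOf K q).scale / K := zpow_sub_one₀ hK0.ne' _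
    _ ≤ maxNorm q / K := by gcongr; exact zpow_scale_le_maxNorm hK hq

theorem floor_mem_Icc_of_abs_le {x : ℚ} {n : ℕ} (h : |x| ≤ n) :
    ⌊x⌋ ∈ Finset.Icc (-(n : ℤ)) n := by
  obtain ⟨hlower, hupper⟩ := abs_le.1 h
  refine Finset.mem_Icc.2 ⟨Int.le_floor.2 (by exact_mod_cast hlower), ?_⟩
  exact_mod_cast (Int.floor_le x).trans hupper

theorem abs_div_zpow_scale_mul_le (hK : 1 < K) {x : ℚ} (hx : |x| ≤ maxNorm p) :
    |x / (K : ℚ) ^ Int.log K (maxNorm p) * K| ≤ (K * K : ℕ) := by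
  have hK0 : (0 : ℚ) < K := by positivity
  have hlt := hx.trans (maxNorm_lt_zpow_scale_add_one hK p).le
  rw [zpow_add_one₀ hK0.ne'] at hlt
  rw [abs_mul, abs_div, abs_of_pos hK0, abs_of_pos (zpow_pos hK0 _), Nat.cast_mul]
  gcongr
  exact (div_le_iff₀' (by positivity)).2 hlt

theorem cellOf_mem_Icc (hK : 1 < K) (p : ℚ × ℚ) :
    (cellOf K p).col ∈ Finset.Icc (-((K * K : ℕ) : ℤ)) (K * K : ℕ) ∧
      (cellOf K p).row ∈ Finset.Icc (-((K * K : ℕ) : ℤ)) (K * K : ℕ) :=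
  ⟨floor_mem_Icc_of_abs_le (abs_div_zpow_scale_mul_le hK (le_max_left _ _)),
    floor_mem_Icc_of_abs_le (abs_div_zpow_scale_mul_le hK (le_max_right _ _))⟩

end Cells

/-! ### Demand classes and types -/

section Rank

variable {l : List Terminal} {u v w : Terminal}

theorem rank_lt_rank (hu : u ∈ l) (h : u.sortKey < v.sortKey) : rank l u < rank l v := by
  obtain ⟨s, t, rfl⟩ := List.append_of_mem hu
  have hmono : ∀ m : List Terminal, rank m u ≤ rank m v := fun m =>
    List.countP_mono_left fun w _ hw => decide_eq_true ((of_decide_eq_true hw).trans h)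
  have hs := hmono s
  have ht := hmono t
  simp only [rank, List.countP_append, List.countP_cons, h, lt_irrefl, decide_true, decide_false,
    if_true, Bool.false_eq_true, if_false] at *
  omega

theorem rank_lt_length (hv : v ∈ l) : rank l v < l.length := by
  refine List.countP_le_length.lt_of_ne fun h => ?_
  simpa using List.countP_eq_length.1 h v hv

theorem eq_of_rank_eq (hl : (l.map Terminal.index).Nodup) (hu : u ∈ l) (hv : v ∈ l)
    (h : rank l u = rank l v) : u = v := by
  rcases lt_trichotomy u.sortKey v.sortKey with hlt | heq | hgt
  · exact absurd h (rank_lt_rank hu hlt).ne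
  · exact List.inj_on_of_nodup_map hl hu hv (congrArg (fun x => (ofLex x).2) heq)
  · exact absurd h (rank_lt_rank hv hgt).ne'

theorem exists_rank_eq (hl : (l.map Terminal.index).Nodup) {n : ℕ} (hn : n < l.length) :
    ∃ u ∈ l, rank l u = n := by
  classical
  have himage : l.toFinset.image (rank l) = Finset.range l.length := by
    refine Finset.eq_of_subset_of_card_le (fun m hm => ?_) ?_
    · obtain ⟨u, hu, rfl⟩ := Finset.mem_image.1 hm
      exact Finset.mem_range.2 (rank_lt_length (List.mem_toFinset.1 hu))
    · rw [Finset.card_range, Finset.card_image_of_injOn, List.toFinset_card_of_nodup hl.of_map]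
      exact fun u hu v hv => eq_of_rank_eq hl (List.mem_toFinset.1 hu) (List.mem_toFinset.1 hv)
  have hmem : n ∈ l.toFinset.image (rank l) := himage ▸ Finset.mem_range.2 hn
  simpa using hmem

theorem demand_le_of_rank_le (hw : w ∈ l) (h : rank l u ≤ rank l w) : w.demand ≤ u.demand := by
  by_contra! hlt
  exact h.not_gt (rank_lt_rank hw (Terminal.sortKey_lt_sortKey.2 (.inl hlt)))

end Rank

section Classify

variable {K : ℕ} {l : List Terminal} {u v w : Item}

/-- The rank of a terminal in its cell. -/
def itemRank (K : ℕ) (l : List Terminal) (v : Item) : ℕ :=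
  rank (inCell K l v.cell) v.toTerminal

/-- The size of the demand classes in a cell; it is `0` for a cell with fewer than `K` terminals,
whose terminals need not be replaced by others. -/
def cellShift (K : ℕ) (l : List Terminal) (κ : Cell) : ℕ := (inCell K l κ).length / K

theorem mem_classify : v ∈ classify K l ↔ v.toTerminal ∈ l ∧
    classifyTerminal K l v.toTerminal = v := by
  rw [classify, List.mem_map]
  refine ⟨?_, fun h => ⟨_, h⟩⟩
  rintro ⟨v, hv, rfl⟩
  exact ⟨hv, rfl⟩

theorem map_toTerminal_classify : (classify K l).map Item.toTerminal = l := by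
  rw [classify, List.map_map]
  exact List.map_id l

theorem cell_eq_of_mem_classify (hv : v ∈ classify K l) : v.cell = cellOf K v.pos :=
  congrArg Item.cell (mem_classify.1 hv).2.symm

theorem group_eq_of_mem_classify (hv : v ∈ classify K l) :
    v.group = itemRank K l v / max (cellShift K l v.cell) 1 := by
  obtain ⟨v, -, rfl⟩ := List.mem_map.1 hv
  rfl

theorem mem_inCell_of_mem_classify (hv : v ∈ classify K l) : v.toTerminal ∈ inCell K l v.cell :=
  List.mem_filter.2 ⟨(mem_classify.1 hv).1, decide_eq_true (cell_eq_of_mem_classify hv).symm⟩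

theorem nodup_map_index_inCell (hl : (l.map Terminal.index).Nodup) (κ : Cell) :
    ((inCell K l κ).map Terminal.index).Nodup :=
  hl.sublist (List.filter_sublist.map _)

theorem length_filter_cell_eq (κ : Cell) :
    ((classify K l).filter fun v => v.cell = κ).length = (inCell K l κ).length := by
  rw [classify, List.filter_map, List.length_map]
  rfl

theorem isRanking_classify (hl : (l.map Terminal.index).Nodup) :
    IsRanking Item.cell (itemRank K l) (classify K l) where
  nodup := .of_map Item.toTerminal (map_toTerminal_classify.symm ▸ hl.of_map)
  eq_of_rk_eq u hu w hw hcell hrank := by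
    have hterminal : u.toTerminal = w.toTerminal := by
      rw [itemRank, itemRank, hcell] at hrank
      exact eq_of_rank_eq (nodup_map_index_inCell hl _) (hcell ▸ mem_inCell_of_mem_classify hu)
        (mem_inCell_of_mem_classify hw) hrank
    rw [← (mem_classify.1 hu).2, ← (mem_classify.1 hw).2, hterminal]
  exists_rk_eq v hv n hn := by
    obtain ⟨u, hu, hrank⟩ := exists_rank_eq (nodup_map_index_inCell hl v.cell)
      (hn.trans (rank_lt_length (mem_inCell_of_mem_classify hv)))
    obtain ⟨hul, hcell⟩ := List.mem_filter.1 hu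
    have hcell : cellOf K u.pos = v.cell := of_decide_eq_true hcell
    exact ⟨classifyTerminal K l u, List.mem_map_of_mem hul, hcell,
      (congrArg (fun κ => rank (inCell K l κ) u) hcell).trans hrank⟩

theorem demand_le_of_itemRank_le (hw : w ∈ classify K l) (hcell : u.cell = w.cell)
    (h : itemRank K l u ≤ itemRank K l w) : w.demand ≤ u.demand := by
  rw [itemRank, itemRank, hcell] at h
  exact demand_le_of_rank_le (mem_inCell_of_mem_classify hw) h

theorem group_lt_of_mem_classify (hK : 0 < K) (hv : v ∈ classify K l) : v.group < 2 * K := by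
  rw [group_eq_of_mem_classify hv, cellShift, itemRank]
  have hrank := rank_lt_length (mem_inCell_of_mem_classify hv)
  set n := (inCell K l v.cell).length
  have hlt : n < K * (n / K + 1) := Nat.lt_mul_div_succ n hK
  have hmax : n / K + 1 ≤ 2 * max (n / K) 1 := by omega
  rw [Nat.div_lt_iff_lt_mul (by omega)]
  calc rank (inCell K l v.cell) v.toTerminal < K * (n / K + 1) := hrank.trans hlt
    _ ≤ K * (2 * max (n / K) 1) := Nat.mul_le_mul_left K hmax
    _ = 2 * K * max (n / K) 1 := by ring

end Classify

/-- A set of types that contains `relType K a v` for all terminals `v` of all instances. -/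
noncomputable def allTypes (K : ℕ) : Finset (Cell × ℕ) :=
  ((Finset.Ico (0 : ℤ) K ×ˢ Finset.Icc (-((K * K : ℕ) : ℤ)) (K * K : ℕ) ×ˢ
    Finset.Icc (-((K * K : ℕ) : ℤ)) (K * K : ℕ)).image fun x => ⟨x.1, x.2.1, x.2.2⟩) ×ˢ
    Finset.range (2 * K)

theorem relType_mem_allTypes {K : ℕ} (hK : 1 < K) (a : ℕ) {l : List Terminal} {v : Item}
    (hv : v ∈ classify K l) : relType K a v ∈ allTypes K := by
  have hbounds := cellOf_mem_Icc hK v.pos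
  rw [← cell_eq_of_mem_classify hv] at hbounds
  have hscale : (v.cell.scale - a) % K ∈ Finset.Ico (0 : ℤ) K :=
    Finset.mem_Ico.2 ⟨Int.emod_nonneg _ (by omega), Int.emod_lt_of_pos _ (by omega)⟩
  exact Finset.mem_product.2 ⟨Finset.mem_image.2 ⟨(_, v.cell.col, v.cell.row),
    Finset.mem_product.2 ⟨hscale, Finset.mem_product.2 hbounds⟩, rfl⟩,
    Finset.mem_range.2 (group_lt_of_mem_classify (by omega) hv)⟩

/-- The configurations: `Cs` contains once every list of at most `k` types of terminals. -/
structure ListsConfigurations (K k : ℕ) (Cs : List (List (Cell × ℕ))) : Prop where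
  nodup : Cs.Nodup
  mem : ∀ c : List (Cell × ℕ), c.length ≤ k → (∀ t ∈ c, t ∈ allTypes K) → c ∈ Cs

theorem exists_listsConfigurations (K k : ℕ) : ∃ Cs, ListsConfigurations K k Cs := by
  have hfinite := (List.finite_length_le (allTypes K) k).image (List.map Subtype.val)
  refine ⟨hfinite.toFinset.toList, Finset.nodup_toList _, fun c hc hT => ?_⟩
  lift c to List (allTypes K) using hT
  simpa using ⟨c, by simpa using hc, rfl⟩

/-! ### Feasibility -/

/-- The tours of `S` are within the capacity and serve each terminal of `l` once. -/
def Packs (S : List (List Item)) (l : List Item) : Prop :=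
  S.flatten.Perm l ∧ ∀ t ∈ S, (t.map fun v => v.demand).sum ≤ 1

theorem Packs.perm {S : List (List Item)} {l m : List Item} (h : Packs S l) (hlm : l.Perm m) :
    Packs S m := ⟨h.1.trans hlm, h.2⟩

theorem Packs.append {S T : List (List Item)} {l m : List Item} (h : Packs S l)
    (h' : Packs T m) : Packs (S ++ T) (l ++ m) :=
  ⟨by simpa using h.1.append h'.1, fun t ht => (List.mem_append.1 ht).elim (h.2 t) (h'.2 t)⟩

theorem packs_flatMap {β : Type*} {L : List β} {S : β → List (List Item)} {l : β → List Item}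
    (h : ∀ b ∈ L, Packs (S b) (l b)) : Packs (L.flatMap S) (L.flatMap l) := by
  induction L with
  | nil => exact ⟨.refl _, by simp⟩
  | cons b L ih =>
    rw [List.forall_mem_cons] at h
    exact h.1.append (ih h.2)

theorem packs_singletons {l : List Item} (h : ∀ v ∈ l, v.demand ≤ 1) :
    Packs (l.map fun v => [v]) l := by
  refine ⟨.of_eq (by simp [← List.flatMap_def]), fun t ht => ?_⟩
  obtain ⟨v, hv, rfl⟩ := List.mem_map.1 ht
  simpa using h v hv

theorem packs_splitTour {t : List Item} (h : ∀ v ∈ t, v.demand ≤ 1) : Packs (splitTour t) t := by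
  unfold splitTour
  split_ifs with hcap
  · exact ⟨by simp, by simpa using hcap⟩
  · exact packs_singletons h

theorem packs_finish {x : List Item × List (List Item)} {l : List Item}
    (hx : (x.2.flatten ++ x.1).Perm l) (h : ∀ v ∈ l, v.demand ≤ 1) : Packs (finish x) l := by
  have hdemand : ∀ v ∈ x.2.flatten ++ x.1, v.demand ≤ 1 := fun v hv => h v (hx.mem_iff.1 hv)
  have hsplit : Packs (x.2.flatMap splitTour) (x.2.flatMap id) :=
    packs_flatMap fun t ht => packs_splitTour fun v hv =>
      hdemand v (List.mem_append_left _ (List.mem_flatten_of_mem ht hv))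
  rw [List.flatMap_id] at hsplit
  exact (hsplit.append (packs_singletons fun v hv =>
    hdemand v (List.mem_append_right _ hv))).perm hx

theorem packs_best (K : ℕ) {l : List Item} {C : List (List (List Item))}
    (h : ∀ v ∈ l, v.demand ≤ 1) (hC : ∀ S ∈ C, Packs S l) : Packs (best K l C) l := by
  rcases List.mem_cons.1 (List.minOn_mem (f := approxCost K)
    (h := List.cons_ne_nil (l.map fun v => [v]) C)) with hbest | hbest
  · rw [best, hbest]
    exact packs_singletons h
  · exact hC _ hbest

theorem totalLength_best_le (K : ℕ) (l : List Item) {C : List (List (List Item))}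
    {S : List (List Item)} (hS : S ∈ C) :
    totalLength (best K l C) ≤ (1 + (1 / 2) ^ K) * totalLength S := by
  have hle : (approxCost K (best K l C) : ℝ) ≤ approxCost K S := by
    exact_mod_cast List.apply_minOn_le_of_mem (f := approxCost K) (List.mem_cons_of_mem _ hS)
  exact (approxCost_bounds K _).1.trans (hle.trans (approxCost_bounds K S).2)

theorem packs_solveBlock (K a : ℕ) (Cs : List (List (Cell × ℕ))) {l : List Item}
    (h : ∀ v ∈ l, v.demand ≤ 1) : Packs (solveBlock K a Cs l) l := by
  refine packs_best K h fun S hS => ?_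
  obtain ⟨x, hx, rfl⟩ := List.mem_map.1 hS
  exact packs_finish (states_perm hx) h

theorem mem_inner {K a : ℕ} {l : List Item} {v : Item} :
    v ∈ inner K a l ↔ v ∈ l ∧ ¬Separates K a v := by
  simp [inner]

theorem mem_blockItems {K a : ℕ} {l : List Item} {b : ℤ} {v : Item} :
    v ∈ blockItems K a l b ↔ v ∈ l ∧ ¬Separates K a v ∧ blockOf K a v = b := by
  simp [blockItems, mem_inner, and_assoc]

theorem blockItems_sublist (K a : ℕ) (l : List Item) (b : ℤ) : (blockItems K a l b).Sublist l :=
  List.filter_sublist.trans List.filter_sublist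

theorem blocks_flatMap_blockItems_perm (K a : ℕ) {l m : List Item} (h : ∀ v ∈ m, v ∈ l) :
    ((blocks K a l).flatMap (blockItems K a m)).Perm (inner K a m) := by
  refine flatMap_filter_perm (List.nodup_dedup _) fun v hv => ?_
  rw [mem_inner] at hv
  exact List.mem_dedup.2 (List.mem_map_of_mem (mem_inner.2 ⟨h v hv.1, hv.2⟩))

theorem packs_solveShift (K a : ℕ) (Cs : List (List (Cell × ℕ))) {l : List Item}
    (h : ∀ v ∈ l, v.demand ≤ 1) : Packs (solveShift K a Cs l) l := by
  have hseparating := packs_singletons (l := l.filter fun v => Separates K a v)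
    fun v hv => h v (List.mem_of_mem_filter hv)
  have hblocks : Packs ((blocks K a l).flatMap fun b => solveBlock K a Cs (blockItems K a l b))
      ((blocks K a l).flatMap (blockItems K a l)) :=
    packs_flatMap fun b _ => packs_solveBlock K a Cs fun v hv => h v (mem_blockItems.1 hv).1
  have hinner := hblocks.perm (blocks_flatMap_blockItems_perm K a fun _ => id)
  refine (hseparating.append hinner).perm ?_
  simpa [inner] using List.filter_append_perm (fun v => Separates K a v) l

theorem packs_solve (K : ℕ) (Cs : List (List (Cell × ℕ))) {l : List Item}
    (h : ∀ v ∈ l, v.demand ≤ 1) : Packs (solve K Cs l) l := by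
  refine packs_best K h fun S hS => ?_
  obtain ⟨a, -, rfl⟩ := List.mem_map.1 hS
  exact packs_solveShift K a Cs h

/-! ### Radii and the splitting of tours among the blocks -/

/-- The distance of a terminal from the depot. -/
noncomputable def rad (v : Item) : ℝ := dist depot (itemPos v)

theorem rad_nonneg (v : Item) : 0 ≤ rad v := dist_nonneg

theorem sum_map_rad_nonneg (l : List Item) : 0 ≤ (l.map rad).sum :=
  List.sum_nonneg (List.forall_mem_map.2 fun v _ => rad_nonneg v)

theorem tourLength_le_sum (t : List Item) : tourLength t ≤ (t.map fun v => 2 * rad v).sum := by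
  have h := walk_le_dist_add_sum depot depot (t.map itemPos)
  rwa [dist_self, zero_add, List.map_map] at h

theorem two_mul_rad_le_tourLength {v : Item} {t : List Item} (h : v ∈ t) :
    2 * rad v ≤ tourLength t :=
  two_mul_dist_le_walk (List.mem_map_of_mem h) _

theorem tourLength_sublist {s t : List Item} (h : s.Sublist t) : tourLength s ≤ tourLength t :=
  walk_sublist (h.map _) _ _

theorem sum_map_rad_sublist {s t : List Item} (h : s.Sublist t) :
    (s.map rad).sum ≤ (t.map rad).sum :=
  (h.map rad).sum_le_sum (List.forall_mem_map.2 fun v _ => rad_nonneg v)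

theorem totalLength_cons (t : List Item) (S : List (List Item)) :
    totalLength (t :: S) = tourLength t + totalLength S := by
  simp [totalLength]

theorem totalLength_nonneg (S : List (List Item)) : 0 ≤ totalLength S :=
  List.sum_nonneg (List.forall_mem_map.2 fun t _ => tourLength_nonneg t)

theorem totalLength_singletons (l : List Item) :
    totalLength (l.map fun v => [v]) = 2 * (l.map rad).sum := by
  rw [totalLength, List.map_map, ← List.sum_map_mul_left]
  congr 1
  refine List.map_congr_left fun v _ => ?_
  simp only [Function.comp_apply, tourLength, List.map_cons, List.map_nil, walk_cons, walk_nil]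
  rw [dist_comm (itemPos v), rad, two_mul]

theorem two_mul_sum_rad_le_totalLength {k : ℕ} {S : List (List Item)}
    (hS : ∀ t ∈ S, t.length ≤ k) : 2 * (S.flatten.map rad).sum ≤ k * totalLength S := by
  induction S with
  | nil => simp [totalLength]
  | cons t S ih =>
    rw [List.forall_mem_cons] at hS
    have htour : 2 * (t.map rad).sum ≤ k * tourLength t :=
      calc 2 * (t.map rad).sum = (t.map fun v => 2 * rad v).sum := (List.sum_map_mul_left ..).symm
        _ ≤ (t.map fun v => 2 * rad v).length • tourLength t :=
          List.sum_le_card_nsmul _ _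
            (List.forall_mem_map.2 fun v hv => two_mul_rad_le_tourLength hv)
        _ ≤ k * tourLength t := by
          rw [List.length_map, nsmul_eq_mul]
          exact mul_le_mul_of_nonneg_right (Nat.cast_le.2 hS.1) (tourLength_nonneg t)
    rw [totalLength_cons, List.flatten_cons, List.map_append, List.sum_append]
    linarith [ih hS.2]

section Split

variable {K a k : ℕ} {l : List Terminal}

theorem scale_add_two_le_of_blockOf_lt (hK : 0 < K) {u v : Item} (hv : ¬Separates K a v)
    (h : blockOf K a u < blockOf K a v) : u.cell.scale + 2 ≤ v.cell.scale := by
  have hK' : (0 : ℤ) < K := by omega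
  have hu_div := Int.mul_ediv_add_emod (u.cell.scale - a) K
  have hv_div := Int.mul_ediv_add_emod (v.cell.scale - a) K
  have hu_mod := Int.emod_lt_of_pos (u.cell.scale - a) hK'
  have hv_mod := Int.emod_nonneg (v.cell.scale - a) hK'.ne'
  have hblock := Int.mul_le_mul_of_nonneg_left (Int.add_one_le_of_lt h) hK'.le
  rw [Int.mul_add, Int.mul_one] at hblock
  unfold Separates at hv
  unfold blockOf at hblock
  omega

theorem rad_le_of_blockOf_lt (hK : 1 < K) {u v : Item} (hu : u ∈ classify K l)
    (hv : v ∈ classify K l) (hsep : ¬Separates K a v) (hv0 : 0 < rad v)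
    (h : blockOf K a u < blockOf K a v) : rad u ≤ 2 / K * rad v := by
  have hnorm : (0 : ℝ) < maxNorm v.pos := by
    have : rad v ≤ 2 * maxNorm v.pos := dist_depot_le_two_mul_maxNorm v.pos
    linarith
  refine dist_depot_le_of_scale_add_two_le hK (by exact_mod_cast hnorm) ?_
  rw [← cell_eq_of_mem_classify hu, ← cell_eq_of_mem_classify hv]
  exact scale_add_two_le_of_blockOf_lt (by omega) hsep h

theorem two_div_le_one (hK : 1 < K) : 2 / (K : ℝ) ≤ 1 := by
  rw [div_le_one (by positivity)]
  exact_mod_cast hK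

theorem rad_le_of_blockOf_ne (hK : 1 < K) {u v : Item} (hu : u ∈ inner K a (classify K l))
    (hv : v ∈ inner K a (classify K l)) (hne : blockOf K a u ≠ blockOf K a v)
    (hle : rad u ≤ rad v) : rad u ≤ 2 / K * rad v := by
  rw [mem_inner] at hu hv
  rcases (rad_nonneg u).eq_or_lt with hu0 | hu0
  · rw [← hu0]
    exact mul_nonneg (by positivity) (rad_nonneg v)
  rcases hne.lt_or_gt with h | h
  · exact rad_le_of_blockOf_lt hK hu.1 hv.1 hv.2 (hu0.trans_le hle) h
  · calc rad u ≤ rad v := hle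
      _ ≤ 2 / K * rad u := rad_le_of_blockOf_lt hK hv.1 hu.1 hu.2 hu0 h
      _ ≤ 2 / K * rad v := mul_le_mul_of_nonneg_left hle (by positivity)

theorem tourLength_blockItems_le_of_ne (hK : 1 < K) {t : List Item}
    (ht : ∀ v ∈ t, v ∈ classify K l) {z : Item} (hz : z ∈ inner K a t)
    (hmax : ∀ v ∈ inner K a t, rad v ≤ rad z) {b : ℤ} (hb : b ≠ blockOf K a z) :
    tourLength (blockItems K a t b) ≤
      (blockItems K a t b).length * (2 / K * tourLength t) := by
  refine (tourLength_le_sum _).trans ?_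
  have h := List.sum_le_card_nsmul ((blockItems K a t b).map fun v => 2 * rad v)
    (2 / K * tourLength t) (List.forall_mem_map.2 fun v hv => ?_)
  · rwa [List.length_map, nsmul_eq_mul] at h
  obtain ⟨hvt, hsep, hvb⟩ := mem_blockItems.1 hv
  have hz' := mem_inner.1 hz
  calc 2 * rad v ≤ 2 * (2 / K * rad z) :=
        mul_le_mul_of_nonneg_left (rad_le_of_blockOf_ne hK (mem_inner.2 ⟨ht v hvt, hsep⟩)
          (mem_inner.2 ⟨ht z hz'.1, hz'.2⟩) (hvb.trans_ne hb)
          (hmax v (mem_inner.2 ⟨hvt, hsep⟩))) zero_le_two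
    _ = 2 / K * (2 * rad z) := by ring
    _ ≤ 2 / K * tourLength t :=
        mul_le_mul_of_nonneg_left (two_mul_rad_le_tourLength hz'.1) (by positivity)

theorem exists_forall_tourLength_blockItems_le (hK : 1 < K) {t : List Item}
    (ht : ∀ v ∈ t, v ∈ classify K l) :
    ∃ b₀, ∀ b, tourLength (blockItems K a t b) ≤ (if b = b₀ then tourLength t else 0) +
      (blockItems K a t b).length * (2 / K * tourLength t) := by
  have ht0 := tourLength_nonneg t
  classical
  by_cases hnil : inner K a t = []
  · refine ⟨0, fun b => ?_⟩
    rw [blockItems, hnil]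
    simp only [List.filter_nil, tourLength, List.map_nil, walk_nil, dist_self]
    positivity
  obtain ⟨z, hz, hmax⟩ := (inner K a t).toFinset.exists_max_image rad
    (by simpa using hnil)
  simp only [List.mem_toFinset] at hz hmax
  refine ⟨blockOf K a z, fun b => ?_⟩
  split_ifs with hb
  · have := tourLength_sublist (blockItems_sublist K a t b)
    have : 0 ≤ (blockItems K a t b).length * (2 / K * tourLength t) := by positivity
    linarith
  · rw [zero_add]
    exact tourLength_blockItems_le_of_ne hK ht hz hmax hb

-- One piece of the tour contains its farthest terminal; the terminals of all other pieces are so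
-- much closer to the depot that they can be served by tours of their own.
theorem sum_tourLength_blockItems_le (hK : 1 < K) {t : List Item}
    (ht : ∀ v ∈ t, v ∈ classify K l) (htk : t.length ≤ k) :
    ((blocks K a (classify K l)).map fun b => tourLength (blockItems K a t b)).sum ≤
      (1 + 2 * k / K) * tourLength t := by
  obtain ⟨b₀, hb₀⟩ := exists_forall_tourLength_blockItems_le (a := a) hK ht
  have ht0 := tourLength_nonneg t
  set B := blocks K a (classify K l)
  have hcount : (B.count b₀ : ℝ) ≤ 1 := by
    exact_mod_cast List.nodup_iff_count_le_one.1 (List.nodup_dedup _) b₀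
  have hlength : ((B.map fun b => ((blockItems K a t b).length : ℝ)).sum) ≤ k := by
    have hperm := (blocks_flatMap_blockItems_perm K a ht).length_eq
    rw [List.length_flatMap] at hperm
    have : (B.map fun b => (blockItems K a t b).length).sum ≤ k :=
      hperm.trans_le ((List.length_filter_le _ _).trans htk)
    simpa [Nat.cast_list_sum, Function.comp_def] using (Nat.cast_le (α := ℝ)).2 this
  calc (B.map fun b => tourLength (blockItems K a t b)).sum
      ≤ (B.map fun b => (if b = b₀ then tourLength t else 0) +
          (blockItems K a t b).length * (2 / K * tourLength t)).sum :=
        List.sum_le_sum fun b _ => hb₀ b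
    _ = B.count b₀ * tourLength t +
          (B.map fun b => ((blockItems K a t b).length : ℝ)).sum * (2 / K * tourLength t) := by
        rw [List.sum_map_add, List.sum_map_ite_eq, List.sum_map_mul_right]
        simp
    _ ≤ 1 * tourLength t + k * (2 / K * tourLength t) := by gcongr
    _ = (1 + 2 * k / K) * tourLength t := by ring

end Split

/-! ### The solution of a block -/

theorem cell_eq_and_group_eq_of_relType_eq {K a : ℕ} {u w : Item}
    (hblock : blockOf K a u = blockOf K a w) (h : relType K a u = relType K a w) :
    u.cell = w.cell ∧ u.group = w.group := by
  simp only [relType, Prod.mk.injEq, Cell.mk.injEq] at h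
  obtain ⟨⟨hmod, hcol, hrow⟩, hgroup⟩ := h
  have hu := Int.mul_ediv_add_emod (u.cell.scale - a) K
  have hw := Int.mul_ediv_add_emod (w.cell.scale - a) K
  unfold blockOf at hblock
  rw [hblock, hmod, hw] at hu
  exact ⟨Cell.ext (sub_left_inj.1 hu.symm) hcol hrow, hgroup⟩

theorem totalLength_finish {x : List Item × List (List Item)}
    (h : ∀ t ∈ x.2, (t.map fun v => v.demand).sum ≤ 1) :
    totalLength (finish x) = totalLength x.2 + 2 * (x.1.map rad).sum := by
  have hsplit : x.2.flatMap splitTour = x.2.flatMap fun t => [t] :=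
    List.flatMap_congr fun t ht => if_pos (h t ht)
  rw [finish, totalLength_append, totalLength_singletons, hsplit, List.flatMap_singleton']

theorem totalLength_filter_ne_nil (S : List (List Item)) :
    totalLength (S.filter fun t => t ≠ []) = totalLength S := by
  induction S with
  | nil => rfl
  | cons t S ih => cases t <;> simp_all [totalLength, tourLength, walk_nil]

theorem Packs.filter_ne_nil {S : List (List Item)} {l : List Item} (h : Packs S l) :
    Packs (S.filter fun t => t ≠ []) l := by
  exact ⟨List.flatten_filter_ne_nil.symm ▸ h.1, fun t ht => h.2 t (List.mem_of_mem_filter ht)⟩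

theorem length_le_length_flatten {α : Type*} {S : List (List α)} (h : ∀ t ∈ S, t ≠ []) :
    S.length ≤ S.flatten.length := by
  rw [List.length_flatten, ← List.length_map (f := List.length)]
  exact List.length_le_sum_of_one_le _
    (List.forall_mem_map.2 fun t ht => List.length_pos_iff.2 (h t ht))

/-- The classified terminals of a block. -/
abbrev block (K a : ℕ) (l : List Terminal) (b : ℤ) : List Item :=
  blockItems K a (classify K l) b

section Block

variable {K a k : ℕ} {l : List Terminal} {b : ℤ} {Cs : List (List (Cell × ℕ))}
  {P : List (List Item)}

theorem mem_block_of_cell_eq {u v : Item} (hv : v ∈ block K a l b)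
    (hu : u ∈ classify K l) (h : u.cell = v.cell) : u ∈ block K a l b := by
  rw [mem_blockItems] at hv ⊢
  unfold Separates blockOf at *
  rw [h]
  exact ⟨hu, hv.2⟩

theorem isRanking_block (hl : (l.map Terminal.index).Nodup) :
    IsRanking Item.cell (itemRank K l) (block K a l b) :=
  (isRanking_classify hl).of_subset
    ((isRanking_classify hl).nodup.sublist (blockItems_sublist ..))
    (blockItems_sublist ..).subset fun _ hv _ hu => mem_block_of_cell_eq hv hu

theorem cellShift_mul_le {v : Item} (hv : v ∈ block K a l b) :
    cellShift K l v.cell * K ≤ ((block K a l b).filter fun w => w.cell = v.cell).length := by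
  have hfilter : ((block K a l b).filter fun w => w.cell = v.cell) =
      (classify K l).filter fun w => w.cell = v.cell := by
    rw [block, blockItems, inner, List.filter_filter, List.filter_filter]
    refine List.filter_congr fun u hu => ?_
    by_cases hcell : u.cell = v.cell
    · have := mem_blockItems.1 (mem_block_of_cell_eq hv hu hcell)
      simp [this, hcell]
    · simp [hcell]
  rw [hfilter, length_filter_cell_eq]
  exact Nat.div_mul_le_self _ _

theorem cell_eq_and_class_eq_of_relType_eq {u w : Item} (hu : u ∈ block K a l b)
    (hw : w ∈ block K a l b) (h : relType K a u = relType K a w) : u.cell = w.cell ∧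
      itemRank K l u / max (cellShift K l u.cell) 1 =
        itemRank K l w / max (cellShift K l w.cell) 1 := by
  rw [mem_blockItems] at hu hw
  rw [← group_eq_of_mem_classify hu.1, ← group_eq_of_mem_classify hw.1]
  exact cell_eq_and_group_eq_of_relType_eq (hu.2.2.trans hw.2.2.symm) h

theorem dist_itemPos_le (hK : 1 < K) {u w : Item} (hu : u ∈ classify K l)
    (hw : w ∈ classify K l) (h : u.cell = w.cell) :
    dist (itemPos w) (itemPos u) ≤ 2 / K * rad u := by
  rw [cell_eq_of_mem_classify hu, cell_eq_of_mem_classify hw] at h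
  exact dist_le_of_cellOf_eq hK h.symm

/-- The configurations of the tours in `P` after linear grouping. -/
noncomputable def shiftedConfigurations (K a : ℕ) (l : List Terminal) (H : List Item)
    (P : List (List Item)) : List (List (Cell × ℕ)) :=
  P.map (shiftedTypes Item.cell (itemRank K l) (cellShift K l) H (relType K a))

theorem exists_mem_states_shiftedConfigurations (hK : 1 < K) (hCs : ListsConfigurations K k Cs)
    (hl : (l.map Terminal.index).Nodup) (hP : P.flatten.Perm (block K a l b))
    (hPk : ∀ t ∈ P, t.length ≤ k) (hP0 : ∀ t ∈ P, t ≠ []) :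
    ∃ x ∈ states (relType K a) Cs (block K a l b),
      (x.2.map (List.map (relType K a))).Perm (shiftedConfigurations K a l (block K a l b) P) := by
  refine exists_mem_states hCs.nodup (fun c hc => ?_) ?_
    ((isRanking_block hl).flatten_shiftedTypes_append_perm (relType K a) hP)
  · obtain ⟨t, ht, rfl⟩ := List.mem_map.1 hc
    refine hCs.mem _ ((List.length_filterMap_le _ _).trans (hPk t ht)) fun τ hτ => ?_
    obtain ⟨u, -, hu⟩ := List.mem_filterMap.1 hτ
    obtain ⟨w, hw, rfl⟩ := Option.map_eq_some_iff.1 hu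
    exact relType_mem_allTypes hK a (mem_blockItems.1 (shiftItem_spec hw).1).1
  · rw [shiftedConfigurations, List.length_map, ← hP.length_eq]
    exact length_le_length_flatten hP0

theorem totalLength_finish_le (hK : 1 < K) (hl : (l.map Terminal.index).Nodup)
    (hdemand : ∀ v ∈ l, 0 ≤ v.demand) (hP : Packs P (block K a l b))
    {x : List Item × List (List Item)}
    (hxG : (x.2.flatten ++ x.1).Perm (block K a l b))
    (hx : (x.2.map (List.map (relType K a))).Perm (shiftedConfigurations K a l (block K a l b) P)) :
    totalLength (finish x) ≤ totalLength P + 12 / K * ((block K a l b).map rad).sum := by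
  have hclassify : ∀ v ∈ block K a l b, v ∈ classify K l := fun v hv => (mem_blockItems.1 hv).1
  have hty : ∀ u ∈ block K a l b, ∀ w ∈ block K a l b, _ := fun u hu w hw =>
    cell_eq_and_class_eq_of_relType_eq hu hw
  have hdist : ∀ u ∈ block K a l b, ∀ w ∈ block K a l b, u.cell = w.cell →
      dist (itemPos w) (itemPos u) ≤ 2 / K * dist depot (itemPos u) :=
    fun u hu w hw => dist_itemPos_le hK (hclassify u hu) (hclassify w hw)
  have hxG' : ∀ t ∈ x.2, ∀ v ∈ t, v ∈ block K a l b := fun t ht v hv =>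
    hxG.mem_iff.1 (List.mem_append_left _ (List.mem_flatten_of_mem ht hv))
  have hcapacity := sum_le_one_of_perm_shiftedTypes hty
    (fun u hu => hdemand _ (mem_classify.1 (hclassify u hu)).1)
    (fun u _ w hw => demand_le_of_itemRank_le (hclassify w hw))
    (fun t ht u hu => hP.1.mem_iff.1 (List.mem_flatten_of_mem ht hu)) hxG' hx hP.2
  have htours : totalLength x.2 ≤ totalLength P + 2 * (2 / K) * ((block K a l b).map rad).sum :=
    sum_walk_le_of_perm_shiftedTypes hty (by positivity) hdist hP.1 hxG' hx
  have hrest : K * (x.1.map rad).sum ≤ (1 + 2 / K) ^ 2 * ((block K a l b).map rad).sum :=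
    (isRanking_block hl).mul_sum_rest_le hty (fun _ => cellShift_mul_le) (by positivity)
      hdist hP.1 hxG hx
  have hsquare : (1 + 2 / (K : ℝ)) ^ 2 ≤ 2 ^ 2 := by
    have := two_div_le_one hK
    gcongr
    linarith
  have hrest' : (x.1.map rad).sum ≤ 4 / K * ((block K a l b).map rad).sum := by
    rw [div_mul_eq_mul_div, le_div_iff₀ (by positivity), mul_comm]
    refine hrest.trans (mul_le_mul_of_nonneg_right (hsquare.trans ?_) (sum_map_rad_nonneg _))
    norm_num
  calc totalLength (finish x) = totalLength x.2 + 2 * (x.1.map rad).sum :=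
        totalLength_finish hcapacity
    _ ≤ totalLength P + 2 * (2 / K) * ((block K a l b).map rad).sum +
          2 * (4 / K * ((block K a l b).map rad).sum) := by
        gcongr
    _ = totalLength P + 12 / K * ((block K a l b).map rad).sum := by ring

theorem totalLength_solveBlock_le (hK : 1 < K) (hCs : ListsConfigurations K k Cs)
    (hl : (l.map Terminal.index).Nodup) (hdemand : ∀ v ∈ l, 0 ≤ v.demand)
    (hP : Packs P (block K a l b)) (hPk : ∀ t ∈ P, t.length ≤ k) :
    totalLength (solveBlock K a Cs (block K a l b)) ≤
      (1 + (1 / 2) ^ K) * (totalLength P + 12 / K * ((block K a l b).map rad).sum) := by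
  obtain ⟨x, hx, hxP⟩ := exists_mem_states_shiftedConfigurations hK hCs hl hP.filter_ne_nil.1
    (fun t ht => hPk t (List.mem_of_mem_filter ht))
    (fun t ht => by simpa using List.of_mem_filter ht)
  have hfinish := totalLength_finish_le hK hl hdemand hP.filter_ne_nil (states_perm hx) hxP
  rw [totalLength_filter_ne_nil] at hfinish
  exact (totalLength_best_le K _ (List.mem_map_of_mem hx)).trans
    (mul_le_mul_of_nonneg_left hfinish (by positivity))

end Block

/-! ### Averaging over the shifts -/

theorem totalLength_flatMap {β : Type*} (L : List β) (f : β → List (List Item)) :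
    totalLength (L.flatMap f) = (L.map fun b => totalLength (f b)).sum := by
  induction L with
  | nil => rfl
  | cons b L ih => rw [List.flatMap_cons, totalLength_append, ih, List.map_cons, List.sum_cons]

theorem sum_map_sum_map_comm {β γ M : Type*} [AddCommMonoid M] (L : List β) (S : List γ)
    (f : β → γ → M) : (L.map fun b => (S.map (f b)).sum).sum =
      (S.map fun c => (L.map fun b => f b c).sum).sum := by
  simpa using Multiset.sum_map_sum_map (L : Multiset β) (S : Multiset γ) (f := f)

theorem Packs.blockItems {P : List (List Item)} {l : List Item} (h : Packs P l)
    (hdemand : ∀ v ∈ l, 0 ≤ v.demand) (K a : ℕ) (b : ℤ) :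
    Packs (P.map fun t => blockItems K a t b) (blockItems K a l b) := by
  refine ⟨?_, fun t ht => ?_⟩
  · simpa only [CVRP.blockItems, inner, List.filter_filter, List.filter_flatten] using
      h.1.filter _
  · obtain ⟨t, htP, rfl⟩ := List.mem_map.1 ht
    refine (((blockItems_sublist K a t b).map _).sum_le_sum ?_).trans (h.2 t htP)
    exact List.forall_mem_map.2 fun v hv =>
      hdemand v (h.1.mem_iff.1 (List.mem_flatten_of_mem htP hv))

theorem sum_sum_rad_blockItems_le (K a : ℕ) (l : List Item) :
    ((blocks K a l).map fun b => ((blockItems K a l b).map rad).sum).sum ≤ (l.map rad).sum := by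
  have hperm := ((blocks_flatMap_blockItems_perm K a (l := l) fun _ => id).map rad).sum_eq
  rw [List.map_flatMap, List.flatMap_def, List.sum_flatten, List.map_map] at hperm
  exact hperm.trans_le (sum_map_rad_sublist List.filter_sublist)

section

variable {K k : ℕ} {l : List Terminal} {Cs : List (List (Cell × ℕ))} {P : List (List Item)}

theorem sum_totalLength_blockItems_le (hK : 1 < K) (a : ℕ) (hP : ∀ t ∈ P, ∀ v ∈ t, v ∈ classify K l)
    (hPk : ∀ t ∈ P, t.length ≤ k) : ((blocks K a (classify K l)).map fun b =>
      totalLength (P.map fun t => blockItems K a t b)).sum ≤ (1 + 2 * k / K) * totalLength P := by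
  simp only [totalLength, List.map_map, Function.comp_def]
  rw [sum_map_sum_map_comm, ← List.sum_map_mul_left]
  exact List.sum_le_sum fun t ht => sum_tourLength_blockItems_le hK (hP t ht) (hPk t ht)

theorem totalLength_solveShift_le (hK : 1 < K) (a : ℕ) (hCs : ListsConfigurations K k Cs)
    (hl : (l.map Terminal.index).Nodup) (hdemand : ∀ v ∈ l, 0 ≤ v.demand)
    (hP : Packs P (classify K l)) (hPk : ∀ t ∈ P, t.length ≤ k) :
    totalLength (solveShift K a Cs (classify K l)) ≤
      2 * (((classify K l).filter fun v => Separates K a v).map rad).sum +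
        (1 + (1 / 2) ^ K) * ((1 + 2 * k / K) * totalLength P +
          12 / K * ((classify K l).map rad).sum) := by
  rw [solveShift, totalLength_append, totalLength_singletons, totalLength_flatMap]
  refine add_le_add_right ?_ _
  have hblock : ∀ b ∈ blocks K a (classify K l), _ := fun b _ =>
    totalLength_solveBlock_le hK hCs hl hdemand
      (hP.blockItems (fun v hv => hdemand _ (mem_classify.1 hv).1) K a b)
      (List.forall_mem_map.2 fun t ht =>
        (blockItems_sublist K a t b).length_le.trans (hPk t ht))
  refine (List.sum_le_sum hblock).trans ?_
  rw [List.sum_map_mul_left, List.sum_map_add, List.sum_map_mul_left]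
  gcongr
  · exact sum_totalLength_blockItems_le hK a
      (fun t ht v hv => hP.1.mem_iff.1 (List.mem_flatten_of_mem ht hv)) hPk
  · exact sum_sum_rad_blockItems_le ..

theorem eq_of_separates {a b : ℕ} {v : Item} (ha : a < K) (hb : b < K)
    (hav : Separates K a v) (hbv : Separates K b v) : a = b := by
  have hdvd := dvd_sub (Int.dvd_of_emod_eq_zero hav) (Int.dvd_of_emod_eq_zero hbv)
  have := Int.eq_zero_of_abs_lt_dvd hdvd (by rw [abs_lt]; constructor <;> omega)
  omega

theorem sum_rad_filter_separates_le (K : ℕ) (l : List Item) :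
    ∑ a ∈ Finset.range K, ((l.filter fun v => Separates K a v).map rad).sum ≤
      (l.map rad).sum := by
  induction l with
  | nil => simp
  | cons v l ih =>
    have hcons : ∀ a, (((v :: l).filter fun v => Separates K a v).map rad).sum =
        (if Separates K a v then rad v else 0) +
          ((l.filter fun v => Separates K a v).map rad).sum := fun a => by
      rw [List.filter_cons]
      split_ifs <;> simp_all
    simp only [hcons, Finset.sum_add_distrib, List.map_cons, List.sum_cons]
    refine add_le_add ?_ ih
    rw [Finset.sum_ite_zero _ _ fun a ha b hb => eq_of_separates (Finset.mem_range.1 ha)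
      (Finset.mem_range.1 hb)]
    split_ifs
    exacts [le_rfl, rad_nonneg v]

theorem exists_mul_sum_rad_filter_separates_le (hK : 0 < K) (l : List Item) :
    ∃ a ∈ List.range K, K * ((l.filter fun v => Separates K a v).map rad).sum ≤
      (l.map rad).sum := by
  simp only [List.mem_range, ← Finset.mem_range]
  refine Finset.exists_le_of_sum_le (Finset.nonempty_range_iff.2 hK.ne') ?_
  rw [← Finset.mul_sum, Finset.sum_const, Finset.card_range, nsmul_eq_mul]
  exact mul_le_mul_of_nonneg_left (sum_rad_filter_separates_le K l) (Nat.cast_nonneg K)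

theorem totalLength_solve_le (hK : 1 < K) (hCs : ListsConfigurations K k Cs)
    (hl : (l.map Terminal.index).Nodup) (hdemand : ∀ v ∈ l, 0 ≤ v.demand)
    (hP : Packs P (classify K l)) (hPk : ∀ t ∈ P, t.length ≤ k) :
    totalLength (solve K Cs (classify K l)) ≤
      (1 + (1 / 2) ^ K) ^ 2 * (1 + 9 * k / K) * totalLength P := by
  obtain ⟨a, ha, hsep⟩ := exists_mul_sum_rad_filter_separates_le (by omega : 0 < K) (classify K l)
  have hrad := two_mul_sum_rad_le_totalLength hPk
  rw [(hP.1.map rad).sum_eq] at hrad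
  have hshift := totalLength_solveShift_le hK a hCs hl hdemand hP hPk
  set R := ((classify K l).map rad).sum
  set Q := (((classify K l).filter fun v => Separates K a v).map rad).sum
  set T := totalLength P
  have hT0 : 0 ≤ T := totalLength_nonneg P
  have hQ : 2 * Q ≤ k / K * T := by
    rw [div_mul_eq_mul_div, le_div_iff₀ (by positivity)]
    linarith
  have hR : 12 / K * R ≤ 6 * k / K * T :=
    calc 12 / K * R = 6 / K * (2 * R) := by ring
      _ ≤ 6 / K * (k * T) := by gcongr
      _ = 6 * k / K * T := by ring
  have hQ' : k / K * T ≤ (1 + (1 / 2) ^ K) * (k / K * T) :=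
    le_mul_of_one_le_left (by positivity) (le_add_of_nonneg_right (by positivity))
  calc totalLength (solve K Cs (classify K l))
      ≤ (1 + (1 / 2) ^ K) * totalLength (solveShift K a Cs (classify K l)) :=
        totalLength_best_le K _ (List.mem_map_of_mem ha)
    _ ≤ (1 + (1 / 2) ^ K) * ((1 + (1 / 2) ^ K) * (k / K * T) +
          (1 + (1 / 2) ^ K) * ((1 + 2 * k / K) * T + 6 * k / K * T)) := by
        gcongr
        exact hshift.trans (add_le_add (hQ.trans hQ') (by gcongr))
    _ = (1 + (1 / 2) ^ K) ^ 2 * (1 + 9 * k / K) * T := by ring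

end

/-! ### Instances and solutions -/

theorem walk_map_congr {α E F : Type*} [MetricSpace E] [MetricSpace F] {f : α → E} {g : α → F}
    (h : ∀ a b, dist (f a) (f b) = dist (g a) (g b)) (x z : α) (l : List α) :
    walk (f x) (l.map f) (f z) = walk (g x) (l.map g) (g z) := by
  induction l generalizing x with
  | nil => simp [walk_nil, h]
  | cons a l ih => rw [List.map_cons, List.map_cons, walk_cons, walk_cons, ih, h]

/-- The terminals that a tour covers, in the order in which it visits them. -/
def Tour.coveredRoute {n : ℕ} (t : Tour n) : List (Fin n) :=
  t.route.reduceOption.dedup.filter fun v => v ∈ t.covered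

theorem Tour.coveredRoute_perm {n : ℕ} {t : Tour n} (hnodup : t.covered.Nodup)
    (hvisits : ∀ v ∈ t.covered, some v ∈ t.route) : t.coveredRoute.Perm t.covered := by
  rw [coveredRoute, List.perm_ext_iff_of_nodup ((List.nodup_dedup _).filter _) hnodup]
  intro v
  simpa [List.reduceOption_mem_iff] using hvisits v

theorem map_some_reduceOption_sublist {α : Type*} (l : List (Option α)) :
    (l.reduceOption.map some).Sublist l := by
  induction l with
  | nil => exact .slnil
  | cons a l ih =>
    cases a with
    | none => exact ih.cons none
    | some a => exact ih.cons_cons (some a)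

theorem Tour.map_some_coveredRoute_sublist {n : ℕ} (t : Tour n) :
    (t.coveredRoute.map some).Sublist t.route :=
  ((List.filter_sublist.trans (List.dedup_sublist _)).map some).trans
    (map_some_reduceOption_sublist t.route)

/-- The solution whose tours visit exactly the given terminals in the given order. -/
def Solution.ofLists {n : ℕ} (Q : List (List (Fin n))) : Solution n :=
  Q.map fun t => ⟨t.map some, t⟩

namespace Instance

variable (I : Instance)

/-- The data of an instance, from which the algorithm works. -/
def data : (ℚ × ℚ) × List ((ℚ × ℚ) × ℚ) := (I.depot, List.ofFn fun i => (I.loc i, I.demand i))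

theorem encode_eq_toData : I.encode = toData I.data := by
  simp only [encode, toData, data, List.map_ofFn]
  rfl

/-- The terminal with index `i` as the algorithm sees it. -/
def terminal (i : Fin I.n) : Terminal :=
  ⟨i + 1, ((I.loc i).1 - I.depot.1, (I.loc i).2 - I.depot.2), I.demand i⟩

theorem terminals_data : terminals I.data = List.ofFn I.terminal :=
  List.ext_getElem (by simp [terminals, data]) fun i _ _ => by
    simp [terminals, data, terminal]

/-- The terminal with index `i` together with its cell and demand class. -/
def item (K : ℕ) (i : Fin I.n) : Item :=
  classifyTerminal K (List.ofFn I.terminal) (I.terminal i)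

theorem classify_ofFn_terminal (K : ℕ) :
    classify K (List.ofFn I.terminal) = (List.finRange I.n).map (I.item K) := by
  rw [classify, ← List.ofFn_eq_map, List.map_ofFn]
  rfl

theorem index_terminal_injective : Function.Injective fun i => (I.terminal i).index :=
  fun _ _ h => Fin.ext (Nat.succ_injective h)

theorem nodup_map_index_terminal : ((List.ofFn I.terminal).map Terminal.index).Nodup := by
  rw [List.map_ofFn]
  exact List.nodup_ofFn_ofInjective I.index_terminal_injective

theorem item_injective (K : ℕ) : Function.Injective (I.item K) :=
  fun _ _ h => I.index_terminal_injective (congrArg (fun v : Item => v.index) h)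

theorem tourCost_eq_walk (t : Tour I.n) :
    I.tourCost t = walk (I.pos none) (t.route.map I.pos) (I.pos none) := by
  simp [tourCost, walk]

theorem tourLength_map_item (K : ℕ) (t : List (Fin I.n)) :
    tourLength (t.map (I.item K)) =
      walk (I.pos none) ((t.map some).map I.pos) (I.pos none) := by
  let relativePos : Vertex I.n → EuclideanSpace ℝ (Fin 2) :=
    fun v => v.elim CVRP.depot fun i => itemPos (I.item K i)
  have hdist : ∀ v w, dist (relativePos v) (relativePos w) = dist (I.pos v) (I.pos w) := by
    rintro (_ | i) (_ | j) <;>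
      simp only [relativePos, Option.elim, CVRP.depot, itemPos, pos, dist_toPlane, item,
        classifyTerminal, terminal] <;>
      congr 1 <;> push_cast <;> ring
  rw [← walk_map_congr hdist none none (t.map some), List.map_map, tourLength, List.map_map]
  rfl

variable {I}

theorem Feasible.flatMap_covered_perm {S : Solution I.n} (hS : I.Feasible S) :
    (S.flatMap Tour.covered).Perm (List.finRange I.n) :=
  List.perm_iff_count.2 fun v => (hS.covers v).trans
    (List.count_eq_one_of_mem (List.nodup_finRange _) (List.mem_finRange v)).symm

theorem Feasible.coveredRoute_perm {S : Solution I.n} (hS : I.Feasible S) {t : Tour I.n}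
    (ht : t ∈ S) : t.coveredRoute.Perm t.covered :=
  Tour.coveredRoute_perm ((List.nodup_flatMap.1
    (hS.flatMap_covered_perm.nodup_iff.2 (List.nodup_finRange _))).1 t ht) (hS.visits t ht)

theorem Feasible.packs {S : Solution I.n} (hS : I.Feasible S) (K : ℕ) :
    Packs (S.map fun t => t.coveredRoute.map (I.item K)) (classify K (List.ofFn I.terminal)) := by
  refine ⟨?_, List.forall_mem_map.2 fun t ht => ?_⟩
  · rw [classify_ofFn_terminal, ← List.flatMap_def, ← List.map_flatMap]
    exact ((List.Perm.flatMap_left S fun t ht => hS.coveredRoute_perm ht).trans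
      hS.flatMap_covered_perm).map _
  · rw [List.map_map]
    exact ((hS.coveredRoute_perm ht).map I.demand).sum_eq.trans_le (hS.capacity t ht)

theorem totalLength_coveredRoute_le_cost (K : ℕ) (S : Solution I.n) :
    totalLength (S.map fun t => t.coveredRoute.map (I.item K)) ≤ I.cost S := by
  rw [totalLength, List.map_map, cost]
  refine List.sum_le_sum fun t _ => ?_
  rw [Function.comp_apply, tourLength_map_item, tourCost_eq_walk]
  exact walk_sublist (t.map_some_coveredRoute_sublist.map _) _ _

theorem exists_eq_map_map_item {K : ℕ} {P : List (List Item)}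
    (hP : P.flatten.Perm (classify K (List.ofFn I.terminal))) :
    ∃ Q : List (List (Fin I.n)), Q.flatten.Perm (List.finRange I.n) ∧
      Q.map (List.map (I.item K)) = P := by
  rw [classify_ofFn_terminal] at hP
  have hrange : P ∈ Set.range (List.map (List.map (I.item K))) := by
    simp only [Set.range_list_map, Set.mem_ofPred_eq]
    intro t ht v hv
    obtain ⟨i, -, hi⟩ := List.mem_map.1 (hP.mem_iff.1 (List.mem_flatten_of_mem ht hv))
    exact ⟨i, hi⟩
  obtain ⟨Q, rfl⟩ := hrange
  rw [← List.map_flatten] at hP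
  exact ⟨Q, (List.map_perm_map_iff (I.item_injective K)).1 hP, rfl⟩

theorem feasible_ofLists {Q : List (List (Fin I.n))} (hQ : Q.flatten.Perm (List.finRange I.n))
    (hcapacity : ∀ t ∈ Q, (t.map I.demand).sum ≤ 1) : I.Feasible (Solution.ofLists Q) where
  visits := List.forall_mem_map.2 fun _ _ _ hv => List.mem_map_of_mem hv
  covers v := by
    have hcovered : (Solution.ofLists Q).flatMap Tour.covered = Q.flatten := by
      simp [Solution.ofLists, List.flatMap_def, Function.comp_def]
    rw [hcovered, hQ.count_eq]
    exact List.count_eq_one_of_mem (List.nodup_finRange _) (List.mem_finRange v)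
  capacity := List.forall_mem_map.2 hcapacity

theorem cost_ofLists (K : ℕ) (Q : List (List (Fin I.n))) :
    I.cost (Solution.ofLists Q) = totalLength (Q.map (List.map (I.item K))) := by
  simp only [cost, Solution.ofLists, totalLength, List.map_map, Function.comp_def,
    tourCost_eq_walk, tourLength_map_item]

theorem encode_ofLists (K : ℕ) (Q : List (List (Fin I.n))) :
    (Solution.ofLists Q).encode = toData ((Q.map (List.map (I.item K))).map fun t =>
      (t.map fun v => v.index, t.map fun v => v.index)) := by
  simp only [Solution.encode, Solution.ofLists, toData, List.map_map]
  congr 1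
  refine List.map_congr_left fun t _ => ?_
  simp only [Function.comp_apply, Tour.encode, List.map_map]
  rfl

theorem exists_feasible_of_packs {K : ℕ} {P : List (List Item)}
    (hP : Packs P (classify K (List.ofFn I.terminal))) :
    ∃ S : Solution I.n, I.Feasible S ∧ I.cost S = totalLength P ∧
      S.encode = toData (P.map fun t => (t.map fun v => v.index, t.map fun v => v.index)) := by
  obtain ⟨Q, hQ, rfl⟩ := exists_eq_map_map_item hP.1
  refine ⟨.ofLists Q, feasible_ofLists hQ fun t ht => ?_, cost_ofLists K Q, encode_ofLists K Q⟩
  have hcapacity := hP.2 _ (List.mem_map_of_mem ht)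
  rwa [List.map_map] at hcapacity

theorem exists_feasible_algorithm (I : Instance) (K : ℕ) (Cs : List (List (Cell × ℕ))) :
    ∃ S : Solution I.n, I.Feasible S ∧
      I.cost S = totalLength (solve K Cs (classify K (List.ofFn I.terminal))) ∧
      S.encode = toData (algorithm K Cs I.data) := by
  rw [algorithm, terminals_data]
  refine exists_feasible_of_packs (packs_solve K Cs fun v hv => ?_)
  obtain ⟨i, hi⟩ := List.mem_ofFn.1 (mem_classify.1 hv).1
  exact hi ▸ I.demand_le_one i

end Instance

theorem length_le_of_le_demand {ε : ℝ} {k : ℕ} (hε : 0 < ε) (hk : 1 / ε ≤ k) {t : List Item}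
    (ht : ∀ v ∈ t, ε ≤ v.demand) (hcapacity : (t.map fun v => v.demand).sum ≤ 1) :
    t.length ≤ k := by
  have hsum : t.length * ε ≤ 1 :=
    calc t.length * ε = (t.map fun v => (v.demand : ℝ)).length • ε := by simp
      _ ≤ (t.map fun v => (v.demand : ℝ)).sum :=
        List.card_nsmul_le_sum _ _ (List.forall_mem_map.2 ht)
      _ = ((t.map fun v => v.demand).sum : ℚ) := by
        rw [Rat.cast_list_sum, List.map_map, Function.comp_def]
      _ ≤ 1 := by exact_mod_cast hcapacity
  exact_mod_cast ((le_div_iff₀ hε).2 hsum).trans hk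

theorem totalLength_solve_le_cost {ε : ℝ} (hε : 0 < ε) {k K : ℕ} (hk : 1 / ε ≤ k) (hK : 1 < K)
    {Cs : List (List (Cell × ℕ))} (hCs : ListsConfigurations K k Cs) {I : Instance}
    (hI : I.AllBig ε) {S : Solution I.n} (hS : I.Feasible S) :
    totalLength (solve K Cs (classify K (List.ofFn I.terminal))) ≤
      (1 + (1 / 2) ^ K) ^ 2 * (1 + 9 * k / K) * I.cost S := by
  have hpacks := hS.packs K
  refine (totalLength_solve_le hK hCs I.nodup_map_index_terminal (fun v hv => ?_) hpacks
    fun t ht => length_le_of_le_demand hε hk (fun v hv => ?_) (hpacks.2 t ht)).trans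
    (mul_le_mul_of_nonneg_left (Instance.totalLength_coveredRoute_le_cost K S) (by positivity))
  · obtain ⟨i, rfl⟩ := List.mem_ofFn.1 hv
    exact (I.demand_pos i).le
  · have hv' := hpacks.1.mem_iff.1 (List.mem_flatten_of_mem ht hv)
    obtain ⟨i, hi⟩ := List.mem_ofFn.1 (mem_classify.1 hv').1
    exact hi ▸ hI i

theorem half_pow_le {k : ℕ} (hk : 0 < k) :
    (1 / 2 : ℝ) ^ (100 * k ^ 2) ≤ 1 / k / 100 := by
  have hpow : 100 * k ≤ 2 ^ (100 * k ^ 2) :=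
    (Nat.mul_le_mul_left 100 (Nat.le_self_pow two_ne_zero k)).trans Nat.lt_two_pow_self.le
  rw [one_div_pow, div_div, mul_comm (k : ℝ)]
  exact one_div_le_one_div_of_le (by positivity) (by exact_mod_cast hpow)

theorem exists_parameters {ε : ℝ} (hε : 0 < ε) : ∃ k K : ℕ, 1 / ε ≤ k ∧ 1 < K ∧
    (1 + (1 / 2 : ℝ) ^ K) ^ 2 * (1 + 9 * k / K) ≤ 1 + ε := by
  obtain ⟨k, hk, hk0⟩ : ∃ k : ℕ, 1 / ε ≤ k ∧ 0 < k :=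
    ⟨⌈1 / ε⌉₊, Nat.le_ceil _, Nat.ceil_pos.2 (by positivity)⟩
  refine ⟨k, 100 * k ^ 2, hk, by nlinarith, ?_⟩
  have hpow := half_pow_le hk0
  have hratio : 9 * k / ((100 * k ^ 2 : ℕ) : ℝ) = 9 * (1 / k) / 100 := by
    push_cast
    field_simp
  have hxε : 1 / (k : ℝ) ≤ ε := (one_div_le (by positivity) hε).2 hk
  have hx1 : 1 / (k : ℝ) ≤ 1 := div_le_one_of_le₀ (by exact_mod_cast hk0) (by positivity)
  have hx0 : 0 < 1 / (k : ℝ) := by positivity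
  rw [hratio]
  set x : ℝ := 1 / k
  calc _ ≤ (1 + x / 100) ^ 2 * (1 + 9 * x / 100) := by gcongr
    _ ≤ 1 + x := by
      nlinarith [mul_nonneg hx0.le (sub_nonneg.2 hx1), mul_pos (mul_pos hx0 hx0) hx0,
        mul_le_mul_of_nonneg_left hx1 (mul_pos hx0 hx0).le]
    _ ≤ 1 + ε := by gcongr

end CVRP

/-- For every `ε > 0` there is a polynomial-time `(1 + ε)`-approximation algorithm for the
unsplittable Euclidean capacitated vehicle routing problem on instances all of whose terminals
have demand at least `ε`. -/
theorem theorem2 (ε : ℝ) (hε : 0 < ε) :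
    ∃ A : Machine.Program,
      CVRP.IsPolyTimeApproxAlgorithm A (fun I => I.AllBig ε) (1 + ε) := by
  obtain ⟨k, K, hk, hK, hratio⟩ := CVRP.exists_parameters hε
  obtain ⟨Cs, hCs⟩ := CVRP.exists_listsConfigurations K k
  obtain ⟨A, t, ⟨p, hp⟩, hA⟩ := CVRP.polyTime_algorithm hK Cs
  refine ⟨A, p, fun I hI => ?_⟩
  obtain ⟨S, hS, hcost, hencode⟩ := I.exists_feasible_algorithm K Cs
  rw [I.encode_eq_toData]
  refine ⟨S, t I.data, hencode ▸ hA I.data, hp I.data, hS, fun S' hS' => ?_⟩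
  calc I.cost S ≤ (1 + (1 / 2) ^ K) ^ 2 * (1 + 9 * k / K) * I.cost S' :=
        hcost.trans_le (CVRP.totalLength_solve_le_cost hε hk hK hCs hI hS')
    _ ≤ (1 + ε) * I.cost S' := mul_le_mul_of_nonneg_right hratio
        (List.sum_nonneg (List.forall_mem_map.2 fun t _ =>
          (I.tourCost_eq_walk t).symm ▸ CVRP.walk_nonneg ..))
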